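/- Let $N\in\mathbb N$ and let $\mu\ge 0$, $\mu\in L^1(\mathbb R^N)$, be the density with respect to Lebesgue measure of a probability measure $d\mu=\mu\,dx$ on $\mathbb R^N$. Assume that $\mu\in H^1_{\rm loc}(\mathbb R^N)$, that $\frac{\nabla\mu}{\mu}\in L^r_{\rm loc}(\mathbb R^N,\mathbb R^N)$ for some $r>N$ (where $\nabla\mu$ is the weak gradient), and that $\mu$ is (essentially) bounded away from $0$ on every compact subset of $\mathbb R^N$. Let $(L,D(L))$ be the closure in the complex space $L^2_\mu:=L^2(\mathbb R^N,d\mu)$ of the operator $L\varphi=\Delta\varphi+\frac{\nabla\mu}{\mu}\cdot\nabla\varphi$, $\varphi\in C_c^\infty(\mathbb R^N)$, and let $(A,D(A))$ be the operator in $L^2_\mu$ associated with the sesquilinear form $a_L(u,v)=\int_{\mathbb R^N}Lu\,\overline{Lv}\,d\mu$, $u,v\in D(L)$; that is, $u\in D(A)$ and $Au=w$ if and only if $u\in D(L)$, $w\in L^2_\mu$ and $a_L(u,v)=\int_{\mathbb R^N}w\,\overline v\,d\mu$ for all $v\in D(L)$. Assume that there is $n\in\mathbb N$ such that $D(A^n)\subset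 L^\infty_{\rm loc}(\mathbb R^N)$. Then $-A$ generates a $C_0$-semigroup $(e^{-tA})_{t\ge0}$ on $L^2_\mu$, and this semigroup is locally individually eventually positive: for every compact set $K\subset\mathbb R^N$ and every $f\in L^2_\mu$ such that $f\ge0$ a.e. on $K$ and $f>0$ on a subset of $K$ of positive Lebesgue measure, there exist $c>0$ and $t_0>0$ such that for every $t\ge t_0$ $$e^{-tA}(\chi_Kf)(x)\ge c\qquad\text{for a.e. }x\in K.$$ -/

import Mathlib

open MeasureTheory Filter Topology
open scoped NNReal ENNReal ContDiff ComplexOrder InnerProductSpace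

noncomputable section

namespace BiKolmogorov

/-! ### Unbounded operators and semigroups on a complex Hilbert space -/

section Abstract

variable {H : Type*} [NormedAddCommGroup H] [InnerProductSpace ℂ H]

/-- A strongly continuous one-parameter semigroup of bounded linear operators. -/
structure C0Semigroup (H : Type*) [NormedAddCommGroup H] [InnerProductSpace ℂ H] where
  /-- the operator at time `t` -/
  op : ℝ≥0 → H →L[ℂ] H
  op_zero : op 0 = ContinuousLinearMap.id ℂ H
  op_add : ∀ s t : ℝ≥0, op (s + t) = (op s).comp (op t)
  tendsto_zero : ∀ x : H, Tendsto (fun t => op t x) (𝓝 0) (𝓝 x)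

/-- `B` is the generator of `T`: `x ∈ D(B)` with `B x = y` if and only if
`t⁻¹ (T(t) x - x) → y` as `t → 0+`. -/
def IsGenerator (T : C0Semigroup H) (B : H →ₗ.[ℂ] H) : Prop :=
  ∀ x y : H, (x, y) ∈ B.graph ↔
    Tendsto (fun t : ℝ≥0 => ((t : ℝ) : ℂ)⁻¹ • (T.op t x - x)) (𝓝[>] 0) (𝓝 y)

/-- The domain of the `n`-th power of an operator: `D(A ^ 0) = H` and
`D(A ^ (n + 1)) = {x ∈ D(A) | A x ∈ D(A ^ n)}`. -/
def powDomain (A : H →ₗ.[ℂ] H) : ℕ → Set H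
  | 0 => Set.univ
  | n + 1 => {x | ∃ hx : x ∈ A.domain, A ⟨x, hx⟩ ∈ powDomain A n}

/-- The graph of the operator associated with the sesquilinear form `(u, v) ↦ (L u, L v)`,
`u, v ∈ D(L)`: the pairs `(u, w)` with `u ∈ D(L)` and `(L u, L v) = (w, v)` for all `v ∈ D(L)`.
(Mathlib's inner product is antilinear in its first argument.) -/
def squareFormGraph (L : H →ₗ.[ℂ] H) : Submodule ℂ (H × H) where
  carrier := {p | ∃ u : L.domain, (u : H) = p.1 ∧
    ∀ v : L.domain, ⟪L v, L u⟫_ℂ = ⟪(v : H), p.2⟫_ℂ}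
  zero_mem' := ⟨0, rfl, fun v => by simp⟩
  add_mem' := by
    rintro ⟨a, b⟩ ⟨c, d⟩ ⟨u, hu, h⟩ ⟨u', hu', h'⟩
    refine ⟨u + u', by simp_all, fun v => ?_⟩
    simp only [LinearPMap.map_add, inner_add_right, Prod.mk_add_mk, h v, h' v]
  smul_mem' := by
    rintro k ⟨a, b⟩ ⟨u, hu, h⟩
    refine ⟨k • u, by simp_all, fun v => ?_⟩
    simp only [LinearPMap.map_smul, inner_smul_right, Prod.smul_mk, h v]

/-- The operator associated with the sesquilinear form `(u, v) ↦ (L u, L v)` on `D(L)`. -/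
def squareFormOperator (L : H →ₗ.[ℂ] H) : H →ₗ.[ℂ] H :=
  (squareFormGraph L).toLinearPMap

/-- For a densely defined `L` the graph above is the graph of `squareFormOperator L`. -/
theorem squareFormOperator_graph {L : H →ₗ.[ℂ] H} (hL : Dense (L.domain : Set H)) :
    (squareFormOperator L).graph = squareFormGraph L := by
  refine Submodule.toLinearPMap_graph_eq _ ?_
  rintro ⟨a, b⟩ ⟨u, hu, h⟩ (rfl : a = 0)
  have hu0 : u = 0 := Subtype.ext hu
  subst hu0
  refine hL.eq_zero_of_inner_left ℂ fun v hv => ?_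
  have := h ⟨v, hv⟩
  rw [LinearPMap.map_zero, inner_zero_right] at this
  exact inner_eq_zero_symm.mp this.symm

end Abstract

/-! ### Weak gradients and the hypotheses on the density -/

/-- `ℝ^N` with the Euclidean norm. -/
abbrev Sp (N : ℕ) : Type := EuclideanSpace ℝ (Fin N)

variable {N : ℕ}

/-- `f ∈ L^p_loc(ℝ^N)` with respect to Lebesgue measure. -/
def LocMemLp {F : Type*} [NormedAddCommGroup F] (f : Sp N → F) (p : ℝ≥0∞) : Prop :=
  ∀ K : Set (Sp N), IsCompact K → MemLp f p (volume.restrict K)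

/-- `G` is the weak (distributional) gradient of `f`. -/
structure HasWeakGradient (f : Sp N → ℝ) (G : Sp N → Sp N) : Prop where
  locallyIntegrable : LocallyIntegrable f
  locallyIntegrable_grad : LocallyIntegrable G
  integral_eq : ∀ φ : Sp N → ℝ, ContDiff ℝ ∞ φ → HasCompactSupport φ → ∀ v : Sp N,
    ∫ x, f x * fderiv ℝ φ x v = - ∫ x, ⟪G x, v⟫_ℝ * φ x

/-- `ρ` is the density of a probability measure on `ℝ^N`. -/
structure IsProbDensity (ρ : Sp N → ℝ) : Prop where
  nonneg : ∀ᵐ x, 0 ≤ ρ x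
  integrable : Integrable ρ
  integral_eq_one : ∫ x, ρ x = 1

/-- The standing hypothesis on a density `ρ` with weak gradient `∇ρ = G`:
`ρ ∈ H^1_loc`, `∇ρ / ρ ∈ L^r_loc` for some `r > N`, and `ρ` is essentially bounded away from zero
on every compact set. -/
structure HypothesisH1 (ρ : Sp N → ℝ) (G : Sp N → Sp N) : Prop where
  locMemLp : LocMemLp ρ 2
  locMemLp_grad : LocMemLp G 2
  locMemLp_logGrad : ∃ r : ℝ, (N : ℝ) < r ∧ LocMemLp (fun x => (ρ x)⁻¹ • G x) (ENNReal.ofReal r)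
  locallyBoundedBelow : ∀ K : Set (Sp N), IsCompact K →
    ∃ δ : ℝ, 0 < δ ∧ ∀ᵐ x ∂(volume.restrict K), δ ≤ ρ x

/-- The measure `dμ = ρ dx`. -/
def wMeasure (ρ : Sp N → ℝ) : Measure (Sp N) :=
  volume.withDensity fun x => ENNReal.ofReal (ρ x)

/-- The complex Hilbert space `L^2(ℝ^N, dμ)`, where `dμ = ρ dx`. -/
abbrev L2 (ρ : Sp N → ℝ) : Type := Lp ℂ 2 (wMeasure ρ)

/-! ### The Kolmogorov and the bi-Kolmogorov operator -/

/-- `Δ φ + (∇ρ / ρ) · ∇φ`, where `G` stands for `∇ρ`. -/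
def kolmogorovExpr (ρ : Sp N → ℝ) (G : Sp N → Sp N) (φ : Sp N → ℂ) (x : Sp N) : ℂ :=
  Laplacian.laplacian φ x + fderiv ℝ φ x ((ρ x)⁻¹ • G x)

theorem kolmogorovExpr_add (ρ : Sp N → ℝ) (G : Sp N → Sp N) {φ ψ : Sp N → ℂ}
    (hφ : ContDiff ℝ ∞ φ) (hψ : ContDiff ℝ ∞ ψ) (x : Sp N) :
    kolmogorovExpr ρ G (φ + ψ) x = kolmogorovExpr ρ G φ x + kolmogorovExpr ρ G ψ x := by
  have h2 : ((2 : ℕ∞) : WithTop ℕ∞) ≤ ((⊤ : ℕ∞) : WithTop ℕ∞) := WithTop.coe_le_coe.mpr le_top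
  have h0 : ((⊤ : ℕ∞) : WithTop ℕ∞) ≠ 0 := by simp
  simp only [kolmogorovExpr]
  rw [ContDiffAt.laplacian_add (hφ.of_le h2).contDiffAt (hψ.of_le h2).contDiffAt,
    fderiv_add (hφ.differentiable h0 x) (hψ.differentiable h0 x)]
  simp only [_root_.add_apply]
  ring

theorem kolmogorovExpr_smul (ρ : Sp N → ℝ) (G : Sp N → Sp N) (c : ℂ) {φ : Sp N → ℂ}
    (hφ : ContDiff ℝ ∞ φ) (x : Sp N) :
    kolmogorovExpr ρ G (c • φ) x = c * kolmogorovExpr ρ G φ x := by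
  have h2 : ((2 : ℕ∞) : WithTop ℕ∞) ≤ ((⊤ : ℕ∞) : WithTop ℕ∞) := WithTop.coe_le_coe.mpr le_top
  have h0 : ((⊤ : ℕ∞) : WithTop ℕ∞) ≠ 0 := by simp
  have hl : Laplacian.laplacian (c • φ) x = c * Laplacian.laplacian φ x :=
    InnerProductSpace.laplacian_smul c (hφ.of_le h2).contDiffAt
  have hd : fderiv ℝ (c • φ) x = c • fderiv ℝ φ x :=
    fderiv_const_smul (hφ.differentiable h0 x) c
  simp only [kolmogorovExpr, hl, hd, _root_.smul_apply, smul_eq_mul]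
  ring

/-- The graph of `(L, C_c^∞(ℝ^N))` in `L^2(dμ) × L^2(dμ)`: the pairs of classes
`(φ, Δφ + (∇ρ / ρ) · ∇φ)` with `φ` a complex-valued test function. -/
def kolmogorovCoreGraph (ρ : Sp N → ℝ) (G : Sp N → Sp N) : Submodule ℂ (L2 ρ × L2 ρ) where
  carrier := {p | ∃ φ : Sp N → ℂ, ContDiff ℝ ∞ φ ∧ HasCompactSupport φ ∧
    p.1 =ᵐ[wMeasure ρ] φ ∧ p.2 =ᵐ[wMeasure ρ] kolmogorovExpr ρ G φ}
  zero_mem' := by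
    refine ⟨0, contDiff_const, HasCompactSupport.zero, Lp.coeFn_zero _ _ _, ?_⟩
    have h : kolmogorovExpr ρ G (0 : Sp N → ℂ) = 0 := by
      funext x
      simpa using kolmogorovExpr_smul ρ G 0 (φ := 0) contDiff_const x
    rw [h]
    exact Lp.coeFn_zero _ _ _
  add_mem' := by
    rintro ⟨a, b⟩ ⟨c, d⟩ ⟨φ, h1, h2, h3, h4⟩ ⟨ψ, k1, k2, k3, k4⟩
    refine ⟨φ + ψ, h1.add k1, h2.add k2, (Lp.coeFn_add _ _).trans (h3.add k3), ?_⟩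
    refine (Lp.coeFn_add _ _).trans ((h4.add k4).trans (Eventually.of_forall fun x => ?_))
    exact (kolmogorovExpr_add ρ G h1 k1 x).symm
  smul_mem' := by
    rintro k ⟨a, b⟩ ⟨φ, h1, h2, h3, h4⟩
    refine ⟨k • φ, contDiff_const.smul h1, h2.smul_left (f := fun _ => k),
      (Lp.coeFn_smul _ _).trans (h3.const_smul k), ?_⟩
    refine (Lp.coeFn_smul _ _).trans
      ((h4.const_smul k).trans (Eventually.of_forall fun x => ?_))
    exact (kolmogorovExpr_smul ρ G k h1 x).symm

/-- If `ρ` is locally bounded away from zero, then Lebesgue measure and `dμ` have the same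
null sets. -/
theorem volume_absolutelyContinuous {ρ : Sp N → ℝ} {G : Sp N → Sp N} (hρ : IsProbDensity ρ)
    (h1 : HypothesisH1 ρ G) : (volume : Measure (Sp N)) ≪ wMeasure ρ := by
  have hpos : ∀ᵐ x : Sp N, 0 < ρ x := by
    have h : ∀ n : ℕ, ∀ᵐ x : Sp N, x ∈ Metric.closedBall (0 : Sp N) n → 0 < ρ x := by
      intro n
      obtain ⟨δ, hδ, h⟩ := h1.locallyBoundedBelow _ (isCompact_closedBall (0 : Sp N) n)
      rw [ae_restrict_iff' Metric.isClosed_closedBall.measurableSet] at h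
      filter_upwards [h] with x hx hxn using hδ.trans_le (hx hxn)
    filter_upwards [ae_all_iff.mpr h] with x hx
    obtain ⟨n, hn⟩ := exists_nat_ge ‖x‖
    exact hx n (by simpa using hn)
  refine withDensity_absolutelyContinuous' hρ.integrable.aemeasurable.ennreal_ofReal ?_
  filter_upwards [hpos] with x hx
  simpa using hx

/-- Under the standing hypothesis the graph of `(L, C_c^∞(ℝ^N))` is single-valued, so that it is
the graph of the operator `kolmogorovCore` below. -/
theorem kolmogorovCoreGraph_singleValued {ρ : Sp N → ℝ} {G : Sp N → Sp N}
    (hρ : IsProbDensity ρ) (h1 : HypothesisH1 ρ G) (p : L2 ρ × L2 ρ)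
    (hp : p ∈ kolmogorovCoreGraph ρ G) (h0 : p.1 = 0) : p.2 = 0 := by
  obtain ⟨φ, h2, -, h3, h4⟩ := hp
  rw [h0] at h3
  have h5 : φ =ᵐ[volume] 0 :=
    (volume_absolutelyContinuous hρ h1).ae_le (h3.symm.trans (Lp.coeFn_zero _ _ _))
  have h6 : φ = 0 := (Continuous.ae_eq_iff_eq volume h2.continuous continuous_const).mp h5
  subst h6
  have h : kolmogorovExpr ρ G (0 : Sp N → ℂ) = 0 := by
    funext x
    simpa using kolmogorovExpr_smul ρ G 0 (φ := 0) contDiff_const x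
  rw [h] at h4
  exact Lp.ext (h4.trans (Lp.coeFn_zero _ _ _).symm)

/-- The operator `L φ = Δ φ + (∇ρ / ρ) · ∇φ` with domain `C_c^∞(ℝ^N)` in `L^2(dμ)`. -/
def kolmogorovCore (ρ : Sp N → ℝ) (G : Sp N → Sp N) : L2 ρ →ₗ.[ℂ] L2 ρ :=
  (kolmogorovCoreGraph ρ G).toLinearPMap

/-- The operator `(L, D(L))`: the closure of `(L, C_c^∞(ℝ^N))` in `L^2(dμ)`. -/
def kolmogorov (ρ : Sp N → ℝ) (G : Sp N → Sp N) : L2 ρ →ₗ.[ℂ] L2 ρ :=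
  (kolmogorovCore ρ G).closure

/-- The bi-Kolmogorov operator `(A, D(A))`: the operator associated with the sesquilinear form
`a_L(u, v) = ∫ L u * conj (L v) dμ` with form domain `D(L)`. -/
def biKolmogorov (ρ : Sp N → ℝ) (G : Sp N → Sp N) : L2 ρ →ₗ.[ℂ] L2 ρ :=
  squareFormOperator (kolmogorov ρ G)

/-! ### Local eventual positivity -/

/-- The class of `χ_s f`. -/
def chiMul {ρ : Sp N → ℝ} {s : Set (Sp N)} (hs : MeasurableSet s) (f : L2 ρ) : L2 ρ :=
  ((Lp.memLp f).indicator hs).toLp (s.indicator f)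

/-- For each compact `K` and each `f ∈ L^2(dμ)` which on `K` is nonnegative and not a.e. zero
there are `c > 0` and `t₀ > 0` such that `T(t) (χ_K f) ≥ c` a.e. on `K` for all `t ≥ t₀`.
(The order on `ℂ` is the usual one: `z ≤ w` means that `w - z` is a nonnegative real number.) -/
def LocallyIndividuallyEventuallyPositive {ρ : Sp N → ℝ} (T : C0Semigroup (L2 ρ)) : Prop :=
  ∀ (K : Set (Sp N)) (hK : IsCompact K) (f : L2 ρ),
    (∀ᵐ x ∂(volume.restrict K), 0 ≤ f x) →
    0 < volume {x | x ∈ K ∧ 0 < f x} →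
    ∃ c : ℝ, 0 < c ∧ ∃ t₀ : ℝ≥0, 0 < t₀ ∧ ∀ t : ℝ≥0, t₀ ≤ t →
      ∀ᵐ x ∂(volume.restrict K), (c : ℂ) ≤ (T.op t (chiMul hK.measurableSet f)) x

end BiKolmogorov

end

open BiKolmogorov

/-! The operator `A` is `L*L` with `L` closed and densely defined, hence nonnegative and
self-adjoint. Its resolvent `R = (1 + A)⁻¹` is a positive contraction with dense range
(`exists_resolvent`), and `e^{-tA} = f_t(R)` with `f_t(r) = exp(-t(1/r - 1))`. Three facts follow
from scalar bounds on `f_t` over `[0, 1]`: `f_t(R)` is a strongly continuous semigroup generated by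
`-A`; `f_1(R)` maps into every `D(A^n)`, because `f_1` vanishes to infinite order at `0`; and
`f_t(R)x → 0` whenever `x` is orthogonal to `ker A = ker L`
(`exists_isGenerator_neg_squareFormOperator`).

If `ker L` consists exactly of the constants, then `e^{-tA}u` converges in `L²(μ)` to the mean of
`u`, and for `u = χ_K f` this mean is some `c > 0`. The hypothesis on `D(A^n)` and the closed graph
theorem make `e^{-A}` bounded from `L²(μ)` to `L^∞(K)`. Writing `e^{-tA} = e^{-A} e^{-(t-1)A}` turns
convergence in `L²(μ)` into uniform convergence on `K`, so `e^{-tA}u ≥ c/2` on `K` for large `t`.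
The values are real because the semigroup commutes with complex conjugation, by uniqueness of the
semigroup with a given generator (`IsGenerator.op_eq`).

That the kernel contains nothing else is the Dirichlet form estimate `∫ |∇φ|² dμ ≤ ‖φ‖ ‖Lφ‖`. The
main difficulty is that the constant `1` lies in the domain of the closure of the core
(`one_mem_closure`). By duality this says: if `b ∈ L²(μ)` satisfies `Lb = a` in the very weak sense,
with `a ∈ L²(μ)`, then `∫ a dμ = 0`. Once `b` has a local weak gradient in `L²`, a Caccioppoli
estimate with cutoffs of gradient size `O(1/n)` proves this (`HypothesisH1.integral_eq_zero`).

The remaining analytic work is thus the local `H¹` regularity of very weak solutions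
(`HypothesisH1.exists_local_gradient`). It is obtained by transposition. A drift in `L^r`, `r > N`,
is a perturbation of `Δ` of relative bound zero, so `c - Δ - β · ∇` maps test functions onto a dense
subspace of `L²` for large `c`. Approximating `w⁻¹ ∂_i ψ` by such images and using coercivity of the
weighted form bounds `∫ u ∂_i ψ` by `‖ψ‖₂`. Local boundedness of the density from above, needed on
the way, is a Morrey estimate for a smooth substitute of `log ρ`. -/

noncomputable section

namespace BiKolmogorov

/-! ### The resolvent of the form operator, built from the graph of `L`. -/

section Resolvent

variable {H : Type*} [NormedAddCommGroup H] [InnerProductSpace ℂ H] [CompleteSpace H]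

/-- The graph of `L` is a Hilbert space for the inner product of `H × H`; let `ι` be its first
coordinate. By Riesz, `ι* x` is the graph element `(u, Lu)` with `(v, u) + (Lv, Lu) = (v, x)` for
all `v ∈ D(L)`, so `ι ι* = (1 + A)⁻¹`. Positivity and the norm bound are read off from this
factorization. -/
theorem exists_resolvent (L : H →ₗ.[ℂ] H) (hcl : IsClosed (L.graph : Set (H × H)))
    (hd : Dense (L.domain : Set H)) :
    ∃ R : H →L[ℂ] H, R.IsPositive ∧ ‖R‖ ≤ 1 ∧ DenseRange R ∧
      ∀ u w : H, (u, w) ∈ squareFormGraph L ↔ R (u + w) = u := by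
  let Γ : Submodule ℂ (WithLp 2 (H × H)) :=
    L.graph.comap (WithLp.linearEquiv 2 ℂ (H × H)).toLinearMap
  have hΓ : IsClosed (Γ : Set (WithLp 2 (H × H))) :=
    hcl.preimage (WithLp.prod_continuous_ofLp 2 H H)
  have : CompleteSpace Γ := hΓ.completeSpace_coe
  let ι : Γ →L[ℂ] H := (WithLp.fstL 2 ℂ H H) ∘L Γ.subtypeL
  have hι : ∀ h : Γ, ι h = (h : WithLp 2 (H × H)).fst := fun h => rfl
  have hadj : ∀ (h : Γ) (x : H), ⟪h, ι.adjoint x⟫_ℂ = ⟪(h : WithLp 2 (H × H)).fst, x⟫_ℂ := by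
    intro h x
    rw [ContinuousLinearMap.adjoint_inner_right]
    rfl
  have mem : ∀ v : L.domain, (WithLp.toLp 2 ((v : H), L v)) ∈ Γ := fun v =>
    LinearPMap.mem_graph L v
  refine ⟨ι ∘L ι.adjoint, ContinuousLinearMap.isPositive_self_comp_adjoint ι, ?_, ?_, ?_⟩
  · have h1 : ‖ι‖ ≤ 1 := by
      refine ContinuousLinearMap.opNorm_le_bound _ zero_le_one fun h => ?_
      rw [one_mul, hι]
      exact WithLp.norm_fst_le _ (h : WithLp 2 (H × H))
    calc _ ≤ ‖ι‖ * ‖ι.adjoint‖ := ContinuousLinearMap.opNorm_comp_le _ _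
      _ ≤ 1 * 1 := by
        rw [LinearIsometryEquiv.norm_map]
        gcongr
      _ = 1 := one_mul 1
  · have : (LinearMap.range (ι ∘L ι.adjoint).toLinearMap).topologicalClosure = ⊤ := by
      rw [Submodule.topologicalClosure_eq_top_iff, Submodule.eq_bot_iff]
      intro y hy
      -- For `y` orthogonal to the range, `‖ι* y‖² = (ι ι* y, y) = 0`; then `y ⊥ D(L)`, and density
      -- of the domain gives `y = 0`.
      have h1 : ι.adjoint y = 0 := by
        refine (inner_self_eq_zero (𝕜 := ℂ)).1 ?_
        rw [ContinuousLinearMap.adjoint_inner_right]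
        exact (Submodule.mem_orthogonal _ y).1 hy _ ⟨y, rfl⟩
      refine hd.eq_zero_of_inner_left ℂ fun v hv => ?_
      have := hadj ⟨_, mem ⟨v, hv⟩⟩ y
      rw [h1, inner_zero_right] at this
      exact inner_eq_zero_symm.mp this.symm
    exact Submodule.dense_iff_topologicalClosure_eq_top.2 this
  · intro u w
    constructor
    · rintro ⟨u', hu, h⟩
      simp only at hu h
      -- Both sides have the same inner product with every graph element: the form identity is `(v,
      -- u) + (Lv, Lu) = (v, u + w)`.
      have : ι.adjoint (u + w) = ⟨_, mem u'⟩ := by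
        refine ext_inner_left ℂ fun k => ?_
        rw [hadj]
        obtain ⟨k, hk⟩ := k
        obtain ⟨v, hv1, hv2⟩ := (LinearPMap.mem_graph_iff L).1 hk
        rw [Submodule.coe_inner, WithLp.prod_inner_apply, inner_add_right]
        have e1 : k.fst = v := hv1.symm
        have e2 : k.snd = L v := hv2.symm
        rw [show (WithLp.ofLp k).fst = v from e1, show (WithLp.ofLp k).snd = L v from e2]
        simp only [h v, hu, e1]
      rw [ContinuousLinearMap.comp_apply, this, hι]
      exact hu
    · intro h
      obtain ⟨u', h1, h2⟩ := (LinearPMap.mem_graph_iff L).1 (ι.adjoint (u + w)).2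
      refine ⟨u', h1.trans h, fun v => ?_⟩
      have := hadj ⟨_, mem v⟩ (u + w)
      rw [Submodule.coe_inner, WithLp.prod_inner_apply, inner_add_right] at this
      simp only at this
      have e1 : (WithLp.ofLp (ι.adjoint (u + w)).1).fst = u := h
      have e2 : (WithLp.ofLp (ι.adjoint (u + w)).1).snd = L u' := h2.symm
      rw [e1, e2] at this
      exact add_left_cancel this

end Resolvent

/-! ### Scalar estimates for the functions `f_t` on the spectral interval `[0, 1]`. -/

section Decay

/-- The function `r ↦ exp (-t (1 / r - 1))` on `(0, ∞)`, extended by zero, for `t > 0`. -/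
def decay (t r : ℝ) : ℝ := Real.exp t * expNegInvGlue (r / t)

theorem continuous_decay (t : ℝ) : Continuous (decay t) :=
  continuous_const.mul ((expNegInvGlue.contDiff (n := 0)).continuous.comp
    (continuous_id.div_const t))

theorem decay_zero_right (t : ℝ) : decay t 0 = 0 := by
  simp [decay, expNegInvGlue.zero]

theorem decay_of_pos {t r : ℝ} (ht : 0 < t) (hr : 0 < r) :
    decay t r = Real.exp (-(t * (1 / r - 1))) := by
  rw [decay, expNegInvGlue, if_neg (not_le.2 (div_pos hr ht)), ← Real.exp_add]
  congr 1
  field_simp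
  ring

theorem decay_nonneg (t r : ℝ) : 0 ≤ decay t r :=
  mul_nonneg (Real.exp_pos _).le (expNegInvGlue.nonneg _)

theorem decay_add {s t r : ℝ} (hs : 0 < s) (ht : 0 < t) (hr : 0 ≤ r) :
    decay (s + t) r = decay s r * decay t r := by
  rcases hr.eq_or_lt with rfl | hr
  · simp [decay_zero_right]
  · rw [decay_of_pos (add_pos hs ht) hr, decay_of_pos hs hr, decay_of_pos ht hr, ← Real.exp_add]
    congr 1
    ring

theorem one_div_sub_one_nonneg {r : ℝ} (hr : 0 < r) (hr1 : r ≤ 1) : 0 ≤ 1 / r - 1 := by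
  rw [sub_nonneg]
  exact (one_le_div hr).2 hr1

theorem decay_le_one {t r : ℝ} (ht : 0 < t) (hr : 0 ≤ r) (hr1 : r ≤ 1) : decay t r ≤ 1 := by
  rcases hr.eq_or_lt with rfl | hr
  · simp [decay_zero_right]
  · rw [decay_of_pos ht hr, Real.exp_le_one_iff]
    have := mul_nonneg ht.le (one_div_sub_one_nonneg hr hr1)
    linarith

/-- By `1 - x ≤ e^{-x}` the defect is at most `t(1 - r)`. It yields strong continuity at time zero
on the range of `R`. -/
theorem abs_decay_mul_sub_le {t r : ℝ} (ht : 0 < t) (hr : 0 ≤ r) (hr1 : r ≤ 1) :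
    |decay t r * r - r| ≤ t := by
  rcases hr.eq_or_lt with rfl | hr
  · simpa using ht.le
  · have h1 := decay_le_one ht hr.le hr1
    have h2 : 1 - t * (1 / r - 1) ≤ decay t r := by
      rw [decay_of_pos ht hr]
      have := Real.add_one_le_exp (-(t * (1 / r - 1)))
      linarith
    rw [abs_le]
    have h3 : (1 - t * (1 / r - 1)) * r ≤ decay t r * r := mul_le_mul_of_nonneg_right h2 hr.le
    have h4 : (1 - t * (1 / r - 1)) * r = r - t * (1 - r) := by
      field_simp
    constructor
    · nlinarith
    · nlinarith

theorem exp_neg_sub_le {x : ℝ} (hx : 0 ≤ x) : |Real.exp (-x) - 1 + x| ≤ x ^ 2 := by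
  have h1 := Real.add_one_le_exp (-x)
  rw [abs_of_nonneg (by linarith)]
  -- Second-order Taylor bound for `x ≤ 1`; for `x > 1` the quantity is at most `x`, hence at most
  -- `x²`.
  rcases le_or_gt x 1 with h | h
  · have := Real.abs_exp_sub_one_sub_id_le (x := -x) (by rwa [abs_neg, abs_of_nonneg hx])
    have := (abs_le.1 this).2
    nlinarith
  · have := Real.exp_le_one_iff.2 (neg_nonpos.2 hx)
    nlinarith

/-- The extra factor `r` compensates the square of `1/r - 1` in the Taylor remainder. This is
convergence of the difference quotient, with rate, on the range of `R²`; the uniform bound in the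
next lemma extends it to the range of `R`. -/
theorem abs_decay_mul_sq_sub_le {t r : ℝ} (ht : 0 < t) (hr : 0 ≤ r) (hr1 : r ≤ 1) :
    |(t⁻¹ * (decay t r * r - r) - (r - 1)) * r| ≤ t := by
  rcases hr.eq_or_lt with rfl | hr
  · simpa using ht.le
  · have h1 := exp_neg_sub_le (mul_nonneg ht.le (one_div_sub_one_nonneg hr hr1))
    rw [← decay_of_pos ht hr] at h1
    have h2 : (t⁻¹ * (decay t r * r - r) - (r - 1)) * r =
        t⁻¹ * r ^ 2 * (decay t r - 1 + t * (1 / r - 1)) := by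
      field_simp
      ring
    rw [h2, abs_mul, abs_of_nonneg (by positivity)]
    calc t⁻¹ * r ^ 2 * |decay t r - 1 + t * (1 / r - 1)|
        ≤ t⁻¹ * r ^ 2 * (t * (1 / r - 1)) ^ 2 := by gcongr
      _ = t * (1 - r) ^ 2 := by
        field_simp
      _ ≤ t * 1 := by
        gcongr
        exact pow_le_one₀ (by linarith) (by linarith)
      _ = t := mul_one t

theorem abs_diffQuot_decay_le {t r : ℝ} (ht : 0 < t) (hr : 0 ≤ r) (hr1 : r ≤ 1) :
    |t⁻¹ * (decay t r * r - r) - (r - 1)| ≤ 2 := by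
  have h1 := abs_decay_mul_sub_le ht hr hr1
  have h2 : |t⁻¹ * (decay t r * r - r)| ≤ 1 := by
    rw [abs_mul, abs_of_pos (inv_pos.2 ht), inv_mul_le_iff₀ ht]
    simpa using h1
  calc _ ≤ |t⁻¹ * (decay t r * r - r)| + |r - 1| := abs_sub _ _
    _ ≤ 1 + 1 := add_le_add h2 (abs_le.2 ⟨by linarith, by linarith⟩)
    _ = 2 := by norm_num

/-- Apply `x ≤ e^x` to `x = t(1/r - 1)` and use `1 - r ≤ 1/r - 1`. It gives decay of order `1/t` on
the range of `1 - R`. -/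
theorem abs_decay_mul_one_sub_le {t r : ℝ} (ht : 0 < t) (hr : 0 ≤ r) (hr1 : r ≤ 1) :
    |decay t r * (1 - r)| ≤ t⁻¹ := by
  rcases hr.eq_or_lt with rfl | hr
  · simpa [decay_zero_right] using ht.le
  · have hs := one_div_sub_one_nonneg hr hr1
    rw [abs_of_nonneg (mul_nonneg (decay_nonneg _ _) (by linarith)), decay_of_pos ht hr,
      Real.exp_neg, inv_mul_eq_div, div_le_iff₀ (Real.exp_pos _), ← div_eq_inv_mul,
      le_div_iff₀ ht]
    have h1 := Real.add_one_le_exp (t * (1 / r - 1))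
    have h2 : 1 - r ≤ 1 / r - 1 := by
      have : 1 / r - 1 - (1 - r) = (1 - r) ^ 2 / r := by field_simp
      have : 0 ≤ (1 - r) ^ 2 / r := by positivity
      linarith
    nlinarith

/-- The exponential beats every power of `1/r` at the origin. This factorization is the smoothing
property: it makes `f_1(R)` factor through `R^n`. -/
theorem exists_decay_one_eq_pow_mul (n : ℕ) :
    ∃ g : ℝ → ℝ, Continuous g ∧ ∀ r, decay 1 r = r ^ n * g r := by
  refine ⟨fun r => Real.exp 1 * ((Polynomial.X ^ n : Polynomial ℝ).eval r⁻¹ * expNegInvGlue r),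
    continuous_const.mul (expNegInvGlue.continuous_polynomial_eval_inv_mul _), fun r => ?_⟩
  rcases eq_or_ne r 0 with rfl | hr
  · simp [decay_zero_right, expNegInvGlue.zero]
  · simp only [decay, div_one, Polynomial.eval_pow, Polynomial.eval_X]
    rw [inv_pow]
    field_simp

end Decay

/-! ### The semigroup `f_t(R)`: generator, smoothing and strong stability. -/

section ResolventSemigroup

variable {H : Type*} [NormedAddCommGroup H] [InnerProductSpace ℂ H]

theorem tendsto_zero_of_mem_closure {ι : Type*} {l : Filter ι} {F : ι → H →L[ℂ] H} {C : ℝ}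
    (hC : ∀ᶠ i in l, ‖F i‖ ≤ C) {s : Set H} (hs : ∀ x ∈ s, Tendsto (fun i => F i x) l (𝓝 0))
    {x : H} (hx : x ∈ closure s) : Tendsto (fun i => F i x) l (𝓝 0) := by
  rw [Metric.tendsto_nhds]
  intro ε hε
  have hC' : 0 < |C| + 1 := by positivity
  obtain ⟨y, hy, hxy⟩ := Metric.mem_closure_iff.1 hx (ε / 2 / (|C| + 1)) (by positivity)
  filter_upwards [hC, Metric.tendsto_nhds.1 (hs y hy) (ε / 2) (half_pos hε)] with i h1 h2
  rw [dist_zero_right] at h2 ⊢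
  calc ‖F i x‖ = ‖F i (x - y) + F i y‖ := by rw [map_sub, sub_add_cancel]
    _ ≤ ‖F i‖ * ‖x - y‖ + ‖F i y‖ :=
      (norm_add_le _ _).trans (add_le_add_left ((F i).le_opNorm _) _)
    _ < (|C| + 1) * (ε / 2 / (|C| + 1)) + ε / 2 := by
      refine add_lt_add_of_le_of_lt ?_ h2
      rw [dist_eq_norm] at hxy
      exact mul_le_mul (h1.trans ((le_abs_self C).trans (by linarith))) hxy.le (norm_nonneg _)
        hC'.le
    _ = ε := by field_simp; ring

variable [CompleteSpace H]

theorem spectrum_subset_Icc {R : H →L[ℂ] H} (hR : R.IsPositive) (hn : ‖R‖ ≤ 1) {r : ℝ}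
    (hr : r ∈ spectrum ℝ R) : 0 ≤ r ∧ r ≤ 1 := by
  refine ⟨spectrum_nonneg_of_nonneg ((ContinuousLinearMap.nonneg_iff_isPositive R).2 hR) hr, ?_⟩
  have hsa : IsSelfAdjoint R := hR.isSelfAdjoint
  exact (le_abs_self r).trans ((IsometricContinuousFunctionalCalculus.norm_spectrum_le R hr hsa).trans hn)

theorem norm_cfc_le_of_Icc {R : H →L[ℂ] H} (hR : R.IsPositive) (hn : ‖R‖ ≤ 1) {f : ℝ → ℝ}
    {c : ℝ} (hc : 0 ≤ c) (hf : ∀ r, 0 ≤ r → r ≤ 1 → |f r| ≤ c) : ‖cfc f R‖ ≤ c :=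
  norm_cfc_le hc fun r hr =>
    hf r (spectrum_subset_Icc hR hn hr).1 (spectrum_subset_Icc hR hn hr).2

/-- The semigroup generated by `1 - R⁻¹`, for a positive injective contraction `R`. -/
def resolventOp (R : H →L[ℂ] H) (t : ℝ≥0) : H →L[ℂ] H :=
  -- Time zero is separate: `decay 0` vanishes identically, since the quotient `r / 0` is `0`.
  if t = 0 then 1 else cfc (decay t) R

theorem norm_resolventOp_le {R : H →L[ℂ] H} (hR : R.IsPositive) (hn : ‖R‖ ≤ 1) (t : ℝ≥0) :
    ‖resolventOp R t‖ ≤ 1 := by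
  unfold resolventOp
  split_ifs with h
  · exact ContinuousLinearMap.norm_id_le
  · refine norm_cfc_le_of_Icc hR hn zero_le_one fun r h0 h1 => ?_
    rw [abs_of_nonneg (decay_nonneg _ _)]
    exact decay_le_one (NNReal.coe_pos.2 (pos_iff_ne_zero.2 h)) h0 h1

theorem resolventOp_add {R : H →L[ℂ] H} (hR : R.IsPositive) (hn : ‖R‖ ≤ 1) (s t : ℝ≥0) :
    resolventOp R (s + t) = resolventOp R s * resolventOp R t := by
  rcases eq_or_ne s 0 with rfl | hs
  · simp [resolventOp]
  rcases eq_or_ne t 0 with rfl | ht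
  · simp [resolventOp]
  have hst : s + t ≠ 0 := by simp [hs]
  simp only [resolventOp, hs, ht, hst, if_false]
  rw [← cfc_mul _ _ R (continuous_decay s).continuousOn (continuous_decay t).continuousOn]
  refine cfc_congr fun r hr => ?_
  rw [NNReal.coe_add]
  exact decay_add (NNReal.coe_pos.2 (pos_iff_ne_zero.2 hs))
    (NNReal.coe_pos.2 (pos_iff_ne_zero.2 ht)) (spectrum_subset_Icc hR hn hr).1

theorem resolventOp_commute {R : H →L[ℂ] H} (hR : R.IsPositive) (t : ℝ≥0) :
    resolventOp R t * R = R * resolventOp R t := by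
  unfold resolventOp
  split_ifs with h
  · simp
  · have hsa : IsSelfAdjoint R := hR.isSelfAdjoint
    nth_rewrite 2 [← cfc_id ℝ R hsa]
    nth_rewrite 3 [← cfc_id ℝ R hsa]
    exact cfc_commute_cfc _ _ R

theorem tendsto_resolventOp_zero {R : H →L[ℂ] H} (hR : R.IsPositive) (hn : ‖R‖ ≤ 1)
    (hd : DenseRange R) (x : H) : Tendsto (fun t => resolventOp R t x) (𝓝 0) (𝓝 x) := by
  have hsa : IsSelfAdjoint R := hR.isSelfAdjoint
  have key : Tendsto (fun t : ℝ≥0 => (resolventOp R t - 1) x) (𝓝 0) (𝓝 0) := by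
    refine tendsto_zero_of_mem_closure (C := 2) (Eventually.of_forall fun t => ?_)
      (s := Set.range R) ?_ (hd x)
    · calc _ ≤ ‖resolventOp R t‖ + ‖(1 : H →L[ℂ] H)‖ := norm_sub_le _ _
        _ ≤ 1 + 1 := add_le_add (norm_resolventOp_le hR hn t) ContinuousLinearMap.norm_id_le
        _ = 2 := by norm_num
    · rintro _ ⟨z, rfl⟩
      have hb : ∀ t : ℝ≥0, ‖(resolventOp R t - 1) (R z)‖ ≤ t * ‖z‖ := by
        intro t
        have : ‖(resolventOp R t - 1) * R‖ ≤ t := by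
          rcases eq_or_ne t 0 with rfl | ht
          · simp [resolventOp]
          · have e : (resolventOp R t - 1) * R = cfc (fun r : ℝ => decay t r * r - r) R := by
              have hc := continuous_decay t
              rw [cfc_sub _ _ R (by fun_prop) (by fun_prop),
                cfc_mul _ _ R (by fun_prop) (by fun_prop), cfc_id' ℝ R hsa, sub_mul,
                one_mul, resolventOp, if_neg ht]
            rw [e]
            exact norm_cfc_le_of_Icc hR hn t.2 fun r h0 h1 =>
              abs_decay_mul_sub_le (NNReal.coe_pos.2 (pos_iff_ne_zero.2 ht)) h0 h1
        exact ((resolventOp R t - 1) * R).le_of_opNorm_le this z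
      refine squeeze_zero_norm hb ?_
      have : Tendsto (fun t : ℝ≥0 => (t : ℝ) * ‖z‖) (𝓝 0) (𝓝 (((0 : ℝ≥0) : ℝ) * ‖z‖)) :=
        (NNReal.continuous_coe.mul continuous_const).tendsto 0
      simpa using this
  have := key.add_const x
  simpa using this

/-- The operators `resolventOp R t` form a strongly continuous semigroup. -/
def resolventSemigroup (R : H →L[ℂ] H) (hR : R.IsPositive) (hn : ‖R‖ ≤ 1) (hd : DenseRange R) :
    C0Semigroup H where
  op := resolventOp R
  op_zero := if_pos rfl
  op_add := resolventOp_add hR hn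
  tendsto_zero := tendsto_resolventOp_zero hR hn hd

/-- Formally `-A R = R - 1`. The operators `t⁻¹(f_t(R)R - R) - (R - 1)` have norm at most `2` and
tend to zero on the range of `R`, which is dense. -/
theorem tendsto_diffQuot_resolventOp {R : H →L[ℂ] H} (hR : R.IsPositive) (hn : ‖R‖ ≤ 1)
    (hd : DenseRange R) (z : H) :
    Tendsto (fun t : ℝ≥0 => ((t : ℝ) : ℂ)⁻¹ • (resolventOp R t (R z) - R z)) (𝓝[>] 0)
      (𝓝 (R z - z)) := by
  have hsa : IsSelfAdjoint R := hR.isSelfAdjoint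
  have e : ∀ t : ℝ≥0, 0 < t →
      (((t : ℝ) : ℂ)⁻¹ • (resolventOp R t * R - R) - (R - 1)) =
        cfc (fun r : ℝ => (t : ℝ)⁻¹ * (decay t r * r - r) - (r - 1)) R := by
    intro t ht
    have hc := continuous_decay t
    rw [cfc_sub _ _ R (by fun_prop) (by fun_prop), cfc_const_mul _ _ R (by fun_prop),
      cfc_sub _ _ R (by fun_prop) (by fun_prop), cfc_sub _ _ R (by fun_prop) (by fun_prop),
      cfc_mul _ _ R (by fun_prop) (by fun_prop), cfc_id' ℝ R hsa, cfc_const_one ℝ R hsa,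
      resolventOp, if_neg ht.ne', ← Complex.ofReal_inv, Complex.coe_smul]
  have key : Tendsto (fun t : ℝ≥0 =>
      (((t : ℝ) : ℂ)⁻¹ • (resolventOp R t * R - R) - (R - 1)) z) (𝓝[>] 0) (𝓝 0) := by
    refine tendsto_zero_of_mem_closure (C := 2) ?_ (s := Set.range R) ?_ (hd z)
    · filter_upwards [self_mem_nhdsWithin] with t (ht : 0 < t)
      rw [e t ht]
      exact norm_cfc_le_of_Icc hR hn zero_le_two fun r h0 h1 =>
        abs_diffQuot_decay_le (NNReal.coe_pos.2 ht) h0 h1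
    · rintro _ ⟨y, rfl⟩
      refine squeeze_zero_norm' (a := fun t : ℝ≥0 => (t : ℝ) * ‖y‖) ?_ ?_
      · filter_upwards [self_mem_nhdsWithin] with t (ht : 0 < t)
        rw [e t ht]
        have hc := continuous_decay t
        have : ‖cfc (fun r : ℝ => (t : ℝ)⁻¹ * (decay t r * r - r) - (r - 1)) R * R‖ ≤ t := by
          nth_rewrite 2 [← cfc_id' ℝ R hsa]
          rw [← cfc_mul _ _ R (by fun_prop) (by fun_prop)]
          exact norm_cfc_le_of_Icc hR hn t.2 fun r h0 h1 =>
            abs_decay_mul_sq_sub_le (NNReal.coe_pos.2 ht) h0 h1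
        exact ContinuousLinearMap.le_of_opNorm_le _ this y
      · have : Tendsto (fun t : ℝ≥0 => (t : ℝ) * ‖y‖) (𝓝 0) (𝓝 (((0 : ℝ≥0) : ℝ) * ‖y‖)) :=
          (NNReal.continuous_coe.mul continuous_const).tendsto 0
        rw [NNReal.coe_zero, zero_mul] at this
        exact this.mono_left nhdsWithin_le_nhds
  have := key.add_const (R z - z)
  simpa using this

theorem isGenerator_resolventSemigroup {R : H →L[ℂ] H} (hR : R.IsPositive) (hn : ‖R‖ ≤ 1)
    (hd : DenseRange R) {B : H →ₗ.[ℂ] H} (hB : ∀ x y, (x, y) ∈ B.graph ↔ R (x - y) = x) :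
    IsGenerator (resolventSemigroup R hR hn hd) B := by
  intro x y
  rw [hB]
  constructor
  · intro h
    have := tendsto_diffQuot_resolventOp hR hn hd (x - y)
    rwa [h, sub_sub_cancel] at this
  · intro h
    have h1 := (R.continuous.tendsto y).comp h
    have h2 := tendsto_diffQuot_resolventOp hR hn hd x
    -- If the difference quotients of `x` converge to `y`, then `R`, which commutes with the
    -- semigroup, sends them to the quotients of `Rx`, whose limit is already known. Hence `R(x - y)
    -- = x`.
    have h3 : R y = R x - x := by
      refine tendsto_nhds_unique h1 (h2.congr fun t => ?_)
      have := congrArg (fun S : H →L[ℂ] H => S x) (resolventOp_commute hR t)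
      simp only [mul_apply_eq_comp] at this
      simp [resolventSemigroup, this]
    rw [map_sub, h3, sub_sub_cancel]

theorem resolventOp_one_mem_powDomain {R : H →L[ℂ] H} (hR : R.IsPositive)
    {A : H →ₗ.[ℂ] H} (hA : ∀ u w, (u, w) ∈ A.graph ↔ R (u + w) = u) (n : ℕ) (x : H) :
    resolventOp R 1 x ∈ powDomain A n := by
  have hsa : IsSelfAdjoint R := hR.isSelfAdjoint
  have hpow : ∀ (n : ℕ) (z : H), (R ^ n) z ∈ powDomain A n := by
    intro n
    induction n with
    | zero => exact fun z => trivial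
    | succ n ih =>
      intro z
      -- Since `R = (1 + A)⁻¹`, applying `A` to `R^{n+1} z` gives `R^n z - R^{n+1} z`, which is
      -- again in the range of `R^n`.
      have h1 : ((R ^ (n + 1)) z, (R ^ n) (z - R z)) ∈ A.graph := by
        rw [hA, map_sub]
        have e : (R ^ (n + 1)) z = (R ^ n) (R z) := by rw [pow_succ, mul_apply_eq_comp]
        rw [e, add_sub_cancel, ← e, pow_succ', mul_apply_eq_comp]
      obtain ⟨u, hu1, hu2⟩ := (LinearPMap.mem_graph_iff A).1 h1
      simp only at hu1 hu2
      refine ⟨hu1 ▸ u.2, ?_⟩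
      have : (⟨(R ^ (n + 1)) z, hu1 ▸ u.2⟩ : A.domain) = u := Subtype.ext hu1.symm
      rw [this, hu2]
      exact ih _
  obtain ⟨g, hg, hgr⟩ := exists_decay_one_eq_pow_mul n
  have : resolventOp R 1 = R ^ n * cfc g R := by
    rw [resolventOp, if_neg one_ne_zero, ← cfc_pow_id (R := ℝ) R n hsa,
      ← cfc_mul _ _ R (by fun_prop) hg.continuousOn]
    exact cfc_congr fun r _ => hgr r
  rw [this]
  exact hpow n _

/-- On the closure of the range of `1 - R` the semigroup is strongly stable. -/
theorem tendsto_resolventOp_atTop {R : H →L[ℂ] H} (hR : R.IsPositive) (hn : ‖R‖ ≤ 1)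
    {x : H} (hx : x ∈ closure (Set.range (1 - R : H →L[ℂ] H))) :
    Tendsto (fun t => resolventOp R t x) atTop (𝓝 0) := by
  have hsa : IsSelfAdjoint R := hR.isSelfAdjoint
  refine tendsto_zero_of_mem_closure (C := 1)
    (Eventually.of_forall fun t => norm_resolventOp_le hR hn t) ?_ hx
  rintro _ ⟨y, rfl⟩
  refine squeeze_zero_norm' (a := fun t : ℝ≥0 => (t : ℝ)⁻¹ * ‖y‖) ?_ ?_
  · filter_upwards [eventually_gt_atTop 0] with t ht
    have hc := continuous_decay t
    have : ‖resolventOp R t * (1 - R)‖ ≤ (t : ℝ)⁻¹ := by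
      have e : resolventOp R t * (1 - R) = cfc (fun r : ℝ => decay t r * (1 - r)) R := by
        rw [cfc_mul _ _ R (by fun_prop) (by fun_prop), cfc_sub _ _ R (by fun_prop) (by fun_prop),
          cfc_id' ℝ R hsa, cfc_const_one ℝ R hsa, resolventOp, if_neg ht.ne']
      rw [e]
      exact norm_cfc_le_of_Icc hR hn (by positivity) fun r h0 h1 =>
        abs_decay_mul_one_sub_le (NNReal.coe_pos.2 ht) h0 h1
    exact ContinuousLinearMap.le_of_opNorm_le _ this y
  · have : Tendsto (fun t : ℝ≥0 => (t : ℝ)⁻¹) atTop (𝓝 0) :=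
      tendsto_inv_atTop_zero.comp (NNReal.tendsto_coe_atTop.2 tendsto_id)
    simpa using this.mul_const ‖y‖

/-- For the self-adjoint operator `1 - R`, the closure of the range is the orthogonal complement of
the kernel, which is the fixed space of `R`. -/
theorem mem_closure_range_one_sub {R : H →L[ℂ] H} (hR : R.IsPositive) {x : H}
    (hx : ∀ y, R y = y → ⟪y, x⟫_ℂ = 0) : x ∈ closure (Set.range (1 - R : H →L[ℂ] H)) := by
  have hsa : IsSelfAdjoint (1 - R) := (IsSelfAdjoint.one _).sub hR.isSelfAdjoint
  have h : x ∈ (LinearMap.range (1 - R : H →L[ℂ] H).toLinearMap).topologicalClosure := by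
    rw [← Submodule.orthogonal_orthogonal_eq_closure, Submodule.mem_orthogonal]
    intro y hy
    refine hx y ?_
    have : (1 - R) y = 0 := by
      refine ext_inner_left ℂ fun v => ?_
      rw [inner_zero_right, ← ContinuousLinearMap.adjoint_inner_left, hsa.adjoint_eq]
      exact (Submodule.mem_orthogonal _ y).1 hy _ ⟨v, rfl⟩
    rw [_root_.sub_apply, one_apply_eq_self, sub_eq_zero] at this
    exact this.symm
  exact h

end ResolventSemigroup

/-! ### General semigroups: continuity of orbits and uniqueness for a dissipative generator. -/

section Uniqueness

variable {H : Type*} [NormedAddCommGroup H] [InnerProductSpace ℂ H]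

theorem C0Semigroup.op_add_apply (T : C0Semigroup H) (s t : ℝ≥0) (x : H) :
    T.op (s + t) x = T.op s (T.op t x) := by
  rw [T.op_add, ContinuousLinearMap.comp_apply]

/-- Otherwise there are times `t_n → 0` with `‖T(t_n)‖ > n + 1`, although `T(t_n)x` converges for
each `x`; this contradicts Banach–Steinhaus. -/
theorem C0Semigroup.exists_bound_near_zero [CompleteSpace H] (T : C0Semigroup H) :
    ∃ M : ℝ, 1 ≤ M ∧ ∃ δ : ℝ≥0, 0 < δ ∧ ∀ t ≤ δ, ‖T.op t‖ ≤ M := by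
  by_contra! hcon
  have h : ∀ n : ℕ, ∃ t : ℝ≥0, t ≤ 1 / ((n : ℝ≥0) + 1) ∧ ((n : ℝ) + 1) < ‖T.op t‖ := fun n =>
    hcon (n + 1) (by linarith [(Nat.cast_nonneg n : (0 : ℝ) ≤ n)]) (1 / ((n : ℝ≥0) + 1))
      (by positivity)
  choose t ht1 ht2 using h
  have ht : Tendsto t atTop (𝓝 0) :=
    tendsto_of_tendsto_of_tendsto_of_le_of_le tendsto_const_nhds
      (tendsto_one_div_add_atTop_nhds_zero_nat (𝕜 := ℝ≥0)) (fun n => zero_le) ht1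
  obtain ⟨C, hC⟩ := banach_steinhaus (g := fun n => T.op (t n)) fun x => by
    obtain ⟨C, hC⟩ := ((T.tendsto_zero x).comp ht).norm.bddAbove_range
    exact ⟨C, fun n => hC ⟨n, rfl⟩⟩
  obtain ⟨n, hn⟩ := exists_nat_gt C
  linarith [ht2 n, hC n]

theorem C0Semigroup.exists_bound [CompleteSpace H] (T : C0Semigroup H) (b : ℝ≥0) :
    ∃ M : ℝ, ∀ t ≤ b, ‖T.op t‖ ≤ M := by
  obtain ⟨M, hM, δ, hδ, h⟩ := T.exists_bound_near_zero
  have key : ∀ n : ℕ, ∀ t : ℝ≥0, t ≤ n * δ → ‖T.op t‖ ≤ M ^ (n + 1) := by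
    intro n
    induction n with
    | zero => exact fun t ht => by simpa using h t (ht.trans (by simp))
    | succ n ih =>
      intro t ht
      rcases le_total t δ with htδ | htδ
      · exact (h t htδ).trans (le_self_pow₀ hM (by simp))
      · have e : t = δ + (t - δ) := (add_tsub_cancel_of_le htδ).symm
        rw [e, T.op_add]
        calc _ ≤ ‖T.op δ‖ * ‖T.op (t - δ)‖ := ContinuousLinearMap.opNorm_comp_le _ _
          _ ≤ M * M ^ (n + 1) := by
            refine mul_le_mul (h δ le_rfl) (ih _ ?_) (norm_nonneg _) (by linarith)
            rw [tsub_le_iff_right]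
            refine ht.trans (le_of_eq ?_)
            push_cast
            ring
          _ = M ^ (n + 1 + 1) := by ring
  obtain ⟨n, hn⟩ := exists_nat_ge (b / δ)
  exact ⟨M ^ (n + 1), fun t ht => key n t (ht.trans ((div_le_iff₀ hδ).1 hn))⟩

theorem C0Semigroup.continuous_op [CompleteSpace H] (T : C0Semigroup H) (x : H) :
    Continuous fun t => T.op t x := by
  refine continuous_iff_continuousAt.2 fun s => ?_
  obtain ⟨M, hM⟩ := T.exists_bound (s + 1)
  have hM0 : 0 ≤ M := (norm_nonneg _).trans (hM 0 (zero_le))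
  -- One estimate serves both sides: the earlier of the two times is factored out, and only that one
  -- has to be bounded.
  have hb : ∀ a b : ℝ≥0, a ≤ b → a ≤ s + 1 →
      ‖T.op b x - T.op a x‖ ≤ M * ‖T.op (nndist b a) x - x‖ := by
    intro a b hab ha
    have e : b = a + nndist b a := by
      rw [NNReal.nndist_eq, max_eq_left (by simp [tsub_eq_zero_of_le hab]),
        add_tsub_cancel_of_le hab]
    calc ‖T.op b x - T.op a x‖ = ‖T.op a (T.op (nndist b a) x - x)‖ := by
          rw [map_sub, ← T.op_add_apply, ← e]
      _ ≤ _ := (T.op a).le_of_opNorm_le (hM a ha) _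
  rw [ContinuousAt, tendsto_iff_norm_sub_tendsto_zero]
  refine squeeze_zero' (g := fun t => M * ‖T.op (nndist t s) x - x‖)
    (Eventually.of_forall fun _ => norm_nonneg _) ?_ ?_
  · have : Set.Iic (s + 1) ∈ 𝓝 s := Iic_mem_nhds (by simp)
    filter_upwards [this] with t ht
    rcases le_total s t with hst | hst
    · exact hb s t hst (by simp)
    · rw [norm_sub_rev, nndist_comm]
      exact hb t s hst ht
  · have h1 : Tendsto (fun t => nndist t s) (𝓝 s) (𝓝 0) := by
      have := (continuous_id.nndist (continuous_const (y := s))).tendsto s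
      simpa using this
    have h2 := ((T.tendsto_zero x).comp h1).sub_const x
    have h3 := h2.norm.const_mul M
    simpa using h3

theorem IsGenerator.op_mem_graph {T : C0Semigroup H} {B : H →ₗ.[ℂ] H} (hT : IsGenerator T B)
    {x y : H} (h : (x, y) ∈ B.graph) (t : ℝ≥0) : (T.op t x, T.op t y) ∈ B.graph := by
  rw [hT] at h ⊢
  refine (((T.op t).continuous.tendsto y).comp h).congr fun s => ?_
  simp only [Function.comp_apply, map_smul, map_sub, ← T.op_add_apply, add_comm s t]

/-- The generator is defined by a limit from the right, so only a right derivative comes for free;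
it suffices for the comparison arguments that follow. -/
theorem IsGenerator.hasDerivWithinAt {T : C0Semigroup H} {B : H →ₗ.[ℂ] H}
    (hT : IsGenerator T B) {x y : H} (h : (x, y) ∈ B.graph) {τ : ℝ} (hτ : 0 ≤ τ) :
    HasDerivWithinAt (fun τ : ℝ => T.op τ.toNNReal x) (T.op τ.toNNReal y) (Set.Ici τ) τ := by
  rw [← hasDerivWithinAt_Ioi_iff_Ici, hasDerivWithinAt_iff_tendsto_slope' (by simp)]
  have h1 : Tendsto (fun z : ℝ => (z - τ).toNNReal) (𝓝[>] τ) (𝓝[>] 0) := by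
    refine tendsto_nhdsWithin_iff.2 ⟨?_, ?_⟩
    · have : Continuous fun z : ℝ => (z - τ).toNNReal := by fun_prop
      have := this.tendsto τ
      rw [sub_self, Real.toNNReal_zero] at this
      exact this.mono_left nhdsWithin_le_nhds
    · filter_upwards [self_mem_nhdsWithin] with z (hz : τ < z)
      simpa using hz
  refine (((hT _ _).1 (hT.op_mem_graph h τ.toNNReal)).comp h1).congr' ?_
  filter_upwards [self_mem_nhdsWithin] with z (hz : τ < z)
  have e : z.toNNReal = (z - τ).toNNReal + τ.toNNReal := by
    rw [← Real.toNNReal_add (by linarith) hτ, sub_add_cancel]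
  simp only [Function.comp_apply, slope_def_module]
  rw [Real.coe_toNNReal _ (by linarith), ← Complex.ofReal_inv, Complex.coe_smul, e,
    T.op_add_apply]

/-- A strongly continuous semigroup is determined by its generator, for dissipative generators. -/
theorem IsGenerator.op_eq [CompleteSpace H] {S T : C0Semigroup H} {B : H →ₗ.[ℂ] H}
    (hS : IsGenerator S B) (hT : IsGenerator T B)
    (hdis : ∀ x y, (x, y) ∈ B.graph → RCLike.re ⟪x, y⟫_ℂ ≤ 0)
    (hdense : Dense (B.domain : Set H)) (t : ℝ≥0) : S.op t = T.op t := by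
  -- The derivative of `‖·‖²` is taken for the real structure, whose inner product is the real part
  -- of the complex one.
  let _ : InnerProductSpace ℝ H := InnerProductSpace.rclikeToReal ℂ H
  have key : ∀ x ∈ B.domain, S.op t x = T.op t x := by
    intro x hx
    have hg : (x, B ⟨x, hx⟩) ∈ B.graph := LinearPMap.mem_graph B ⟨x, hx⟩
    set y := B ⟨x, hx⟩
    let w : ℝ → H := fun τ => S.op τ.toNNReal x - T.op τ.toNNReal x
    have hw : Continuous w := ((S.continuous_op x).comp continuous_real_toNNReal).sub
      ((T.continuous_op x).comp continuous_real_toNNReal)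
    have hd : ∀ τ ∈ Set.Ico (0 : ℝ) t, HasDerivWithinAt (fun τ => ‖w τ‖ ^ 2)
        (2 * ⟪w τ, S.op τ.toNNReal y - T.op τ.toNNReal y⟫_ℝ) (Set.Ici τ) τ := fun τ hτ =>
      ((hS.hasDerivWithinAt hg hτ.1).sub (hT.hasDerivWithinAt hg hτ.1)).norm_sq
    -- The difference `w` of two orbits starts at zero, and `‖w‖²` has right derivative `2 Re (w,
    -- Bw) ≤ 0`, so it stays zero.
    have hle := image_le_of_deriv_right_le_deriv_boundary (hw.norm.pow 2).continuousOn hd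
      (B := fun _ => 0) (B' := fun _ => 0) (by simp [w, S.op_zero, T.op_zero]) continuousOn_const
      (fun _ _ => hasDerivWithinAt_const _ _ _) (fun τ _ => by
        have h1 := B.graph.sub_mem (hS.op_mem_graph hg τ.toNNReal)
          (hT.op_mem_graph hg τ.toNNReal)
        have h2 := hdis _ _ h1
        rw [real_inner_eq_re_inner ℂ]
        change 2 * RCLike.re ⟪S.op τ.toNNReal x - T.op τ.toNNReal x, _⟫_ℂ ≤ 0
        linarith) ⟨t.2, le_rfl⟩
    have h0 : ‖w t‖ = 0 := by
      have : ‖w t‖ ^ 2 ≤ 0 := hle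
      nlinarith [norm_nonneg (w t)]
    have := norm_eq_zero.1 h0
    simp only [w, Real.toNNReal_coe] at this
    exact sub_eq_zero.1 this
  refine ContinuousLinearMap.ext fun x => ?_
  exact congrFun (Continuous.ext_on hdense (S.op t).continuous (T.op t).continuous key) x

/-- Elements of the kernel of the generator are fixed by the semigroup. -/
theorem IsGenerator.op_eq_self [CompleteSpace H] {T : C0Semigroup H} {B : H →ₗ.[ℂ] H}
    (hT : IsGenerator T B) {x : H} (h : (x, 0) ∈ B.graph) (t : ℝ≥0) : T.op t x = x := by
  have := constant_of_has_deriv_right_zero (a := 0) (b := t)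
    ((T.continuous_op x).comp continuous_real_toNNReal).continuousOn
    (fun τ hτ => by simpa using! hT.hasDerivWithinAt h hτ.1) t ⟨t.2, le_rfl⟩
  simpa [T.op_zero] using this

end Uniqueness

/-! ### Averages over small balls and pointwise bounds by averaged gradients. -/

section Averages

variable {N : ℕ}

theorem lintegral_rpow_le_rpow_mul_measure {α : Type*} [MeasurableSpace α] {μ : Measure α}
    {f : α → ℝ≥0∞} (hf : AEMeasurable f μ) {p q : ℝ} (hp : 0 ≤ p) (hq : 0 < q) (hpq : p ≤ q) :
    ∫⁻ a, f a ^ p ∂μ ≤ (∫⁻ a, f a ^ q ∂μ) ^ (p / q) * μ Set.univ ^ (1 - p / q) := by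
  have := ENNReal.lintegral_mul_norm_pow_le (μ := μ) (f := fun a => f a ^ q) (g := fun _ => 1)
    (hf.pow_const q) aemeasurable_const (p := p / q) (q := 1 - p / q) (by positivity)
    (sub_nonneg.2 ((div_le_one hq).2 hpq)) (by ring)
  simpa [← ENNReal.rpow_mul, mul_div_cancel₀ _ hq.ne'] using this

theorem sq_lintegral_mul_le {α : Type*} [MeasurableSpace α] {μ : Measure α}
    {f g : α → ℝ≥0∞} (hf : AEMeasurable f μ) (hg : AEMeasurable g μ) :
    (∫⁻ a, f a * g a ∂μ) ^ 2 ≤ (∫⁻ a, f a ^ 2 ∂μ) * ∫⁻ a, g a ^ 2 ∂μ := by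
  have h := ENNReal.lintegral_mul_norm_pow_le (μ := μ) (hf.pow_const 2) (hg.pow_const 2)
    (p := 1 / 2) (q := 1 / 2) (by norm_num) (by norm_num) (by norm_num)
  have e : ∀ c : ℝ≥0∞, (c ^ 2) ^ (1 / 2 : ℝ) = c := fun c => by
    rw [← ENNReal.rpow_natCast, ← ENNReal.rpow_mul]; norm_num
  have e' : ∀ c : ℝ≥0∞, (c ^ (1 / 2 : ℝ)) ^ 2 = c := fun c => by
    rw [← ENNReal.rpow_natCast, ← ENNReal.rpow_mul]; norm_num
  simp only [e] at h
  calc _ ≤ _ := pow_le_pow_left' h 2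
    _ = _ := by rw [mul_pow, e', e']

theorem ennreal_add_sq_le (a b : ℝ≥0∞) : (a + b) ^ 2 ≤ 2 * (a ^ 2 + b ^ 2) := by
  have := ENNReal.rpow_add_le_mul_rpow_add_rpow a b (p := 2) (by norm_num)
  norm_num at this
  exact this

theorem lintegral_comp_add_smul {f : Sp N → ℝ≥0∞} (hf : Measurable f) (x : Sp N) {s : ℝ}
    (hs : 0 < s) :
    ∫⁻ y, f (x + s • y) = ((ENNReal.ofReal s) ^ N)⁻¹ * ∫⁻ y, f y := by
  have h1 : ∫⁻ y, f (x + s • y) = ∫⁻ z, f (x + z) ∂(Measure.map (s • ·) volume) :=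
    (lintegral_map (hf.comp (measurable_const_add x)) (measurable_const_smul s)).symm
  rw [h1, Measure.map_addHaar_smul _ hs.ne', lintegral_smul_measure, lintegral_add_left_eq_self,
    finrank_euclideanSpace_fin, abs_of_pos (by positivity), ENNReal.ofReal_inv_of_pos (by positivity),
    ENNReal.ofReal_pow hs.le, smul_eq_mul]

/-- The unit ball over which averages are taken. -/
abbrev unitBall (N : ℕ) : Set (Sp N) := Metric.ball 0 1

theorem volume_unitBall_ne_zero : volume (unitBall N) ≠ 0 :=
  (Metric.measure_ball_pos _ _ one_pos).ne'

theorem volume_unitBall_ne_top : volume (unitBall N) ≠ ⊤ := measure_ball_lt_top.ne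

/-- Fubini and translation move the average from `f` to `b²`, and Hölder on the unit ball bounds the
average of `b²` uniformly by the `L^r` norm. What matters is the cost `s^{-2N/r}`: its exponent
exceeds `-2` exactly when `r > N`. -/
theorem lintegral_sq_mul_average_le {b f : Sp N → ℝ≥0∞} (hb : Measurable b) (hf : Measurable f)
    {r : ℝ} (hr : 2 ≤ r) {s : ℝ} (hs : 0 < s) :
    ∫⁻ x, b x ^ 2 * ∫⁻ y in unitBall N, f (x + s • y) ≤
      (∫⁻ x, b x ^ r) ^ (2 / r) * volume (unitBall N) ^ (1 - 2 / r) *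
        ENNReal.ofReal s ^ (-(2 * (N / r))) * ∫⁻ x, f x := by
  have hr0 : 0 < r := by linarith
  have hs0 : ENNReal.ofReal s ≠ 0 := by simpa using hs
  set D := (∫⁻ x, b x ^ r) ^ (2 / r) * volume (unitBall N) ^ (1 - 2 / r) *
        ENNReal.ofReal s ^ (-(2 * (N / r)))
  have hD : ∀ x, ∫⁻ y in unitBall N, b (x - s • y) ^ 2 ≤ D := by
    intro x
    have hm : Measurable fun y : Sp N => b (x - s • y) := hb.comp (by fun_prop)
    have h1 := lintegral_rpow_le_rpow_mul_measure (μ := volume.restrict (unitBall N))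
      hm.aemeasurable zero_le_two hr0 hr
    have h2 : ∫⁻ y in unitBall N, b (x - s • y) ^ r ≤
        ((ENNReal.ofReal s) ^ N)⁻¹ * ∫⁻ y, b y ^ r := by
      calc _ ≤ ∫⁻ y, b (x - s • y) ^ r := setLIntegral_le_lintegral _ _
        _ = ∫⁻ y, b (x - s • -y) ^ r :=
          (lintegral_neg_eq_self (μ := volume) fun y => b (x - s • y) ^ r).symm
        _ = ∫⁻ y, b (x + s • y) ^ r := by simp
        _ = _ := lintegral_comp_add_smul (hb.pow_const r) x hs
    simp only [ENNReal.rpow_two, Measure.restrict_apply_univ] at h1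
    refine h1.trans ?_
    calc _ ≤ (((ENNReal.ofReal s) ^ N)⁻¹ * ∫⁻ y, b y ^ r) ^ (2 / r) *
          volume (unitBall N) ^ (1 - 2 / r) := by gcongr
      _ = D := by
        rw [ENNReal.mul_rpow_of_nonneg _ _ (by positivity), ← ENNReal.rpow_natCast,
          ← ENNReal.rpow_neg, ← ENNReal.rpow_mul]
        simp only [D]
        rw [show -(N : ℝ) * (2 / r) = -(2 * (N / r)) by ring]
        ring
  have hm1 : Measurable fun p : Sp N × Sp N => f (p.1 + s • p.2) := hf.comp (by fun_prop)
  have hm2 : Measurable fun p : Sp N × Sp N => b p.1 ^ 2 * f (p.1 + s • p.2) :=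
    ((hb.comp measurable_fst).pow_const 2).mul hm1
  have hm3 : Measurable fun p : Sp N × Sp N => b (p.1 - s • p.2) ^ 2 * f p.1 :=
    ((hb.comp (by fun_prop)).pow_const 2).mul (hf.comp measurable_fst)
  calc ∫⁻ x, b x ^ 2 * ∫⁻ y in unitBall N, f (x + s • y)
      = ∫⁻ x, ∫⁻ y in unitBall N, b x ^ 2 * f (x + s • y) :=
        lintegral_congr fun x =>
          (lintegral_const_mul _ (hm1.comp (measurable_const.prodMk measurable_id))).symm
    _ = ∫⁻ y in unitBall N, ∫⁻ x, b x ^ 2 * f (x + s • y) :=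
        lintegral_lintegral_swap hm2.aemeasurable
    _ = ∫⁻ y in unitBall N, ∫⁻ x, b (x - s • y) ^ 2 * f x := by
        refine lintegral_congr fun y => ?_
        rw [← lintegral_add_right_eq_self (fun x => b (x - s • y) ^ 2 * f x) (s • y)]
        simp
    _ = ∫⁻ x, ∫⁻ y in unitBall N, b (x - s • y) ^ 2 * f x :=
        (lintegral_lintegral_swap hm3.aemeasurable).symm
    _ = ∫⁻ x, (∫⁻ y in unitBall N, b (x - s • y) ^ 2) * f x :=
        lintegral_congr fun x => lintegral_mul_const _
          ((hb.comp (by fun_prop)).pow_const 2)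
    _ ≤ ∫⁻ x, D * f x := lintegral_mono fun x => mul_le_mul_left (hD x) _
    _ = D * ∫⁻ x, f x := lintegral_const_mul _ hf

theorem enorm_le_add_lintegral_fderiv {φ : Sp N → ℝ} (hφ : ContDiff ℝ 1 φ) (x h : Sp N) :
    ‖φ x‖ₑ ≤ ‖φ (x + h)‖ₑ + ‖h‖ₑ * ∫⁻ t in Set.Ioo (0 : ℝ) 1, ‖fderiv ℝ φ (x + t • h)‖ₑ := by
  have hd : ∀ t ∈ Set.uIcc (0 : ℝ) 1, HasDerivAt (fun t : ℝ => φ (x + t • h))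
      (fderiv ℝ φ (x + t • h) h) t := by
    intro t _
    have h1 : HasDerivAt (fun t : ℝ => x + t • h) h t := by
      simpa using ((hasDerivAt_id t).smul_const h).const_add x
    exact ((hφ.differentiable one_ne_zero _).hasFDerivAt).comp_hasDerivAt t h1
  have hc : Continuous fun t : ℝ => fderiv ℝ φ (x + t • h) :=
    (hφ.continuous_fderiv one_ne_zero).comp (by fun_prop)
  have hint := intervalIntegral.integral_eq_sub_of_hasDerivAt hd
    ((hc.clm_apply continuous_const).intervalIntegrable 0 1)
  rw [one_smul, zero_smul, add_zero, intervalIntegral.integral_of_le zero_le_one] at hint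
  have e : φ x = φ (x + h) - ∫ t in Set.Ioc (0 : ℝ) 1, fderiv ℝ φ (x + t • h) h := by
    rw [hint]; ring
  rw [e]
  refine (enorm_sub_le).trans (add_le_add le_rfl ?_)
  refine (enorm_integral_le_lintegral_enorm _).trans ?_
  rw [restrict_Ioo_eq_restrict_Ioc, ← lintegral_const_mul _ hc.enorm.measurable]
  refine lintegral_mono fun t => ?_
  rw [mul_comm]
  exact ContinuousLinearMap.le_opENorm _ _

/-- The fundamental theorem of calculus along the segment from `x` to `x + Ry`, integrated over `y`
in the unit ball. -/
theorem volume_mul_enorm_le {φ : Sp N → ℝ} (hφ : ContDiff ℝ 1 φ) (x : Sp N) {R : ℝ} (hR : 0 < R) :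
    volume (unitBall N) * ‖φ x‖ₑ ≤ (∫⁻ y in unitBall N, ‖φ (x + R • y)‖ₑ) +
      ENNReal.ofReal R * ∫⁻ t in Set.Ioo (0 : ℝ) 1, ∫⁻ y in unitBall N,
        ‖fderiv ℝ φ (x + (t * R) • y)‖ₑ := by
  have hc1 : Measurable fun y : Sp N => ‖φ (x + R • y)‖ₑ :=
    (hφ.continuous.comp (by fun_prop)).enorm.measurable
  have hc2 : Measurable fun p : Sp N × ℝ => ‖fderiv ℝ φ (x + (p.2 * R) • p.1)‖ₑ :=
    ((hφ.continuous_fderiv one_ne_zero).comp (by fun_prop)).enorm.measurable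
  calc volume (unitBall N) * ‖φ x‖ₑ = ∫⁻ _ in unitBall N, ‖φ x‖ₑ := by
        rw [setLIntegral_const, mul_comm]
    _ ≤ ∫⁻ y in unitBall N, (‖φ (x + R • y)‖ₑ +
        ENNReal.ofReal R * ∫⁻ t in Set.Ioo (0 : ℝ) 1, ‖fderiv ℝ φ (x + (t * R) • y)‖ₑ) := by
        refine setLIntegral_mono' measurableSet_ball fun y hy => ?_
        refine (enorm_le_add_lintegral_fderiv hφ x (R • y)).trans ?_
        simp only [smul_smul]
        gcongr
        rw [enorm_smul, Real.enorm_of_nonneg hR.le]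
        have : ‖y‖ₑ ≤ 1 := by
          rw [mem_ball_zero_iff] at hy
          rw [← ofReal_norm, ← ENNReal.ofReal_one]
          exact ENNReal.ofReal_le_ofReal hy.le
        calc ENNReal.ofReal R * ‖y‖ₑ ≤ ENNReal.ofReal R * 1 := by gcongr
          _ = _ := mul_one _
    _ = _ := by
        rw [lintegral_add_left hc1, lintegral_const_mul _ hc2.lintegral_prod_right',
          lintegral_lintegral_swap hc2.aemeasurable]

theorem lintegral_Ioo_rpow_neg_ne_top {k : ℝ} (hk : k < 1) :
    ∫⁻ t in Set.Ioo (0 : ℝ) 1, ENNReal.ofReal t ^ (-k) ≠ ⊤ := by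
  have h : IntegrableOn (fun t : ℝ => t ^ (-k)) (Set.Ioo 0 1) :=
    (intervalIntegral.integrableOn_Ioo_rpow_iff zero_lt_one).2 (by linarith)
  have h2 := h.2
  rw [hasFiniteIntegral_iff_enorm] at h2
  refine ne_of_lt (lt_of_le_of_lt (le_of_eq ?_) h2)
  refine setLIntegral_congr_fun measurableSet_Ioo fun t ht => ?_
  rw [Real.enorm_of_nonneg (Real.rpow_nonneg ht.1.le _), ENNReal.ofReal_rpow_of_pos ht.1]

/-- Pointwise bound for the square of a function by averages. -/
theorem volume_mul_enorm_sq_le {φ : Sp N → ℝ} (hφ : ContDiff ℝ 1 φ) (x : Sp N) {R : ℝ}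
    (hR : 0 < R) (k : ℝ) :
    volume (unitBall N) * ‖φ x‖ₑ ^ 2 ≤ 2 * ((∫⁻ y in unitBall N, ‖φ (x + R • y)‖ₑ ^ 2) +
      ENNReal.ofReal R ^ 2 * ((∫⁻ t in Set.Ioo (0 : ℝ) 1, ENNReal.ofReal t ^ (-k)) *
        ∫⁻ t in Set.Ioo (0 : ℝ) 1, ENNReal.ofReal t ^ k * ∫⁻ y in unitBall N,
          ‖fderiv ℝ φ (x + (t * R) • y)‖ₑ ^ 2)) := by
  set m := volume (unitBall N)
  have hm0 : m ≠ 0 := volume_unitBall_ne_zero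
  have hmt : m ≠ ⊤ := volume_unitBall_ne_top
  have avg_sq : ∀ f : Sp N → ℝ≥0∞, Measurable f →
      (∫⁻ y in unitBall N, f y) ^ 2 ≤ m * ∫⁻ y in unitBall N, f y ^ 2 := by
    intro f hf
    have := sq_lintegral_mul_le (μ := volume.restrict (unitBall N)) (f := fun _ => 1)
      aemeasurable_const hf.aemeasurable
    simpa using this
  have hF : Continuous fun p : ℝ × Sp N => fderiv ℝ φ (x + (p.1 * R) • p.2) :=
    (hφ.continuous_fderiv one_ne_zero).comp (by fun_prop)
  let g : ℝ → ℝ≥0∞ := fun t => ∫⁻ y in unitBall N, ‖fderiv ℝ φ (x + (t * R) • y)‖ₑ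
  have hg : Measurable g := hF.enorm.measurable.lintegral_prod_right'
  have hpow : ∀ a : ℝ, Measurable fun t : ℝ => ENNReal.ofReal t ^ a := fun a =>
    ENNReal.measurable_ofReal.pow_const a
  -- Cauchy–Schwarz after inserting `t^{-k/2} t^{k/2}`. The weight `t^k` later meets a factor
  -- `t^{-2k}` from the averages at scale `tR`, and `t^{-k}` is integrable when `k < 1`.
  have hint : (∫⁻ t in Set.Ioo (0 : ℝ) 1, g t) ^ 2 ≤
      (∫⁻ t in Set.Ioo (0 : ℝ) 1, ENNReal.ofReal t ^ (-k)) *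
        ∫⁻ t in Set.Ioo (0 : ℝ) 1, ENNReal.ofReal t ^ k * (m * ∫⁻ y in unitBall N,
          ‖fderiv ℝ φ (x + (t * R) • y)‖ₑ ^ 2) := by
    have h := sq_lintegral_mul_le (μ := volume.restrict (Set.Ioo (0 : ℝ) 1))
      (hpow (-(k / 2))).aemeasurable ((hpow (k / 2)).mul hg).aemeasurable
    have e1 : ∫⁻ t in Set.Ioo (0 : ℝ) 1, g t = ∫⁻ t in Set.Ioo (0 : ℝ) 1,
        ENNReal.ofReal t ^ (-(k / 2)) * (ENNReal.ofReal t ^ (k / 2) * g t) := by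
      refine setLIntegral_congr_fun measurableSet_Ioo fun t ht => ?_
      have h0 : ENNReal.ofReal t ≠ 0 := by simpa using ht.1
      rw [← mul_assoc, ← ENNReal.rpow_add _ _ h0 ENNReal.ofReal_ne_top, neg_add_cancel,
        ENNReal.rpow_zero, one_mul]
    have e2 : ∀ t : ℝ, (ENNReal.ofReal t ^ (-(k / 2))) ^ 2 = ENNReal.ofReal t ^ (-k) := by
      intro t
      rw [← ENNReal.rpow_natCast, ← ENNReal.rpow_mul]
      congr 1
      push_cast
      ring
    have e3 : ∀ t : ℝ, (ENNReal.ofReal t ^ (k / 2)) ^ 2 = ENNReal.ofReal t ^ k := by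
      intro t
      rw [← ENNReal.rpow_natCast, ← ENNReal.rpow_mul]
      congr 1
      push_cast
      ring
    rw [e1]
    refine h.trans ?_
    simp only [e2, Pi.mul_apply, mul_pow, e3]
    gcongr with t
    exact avg_sq _ (hF.comp (by fun_prop : Continuous fun y => (t, y))).enorm.measurable
  have hmain := pow_le_pow_left' (volume_mul_enorm_le hφ x hR) 2
  -- Squaring the averaged bound produces two factors of the ball's volume on the left; one of them
  -- is cancelled here.
  rw [← ENNReal.mul_le_mul_iff_right hm0 hmt]
  calc m * (m * ‖φ x‖ₑ ^ 2) = (m * ‖φ x‖ₑ) ^ 2 := by ring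
    _ ≤ _ := hmain
    _ ≤ _ := ennreal_add_sq_le _ _
    _ ≤ 2 * (m * (∫⁻ y in unitBall N, ‖φ (x + R • y)‖ₑ ^ 2) + ENNReal.ofReal R ^ 2 * (
        (∫⁻ t in Set.Ioo (0 : ℝ) 1, ENNReal.ofReal t ^ (-k)) *
        ∫⁻ t in Set.Ioo (0 : ℝ) 1, ENNReal.ofReal t ^ k * (m * ∫⁻ y in unitBall N,
          ‖fderiv ℝ φ (x + (t * R) • y)‖ₑ ^ 2))) := by
      rw [mul_pow]
      gcongr
      exact avg_sq _ (hφ.continuous.comp (by fun_prop)).enorm.measurable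
    _ = _ := by
      have hF2 : Measurable fun t : ℝ => ENNReal.ofReal t ^ k * ∫⁻ y in unitBall N,
          ‖fderiv ℝ φ (x + (t * R) • y)‖ₑ ^ 2 :=
        (hpow k).mul (hF.enorm.measurable.pow_const 2).lintegral_prod_right'
      simp only [mul_left_comm _ m, lintegral_const_mul _ hF2]
      ring

end Averages

/-! ### Form bounds for `L^r` multipliers and a local Morrey inequality, both using `r > N`. -/

section Embeddings

variable {N : ℕ}

/-- Multiplication by a function in `L^r`, `r > N`, is form bounded with relative bound zero with
respect to the gradient. -/
theorem exists_lintegral_sq_mul_le {b : Sp N → ℝ≥0∞} (hb : AEMeasurable b) {r : ℝ} (hr : 2 ≤ r)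
    (hNr : (N : ℝ) < r) (hbr : ∫⁻ x, b x ^ r ≠ ⊤) {ε : ℝ≥0∞} (hε : ε ≠ 0) :
    ∃ C : ℝ≥0∞, C ≠ ⊤ ∧ ∀ φ : Sp N → ℝ, ContDiff ℝ 1 φ →
      ∫⁻ x, b x ^ 2 * ‖φ x‖ₑ ^ 2 ≤
        C * (∫⁻ x, ‖φ x‖ₑ ^ 2) + ε * ∫⁻ x, ‖fderiv ℝ φ x‖ₑ ^ 2 := by
  wlog hbm : Measurable b generalizing b
  · obtain ⟨C, hC, h⟩ := this (b := hb.mk b) hb.measurable_mk.aemeasurable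
      (by
        rwa [lintegral_congr_ae (g := fun x => hb.mk b x ^ r)
          (by filter_upwards [hb.ae_eq_mk] with x hx; rw [hx])] at hbr) hb.measurable_mk
    refine ⟨C, hC, fun φ hφ => ?_⟩
    rw [lintegral_congr_ae (g := fun x => hb.mk b x ^ 2 * ‖φ x‖ₑ ^ 2)
      (by filter_upwards [hb.ae_eq_mk] with x hx; rw [hx])]
    exact h φ hφ
  have hr0 : 0 < r := by linarith
  -- With this `k` the averages at scale `s` cost `s^{-2k}`, and `r > N` means `k < 1`.
  set k : ℝ := N / r
  have hk : k < 1 := (div_lt_one hr0).2 hNr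
  set m := volume (unitBall N)
  have hm0 : m ≠ 0 := volume_unitBall_ne_zero
  have hmt : m ≠ ⊤ := volume_unitBall_ne_top
  set T := ∫⁻ t in Set.Ioo (0 : ℝ) 1, ENNReal.ofReal t ^ (-k)
  have hT : T ≠ ⊤ := lintegral_Ioo_rpow_neg_ne_top hk
  set D := (∫⁻ x, b x ^ r) ^ (2 / r) * volume (unitBall N) ^ (1 - 2 / r)
  have hD : D ≠ ⊤ := ENNReal.mul_ne_top (ENNReal.rpow_ne_top_of_nonneg (by positivity) hbr)
    (ENNReal.rpow_ne_top_of_nonneg (sub_nonneg.2 ((div_le_one hr0).2 hr)) hmt)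
  have hmi : m⁻¹ ≠ ⊤ := ENNReal.inv_ne_top.2 hm0
  -- The coefficient of the gradient term at scale `R` is the displayed quantity: `R²` from the
  -- squared displacement and `R^{-2k}` from the average. As `k < 1` it is small for small `R`.
  obtain ⟨R, hR, hRε⟩ : ∃ R : ℝ, 0 < R ∧
      m⁻¹ * 2 * D * T ^ 2 * ENNReal.ofReal R ^ (2 - 2 * k) ≤ ε := by
    have h1 : Tendsto (fun R : ℝ => ENNReal.ofReal R ^ (2 - 2 * k)) (𝓝[>] 0) (𝓝 0) := by
      have h2 : Continuous fun R : ℝ => ENNReal.ofReal R ^ (2 - 2 * k) :=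
        ENNReal.continuous_rpow_const.comp ENNReal.continuous_ofReal
      have h3 := h2.tendsto 0
      rw [ENNReal.ofReal_zero, ENNReal.zero_rpow_of_pos (by linarith)] at h3
      exact h3.mono_left nhdsWithin_le_nhds
    have h4 := ENNReal.Tendsto.const_mul (a := m⁻¹ * 2 * D * T ^ 2) h1 (Or.inr (by finiteness))
    rw [mul_zero] at h4
    obtain ⟨R, h5, h6⟩ := ((h4.eventually_lt_const (pos_iff_ne_zero.2 hε)).and
      self_mem_nhdsWithin).exists
    exact ⟨R, h6, h5.le⟩
  have hR0 : ENNReal.ofReal R ≠ 0 := by simpa using hR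
  have hRt : ENNReal.ofReal R ≠ ⊤ := ENNReal.ofReal_ne_top
  have hRk : ENNReal.ofReal R ^ (-(2 * k)) ≠ ⊤ := by
    simp [ENNReal.rpow_eq_top_iff, hR0, hRt]
  refine ⟨m⁻¹ * 2 * (D * ENNReal.ofReal R ^ (-(2 * k))), by finiteness, fun φ hφ => ?_⟩
  have hpow : ∀ a : ℝ, Measurable fun t : ℝ => ENNReal.ofReal t ^ a := fun a =>
    ENNReal.measurable_ofReal.pow_const a
  have hφc := hφ.continuous
  have hF : Continuous (fderiv ℝ φ) := hφ.continuous_fderiv one_ne_zero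
  have hφm : Measurable fun x => ‖φ x‖ₑ ^ 2 := hφc.enorm.measurable.pow_const 2
  have hFm : Measurable fun x => ‖fderiv ℝ φ x‖ₑ ^ 2 := hF.enorm.measurable.pow_const 2
  have hb2 : Measurable fun x => b x ^ 2 := hbm.pow_const 2
  have m1 : Measurable fun x => ∫⁻ y in unitBall N, ‖φ (x + R • y)‖ₑ ^ 2 :=
    (hφm.comp (by fun_prop : Measurable fun p : Sp N × Sp N => p.1 + R • p.2)).lintegral_prod_right'
  have m2 : Measurable fun p : Sp N × ℝ => ENNReal.ofReal p.2 ^ k * ∫⁻ y in unitBall N,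
      ‖fderiv ℝ φ (p.1 + (p.2 * R) • y)‖ₑ ^ 2 :=
    ((hpow k).comp measurable_snd).mul (hFm.comp (by fun_prop : Measurable
      fun q : (Sp N × ℝ) × Sp N => q.1.1 + (q.1.2 * R) • q.2)).lintegral_prod_right'
  have m3 : Measurable fun x => ∫⁻ t in Set.Ioo (0 : ℝ) 1, ENNReal.ofReal t ^ k *
      ∫⁻ y in unitBall N, ‖fderiv ℝ φ (x + (t * R) • y)‖ₑ ^ 2 := m2.lintegral_prod_right'
  have m2' : Measurable fun p : Sp N × ℝ => b p.1 ^ 2 * (ENNReal.ofReal p.2 ^ k *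
      ∫⁻ y in unitBall N, ‖fderiv ℝ φ (p.1 + (p.2 * R) • y)‖ₑ ^ 2) :=
    (hb2.comp measurable_fst).mul m2
  have est2 : ∫⁻ x, b x ^ 2 * (∫⁻ t in Set.Ioo (0 : ℝ) 1, ENNReal.ofReal t ^ k *
      ∫⁻ y in unitBall N, ‖fderiv ℝ φ (x + (t * R) • y)‖ₑ ^ 2) ≤
      D * ENNReal.ofReal R ^ (-(2 * k)) * T * ∫⁻ x, ‖fderiv ℝ φ x‖ₑ ^ 2 := by
    calc _ = ∫⁻ x, ∫⁻ t in Set.Ioo (0 : ℝ) 1, b x ^ 2 * (ENNReal.ofReal t ^ k *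
          ∫⁻ y in unitBall N, ‖fderiv ℝ φ (x + (t * R) • y)‖ₑ ^ 2) :=
          lintegral_congr fun x => (lintegral_const_mul _
            (m2.comp (measurable_const.prodMk measurable_id))).symm
      _ = ∫⁻ t in Set.Ioo (0 : ℝ) 1, ∫⁻ x, b x ^ 2 * (ENNReal.ofReal t ^ k *
          ∫⁻ y in unitBall N, ‖fderiv ℝ φ (x + (t * R) • y)‖ₑ ^ 2) :=
          lintegral_lintegral_swap m2'.aemeasurable
      _ ≤ ∫⁻ t in Set.Ioo (0 : ℝ) 1, ENNReal.ofReal t ^ (-k) *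
          (D * ENNReal.ofReal R ^ (-(2 * k)) * ∫⁻ x, ‖fderiv ℝ φ x‖ₑ ^ 2) := by
          refine setLIntegral_mono' measurableSet_Ioo fun t ht => ?_
          have ht0 : ENNReal.ofReal t ≠ 0 := by simpa using ht.1
          have htt : ENNReal.ofReal t ≠ ⊤ := ENNReal.ofReal_ne_top
          have m4 : Measurable fun x => ∫⁻ y in unitBall N,
              ‖fderiv ℝ φ (x + (t * R) • y)‖ₑ ^ 2 :=
            (hFm.comp (by fun_prop : Measurable
              fun p : Sp N × Sp N => p.1 + (t * R) • p.2)).lintegral_prod_right'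
          simp only [mul_left_comm (b _ ^ 2)]
          rw [lintegral_const_mul' _ _ (by simp [ENNReal.rpow_eq_top_iff, ht0, htt])]
          calc _ ≤ ENNReal.ofReal t ^ k * (D * ENNReal.ofReal (t * R) ^ (-(2 * k)) *
                ∫⁻ x, ‖fderiv ℝ φ x‖ₑ ^ 2) := by
                gcongr
                exact lintegral_sq_mul_average_le hbm hFm hr (mul_pos ht.1 hR)
            _ = (ENNReal.ofReal t ^ k * ENNReal.ofReal t ^ (-(2 * k))) *
                (D * ENNReal.ofReal R ^ (-(2 * k)) * ∫⁻ x, ‖fderiv ℝ φ x‖ₑ ^ 2) := by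
                rw [ENNReal.ofReal_mul ht.1.le, ENNReal.mul_rpow_of_ne_top htt hRt]
                ring
            _ = _ := by
                rw [← ENNReal.rpow_add _ _ ht0 htt]
                ring_nf
      _ = _ := by
          rw [lintegral_mul_const _ (hpow _)]
          ring
  have hmain : m * ∫⁻ x, b x ^ 2 * ‖φ x‖ₑ ^ 2 ≤
      2 * (D * ENNReal.ofReal R ^ (-(2 * k)) * (∫⁻ x, ‖φ x‖ₑ ^ 2) + ENNReal.ofReal R ^ 2 * (T *
        (D * ENNReal.ofReal R ^ (-(2 * k)) * T * ∫⁻ x, ‖fderiv ℝ φ x‖ₑ ^ 2))) := by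
    calc m * ∫⁻ x, b x ^ 2 * ‖φ x‖ₑ ^ 2 = ∫⁻ x, b x ^ 2 * (m * ‖φ x‖ₑ ^ 2) := by
          simp only [mul_left_comm _ m]
          rw [lintegral_const_mul' _ _ hmt]
      _ ≤ ∫⁻ x, b x ^ 2 * (2 * ((∫⁻ y in unitBall N, ‖φ (x + R • y)‖ₑ ^ 2) +
          ENNReal.ofReal R ^ 2 * (T * ∫⁻ t in Set.Ioo (0 : ℝ) 1, ENNReal.ofReal t ^ k *
            ∫⁻ y in unitBall N, ‖fderiv ℝ φ (x + (t * R) • y)‖ₑ ^ 2))) := by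
          exact lintegral_mono fun x => mul_le_mul_right (volume_mul_enorm_sq_le hφ x hR k) _
      _ = 2 * ((∫⁻ x, b x ^ 2 * ∫⁻ y in unitBall N, ‖φ (x + R • y)‖ₑ ^ 2) +
          ENNReal.ofReal R ^ 2 * (T * ∫⁻ x, b x ^ 2 * (∫⁻ t in Set.Ioo (0 : ℝ) 1,
            ENNReal.ofReal t ^ k *
              ∫⁻ y in unitBall N, ‖fderiv ℝ φ (x + (t * R) • y)‖ₑ ^ 2))) := by
          simp only [mul_left_comm (b _ ^ 2), mul_add]
          rw [lintegral_add_left (by fun_prop), lintegral_const_mul _ (by fun_prop),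
            lintegral_const_mul _ (by fun_prop), lintegral_const_mul _ (by fun_prop),
            lintegral_const_mul _ (by fun_prop)]
      _ ≤ _ := by
          gcongr
          exact lintegral_sq_mul_average_le hbm hφm hr hR
  have hRR : ENNReal.ofReal R ^ 2 * ENNReal.ofReal R ^ (-(2 * k)) =
      ENNReal.ofReal R ^ (2 - 2 * k) := by
    rw [← ENNReal.rpow_two, ← ENNReal.rpow_add _ _ hR0 hRt, sub_eq_add_neg]
  calc ∫⁻ x, b x ^ 2 * ‖φ x‖ₑ ^ 2 = m⁻¹ * (m * ∫⁻ x, b x ^ 2 * ‖φ x‖ₑ ^ 2) := by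
        rw [← mul_assoc, ENNReal.inv_mul_cancel hm0 hmt, one_mul]
    _ ≤ _ := mul_le_mul_right hmain _
    _ = m⁻¹ * 2 * (D * ENNReal.ofReal R ^ (-(2 * k))) * (∫⁻ x, ‖φ x‖ₑ ^ 2) +
        (m⁻¹ * 2 * D * T ^ 2 * (ENNReal.ofReal R ^ 2 * ENNReal.ofReal R ^ (-(2 * k)))) *
          ∫⁻ x, ‖fderiv ℝ φ x‖ₑ ^ 2 := by ring
    _ ≤ _ := by
      rw [hRR]
      gcongr

theorem setLIntegral_comp_add_smul_le {f : Sp N → ℝ≥0∞} (hf : Measurable f) (x : Sp N) {s : ℝ}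
    (hs : 0 < s) (hs1 : s ≤ 1) :
    ∫⁻ y in unitBall N, f (x + s • y) ≤
      (ENNReal.ofReal s ^ N)⁻¹ * ∫⁻ y in Metric.closedBall x 1, f y := by
  rw [← lintegral_indicator measurableSet_closedBall,
    ← lintegral_comp_add_smul (hf.indicator measurableSet_closedBall) x hs]
  rw [← lintegral_indicator measurableSet_ball]
  refine lintegral_mono fun y => ?_
  by_cases hy : y ∈ unitBall N
  · have : x + s • y ∈ Metric.closedBall x 1 := by
      rw [mem_closedBall_iff_norm, add_sub_cancel_left, norm_smul, Real.norm_of_nonneg hs.le]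
      rw [mem_ball_zero_iff] at hy
      nlinarith [norm_nonneg y]
    simp [Set.indicator_of_mem hy, Set.indicator_of_mem this]
  · simp [Set.indicator_of_notMem hy]

/-- Hölder's inequality for the averages in `volume_mul_enorm_le`. -/
theorem lintegral_average_le {F : Sp N → ℝ≥0∞} (hF : Measurable F) {r : ℝ} (hr : 1 ≤ r)
    (x : Sp N) :
    ∫⁻ t in Set.Ioo (0 : ℝ) 1, ∫⁻ y in unitBall N, F (x + t • y) ≤
      volume (unitBall N) ^ (1 - 1 / r) *
        (∫⁻ t in Set.Ioo (0 : ℝ) 1, ENNReal.ofReal t ^ (-(N / r))) *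
        (∫⁻ y in Metric.closedBall x 1, F y ^ r) ^ (1 / r) := by
  have hr0 : 0 < r := by linarith
  set m := volume (unitBall N)
  set I := (∫⁻ y in Metric.closedBall x 1, F y ^ r) ^ (1 / r)
  calc _ ≤ ∫⁻ t in Set.Ioo (0 : ℝ) 1, ENNReal.ofReal t ^ (-(N / r)) * (m ^ (1 - 1 / r) * I) := by
        refine setLIntegral_mono' measurableSet_Ioo fun t ht => ?_
        have h3 := lintegral_rpow_le_rpow_mul_measure (μ := volume.restrict (unitBall N))
          (f := fun y => F (x + t • y)) (hF.comp (by fun_prop)).aemeasurable zero_le_one hr0 hr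
        simp only [ENNReal.rpow_one, Measure.restrict_apply_univ] at h3
        refine h3.trans ?_
        calc _ ≤ ((ENNReal.ofReal t ^ N)⁻¹ *
              ∫⁻ y in Metric.closedBall x 1, F y ^ r) ^ (1 / r) * m ^ (1 - 1 / r) := by
              gcongr
              exact setLIntegral_comp_add_smul_le (hF.pow_const r) x ht.1 ht.2.le
          _ = _ := by
              rw [ENNReal.mul_rpow_of_nonneg _ _ (by positivity), ← ENNReal.rpow_natCast,
                ← ENNReal.rpow_neg, ← ENNReal.rpow_mul,
                show -(N : ℝ) * (1 / r) = -(N / r) by ring]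
              ring
    _ = _ := by
        rw [lintegral_mul_const _ (ENNReal.measurable_ofReal.pow_const _)]
        ring

/-- A translation by `s y` with `|s y| ≤ 1` moves the ball of radius `R` into the ball of radius `R
+ 1`. -/
theorem setLIntegral_average_le {d : Sp N → ℝ≥0∞} (hd : Measurable d) (R : ℝ) {s : ℝ}
    (hs : 0 ≤ s) (hs1 : s ≤ 1) :
    ∫⁻ x in Metric.closedBall 0 R, ∫⁻ y in unitBall N, d (x + s • y) ≤
      volume (unitBall N) * ∫⁻ x in Metric.closedBall 0 (R + 1), d x := by
  have hm : Measurable fun p : Sp N × Sp N => d (p.1 + s • p.2) := hd.comp (by fun_prop)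
  rw [lintegral_lintegral_swap hm.aemeasurable, mul_comm, ← setLIntegral_const]
  refine setLIntegral_mono' measurableSet_ball fun y hy => ?_
  rw [← lintegral_indicator measurableSet_closedBall, ← lintegral_indicator measurableSet_closedBall,
    ← lintegral_add_right_eq_self ((Metric.closedBall 0 (R + 1)).indicator d) (s • y)]
  refine lintegral_mono fun x => ?_
  by_cases hx : x ∈ Metric.closedBall (0 : Sp N) R
  · have : x + s • y ∈ Metric.closedBall (0 : Sp N) (R + 1) := by
      rw [mem_closedBall_zero_iff] at hx ⊢
      rw [mem_ball_zero_iff] at hy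
      have h1 : ‖s • y‖ ≤ 1 := by
        rw [norm_smul, Real.norm_of_nonneg hs]
        nlinarith [norm_nonneg y]
      exact (norm_add_le _ _).trans (add_le_add hx h1)
    rw [Set.indicator_of_mem hx, Set.indicator_of_mem this]
  · simp [Set.indicator_of_notMem hx]

/-- A local form of Morrey's inequality for limits of smooth functions. -/
theorem exists_ae_enorm_le_of_tendsto {r : ℝ} (hr : 1 ≤ r) (hNr : (N : ℝ) < r) {R : ℝ}
    {φ : ℕ → Sp N → ℝ} (hφ : ∀ n, ContDiff ℝ 1 (φ n)) {u : Sp N → ℝ} (hu : Measurable u)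
    {F : Sp N → (Sp N →L[ℝ] ℝ)} (hF : Measurable F)
    (hui : ∫⁻ x in Metric.closedBall 0 (R + 1), ‖u x‖ₑ ≠ ⊤)
    (hFr : ∫⁻ x in Metric.closedBall 0 (R + 1), ‖F x‖ₑ ^ r ≠ ⊤)
    (hlim : Tendsto (fun n => ∫⁻ x in Metric.closedBall 0 (R + 1), ‖φ n x - u x‖ₑ) atTop (𝓝 0))
    (hlimF : Tendsto (fun n => ∫⁻ x in Metric.closedBall 0 (R + 1), ‖fderiv ℝ (φ n) x - F x‖ₑ)
      atTop (𝓝 0)) :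
    ∃ C : ℝ≥0∞, C ≠ ⊤ ∧ ∀ᵐ x ∂(volume.restrict (Metric.closedBall 0 R)), ‖u x‖ₑ ≤ C := by
  have hr0 : 0 < r := by linarith
  set m := volume (unitBall N)
  have hm0 : m ≠ 0 := volume_unitBall_ne_zero
  have hmt : m ≠ ⊤ := volume_unitBall_ne_top
  have hmi : m⁻¹ ≠ ⊤ := ENNReal.inv_ne_top.2 hm0
  set T := ∫⁻ t in Set.Ioo (0 : ℝ) 1, ENNReal.ofReal t ^ (-(N / r))
  have hT : T ≠ ⊤ := lintegral_Ioo_rpow_neg_ne_top ((div_lt_one hr0).2 hNr)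
  have hM : m ^ (1 - 1 / r) ≠ ⊤ :=
    ENNReal.rpow_ne_top_of_nonneg (sub_nonneg.2 ((div_le_one hr0).2 hr)) hmt
  set B := Metric.closedBall (0 : Sp N) R
  set B' := Metric.closedBall (0 : Sp N) (R + 1)
  have hIr : (∫⁻ x in B', ‖F x‖ₑ ^ r) ^ (1 / r) ≠ ⊤ :=
    ENNReal.rpow_ne_top_of_nonneg (by positivity) hFr
  set C := (∫⁻ x in B', ‖u x‖ₑ) + m ^ (1 - 1 / r) * T * (∫⁻ x in B', ‖F x‖ₑ ^ r) ^ (1 / r)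
  have hC : C ≠ ⊤ := by finiteness
  let d : ℕ → Sp N → ℝ≥0∞ := fun n x => ‖φ n x - u x‖ₑ
  let e : ℕ → Sp N → ℝ≥0∞ := fun n x => ‖fderiv ℝ (φ n) x - F x‖ₑ
  have hd : ∀ n, Measurable (d n) := fun n => ((hφ n).continuous.measurable.sub hu).enorm
  have he : ∀ n, Measurable (e n) := fun n =>
    (((hφ n).continuous_fderiv one_ne_zero).measurable.sub hF).enorm
  -- The total error of replacing `φ n` and its derivative by `u` and `F` in the averaged bound. The
  -- derivatives converge only in `L¹`, so `q n` is small in integral rather than pointwise.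
  let q : ℕ → Sp N → ℝ≥0∞ := fun n x => m * d n x + ((∫⁻ y in unitBall N, d n (x + (1 : ℝ) • y)) +
    ∫⁻ t in Set.Ioo (0 : ℝ) 1, ∫⁻ y in unitBall N, e n (x + t • y))
  have hav : ∀ n, Measurable fun x => ∫⁻ y in unitBall N, d n (x + (1 : ℝ) • y) := fun n =>
    ((hd n).comp (by fun_prop : Measurable
      fun p : Sp N × Sp N => p.1 + (1 : ℝ) • p.2)).lintegral_prod_right'
  have hae : ∀ n, Measurable fun p : Sp N × ℝ => ∫⁻ y in unitBall N, e n (p.1 + p.2 • y) := fun n =>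
    ((he n).comp (by fun_prop : Measurable
      fun p : (Sp N × ℝ) × Sp N => p.1.1 + p.1.2 • p.2)).lintegral_prod_right'
  have key : ∀ n, ∀ x ∈ B, m * ‖u x‖ₑ ≤ C + q n x := by
    intro n x hx
    have hsub : Metric.closedBall x 1 ⊆ B' := by
      refine Metric.closedBall_subset_closedBall' ?_
      have : dist x 0 ≤ R := hx
      linarith
    have h0 := volume_mul_enorm_le (hφ n) x zero_lt_one
    simp only [ENNReal.ofReal_one, one_mul, mul_one] at h0
    have h1 : ∫⁻ y in unitBall N, ‖φ n (x + (1 : ℝ) • y)‖ₑ ≤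
        (∫⁻ x in B', ‖u x‖ₑ) + ∫⁻ y in unitBall N, d n (x + (1 : ℝ) • y) := by
      calc _ ≤ ∫⁻ y in unitBall N, (‖u (x + (1 : ℝ) • y)‖ₑ + d n (x + (1 : ℝ) • y)) := by
            refine lintegral_mono fun y => ?_
            refine le_trans (le_of_eq ?_) (enorm_add_le _ _)
            rw [add_sub_cancel]
        _ = (∫⁻ y in unitBall N, ‖u (x + (1 : ℝ) • y)‖ₑ) +
            ∫⁻ y in unitBall N, d n (x + (1 : ℝ) • y) :=
            lintegral_add_left (hu.enorm.comp (by fun_prop)) _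
        _ ≤ _ := by
            refine add_le_add ?_ le_rfl
            refine (setLIntegral_comp_add_smul_le hu.enorm x zero_lt_one le_rfl).trans ?_
            simp only [ENNReal.ofReal_one, one_pow, inv_one, one_mul]
            exact lintegral_mono_set hsub
    have h2 : ∫⁻ t in Set.Ioo (0 : ℝ) 1, ∫⁻ y in unitBall N, ‖fderiv ℝ (φ n) (x + t • y)‖ₑ ≤
        m ^ (1 - 1 / r) * T * (∫⁻ x in B', ‖F x‖ₑ ^ r) ^ (1 / r) +
          ∫⁻ t in Set.Ioo (0 : ℝ) 1, ∫⁻ y in unitBall N, e n (x + t • y) := by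
      have hFa : Measurable fun t : ℝ => ∫⁻ y in unitBall N, ‖F (x + t • y)‖ₑ :=
        (hF.enorm.comp (by fun_prop : Measurable
          fun p : ℝ × Sp N => x + p.1 • p.2)).lintegral_prod_right'
      calc _ ≤ ∫⁻ t in Set.Ioo (0 : ℝ) 1, ((∫⁻ y in unitBall N, ‖F (x + t • y)‖ₑ) +
            ∫⁻ y in unitBall N, e n (x + t • y)) := by
            refine lintegral_mono fun t => ?_
            have hFt : Measurable fun y : Sp N => ‖F (x + t • y)‖ₑ := hF.enorm.comp (by fun_prop)
            rw [← lintegral_add_left hFt]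
            refine lintegral_mono fun y => ?_
            have h3 := enorm_add_le (F (x + t • y)) (fderiv ℝ (φ n) (x + t • y) - F (x + t • y))
            rwa [add_sub_cancel] at h3
        _ = _ := lintegral_add_left hFa _
        _ ≤ _ := by
            refine add_le_add ?_ le_rfl
            refine (lintegral_average_le hF.enorm hr x).trans ?_
            gcongr
    calc m * ‖u x‖ₑ ≤ m * (‖φ n x‖ₑ + d n x) := by
          gcongr
          refine le_trans (le_of_eq ?_) enorm_sub_le
          rw [sub_sub_cancel]
      _ = m * d n x + m * ‖φ n x‖ₑ := by ring
      _ ≤ _ := add_le_add le_rfl (h0.trans (add_le_add h1 h2))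
      _ = C + q n x := by
          simp only [C, q]
          ring
  have hq : ∀ n, ∫⁻ x in B, q n x ≤ 2 * m * (∫⁻ x in B', d n x) + m * ∫⁻ x in B', e n x := by
    intro n
    have h1 : ∫⁻ x in B, ∫⁻ t in Set.Ioo (0 : ℝ) 1, ∫⁻ y in unitBall N, e n (x + t • y) ≤
        m * ∫⁻ x in B', e n x := by
      rw [lintegral_lintegral_swap (hae n).aemeasurable]
      calc _ ≤ ∫⁻ _ in Set.Ioo (0 : ℝ) 1, m * ∫⁻ x in B', e n x :=
            setLIntegral_mono' measurableSet_Ioo fun t ht =>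
              setLIntegral_average_le (he n) R ht.1.le ht.2.le
        _ = _ := by simp
    have h2 : ∫⁻ x in B, d n x ≤ ∫⁻ x in B', d n x :=
      lintegral_mono_set (Metric.closedBall_subset_closedBall (by linarith))
    have h3 := setLIntegral_average_le (hd n) R zero_le_one le_rfl
    calc ∫⁻ x in B, q n x = m * (∫⁻ x in B, d n x) +
          ((∫⁻ x in B, ∫⁻ y in unitBall N, d n (x + (1 : ℝ) • y)) +
          ∫⁻ x in B, ∫⁻ t in Set.Ioo (0 : ℝ) 1, ∫⁻ y in unitBall N, e n (x + t • y)) := by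
          simp only [q]
          rw [lintegral_add_left ((hd n).const_mul m), lintegral_add_left (hav n),
            lintegral_const_mul _ (hd n)]
      _ ≤ m * (∫⁻ x in B', d n x) + (m * (∫⁻ x in B', d n x) + m * ∫⁻ x in B', e n x) := by
          gcongr
      _ = _ := by ring
  have hq0 : Tendsto (fun n => 2 * m * (∫⁻ x in B', d n x) + m * ∫⁻ x in B', e n x) atTop
      (𝓝 0) := by
    have h1 := ENNReal.Tendsto.const_mul (a := 2 * m) hlim (Or.inr (by finiteness))
    have h2 := ENNReal.Tendsto.const_mul (a := m) hlimF (Or.inr hmt)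
    simpa using h1.add h2
  -- Subtraction in `ℝ≥0∞` is truncated: the integrand is the positive part of `m|u| - C`, which
  -- lies below every `q n`.
  have hzero : ∫⁻ x in B, (m * ‖u x‖ₑ - C) = 0 := by
    refine le_antisymm (ge_of_tendsto' hq0 fun n => ?_) zero_le
    refine le_trans (setLIntegral_mono' measurableSet_closedBall fun x hx => ?_) (hq n)
    exact tsub_le_iff_left.2 (key n x hx)
  have hmu : Measurable fun x => m * ‖u x‖ₑ - C := (hu.enorm.const_mul m).sub measurable_const
  rw [lintegral_eq_zero_iff hmu] at hzero
  refine ⟨m⁻¹ * C, by finiteness, ?_⟩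
  filter_upwards [hzero] with x hx
  have h1 : m * ‖u x‖ₑ ≤ C := tsub_eq_zero_iff_le.1 hx
  calc ‖u x‖ₑ = m⁻¹ * (m * ‖u x‖ₑ) := by
        rw [← mul_assoc, ENNReal.inv_mul_cancel hm0 hmt, one_mul]
    _ ≤ _ := by gcongr

end Embeddings

/-! ### Mollification of locally integrable functions and of weak gradients. -/

section Mollification

open scoped Convolution

variable {N : ℕ}

/-- A sequence of bump functions shrinking to the origin. -/
def shrinkingBump (N n : ℕ) : ContDiffBump (0 : Sp N) where
  rIn := 1 / (2 * ((n : ℝ) + 1))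
  rOut := 1 / ((n : ℝ) + 1)
  rIn_pos := by positivity
  rIn_lt_rOut := by
    apply one_div_lt_one_div_of_lt <;> linarith [(Nat.cast_nonneg n : (0 : ℝ) ≤ n)]

/-- The kernels used for mollification. -/
def mollifier (N n : ℕ) : Sp N → ℝ := (shrinkingBump N n).normed volume

/-- Convolution with `mollifier N n`. -/
def mollify {F : Type*} [NormedAddCommGroup F] [NormedSpace ℝ F] (n : ℕ) (u : Sp N → F) :
    Sp N → F :=
  mollifier N n ⋆[ContinuousLinearMap.lsmul ℝ ℝ, volume] u

theorem contDiff_mollifier (n : ℕ) : ContDiff ℝ ∞ (mollifier N n) :=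
  (shrinkingBump N n).contDiff_normed

theorem hasCompactSupport_mollifier (n : ℕ) : HasCompactSupport (mollifier N n) :=
  (shrinkingBump N n).hasCompactSupport_normed

theorem mollifier_nonneg (n : ℕ) (x : Sp N) : 0 ≤ mollifier N n x :=
  (shrinkingBump N n).nonneg_normed x

theorem support_mollifier_subset (n : ℕ) :
    Function.support (mollifier N n) ⊆ Metric.ball 0 1 := by
  rw [mollifier, ContDiffBump.support_normed_eq]
  refine Metric.ball_subset_ball ?_
  change 1 / ((n : ℝ) + 1) ≤ 1
  rw [div_le_one (by positivity)]
  linarith [(Nat.cast_nonneg n : (0 : ℝ) ≤ n)]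

theorem lintegral_enorm_mollifier (n : ℕ) : ∫⁻ x, ‖mollifier N n x‖ₑ = 1 := by
  have h1 : Integrable (mollifier N n) := (shrinkingBump N n).integrable_normed
  have h2 := ofReal_integral_eq_lintegral_ofReal h1 (Eventually.of_forall (mollifier_nonneg n))
  rw [show ∫ x, mollifier N n x = 1 from (shrinkingBump N n).integral_normed (μ := volume),
    ENNReal.ofReal_one] at h2
  rw [h2]
  exact lintegral_congr fun x => Real.enorm_of_nonneg (mollifier_nonneg n x)

theorem tendsto_rOut_shrinkingBump :
    Tendsto (fun n => (shrinkingBump N n).rOut) atTop (𝓝 0) :=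
  tendsto_one_div_add_atTop_nhds_zero_nat

variable {F : Type*} [NormedAddCommGroup F] [NormedSpace ℝ F]

theorem contDiff_mollify (n : ℕ) {u : Sp N → F} (hu : LocallyIntegrable u) :
    ContDiff ℝ ∞ (mollify n u) :=
  (hasCompactSupport_mollifier n).contDiff_convolution_left _ (contDiff_mollifier n) hu

theorem mollify_apply (n : ℕ) (u : Sp N → F) (x : Sp N) :
    mollify n u x = ∫ y, mollifier N n (x - y) • u y := by
  rw [mollify, convolution_lsmul_swap]

theorem integrable_mollifier_smul (n : ℕ) {u : Sp N → F} (hu : LocallyIntegrable u) (x : Sp N) :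
    Integrable fun y => mollifier N n (x - y) • u y :=
  ((hasCompactSupport_mollifier n).convolutionExists_left
    (ContinuousLinearMap.lsmul ℝ ℝ) (contDiff_mollifier n).continuous hu x).integrable_swap

theorem mollify_sub (n : ℕ) {u v : Sp N → F} (hu : LocallyIntegrable u)
    (hv : LocallyIntegrable v) (x : Sp N) :
    mollify n (fun y => u y - v y) x = mollify n u x - mollify n v x := by
  simp only [mollify_apply, smul_sub]
  exact integral_sub (integrable_mollifier_smul n hu x) (integrable_mollifier_smul n hv x)

theorem lintegral_enorm_mollify_le (n : ℕ) {u : Sp N → F} (hu : AEStronglyMeasurable u) :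
    ∫⁻ x, ‖mollify n u x‖ₑ ≤ ∫⁻ x, ‖u x‖ₑ := by
  have hm : AEMeasurable (Function.uncurry fun (x t : Sp N) => ‖mollifier N n t‖ₑ * ‖u (x - t)‖ₑ)
      (volume.prod volume) :=
    ((contDiff_mollifier n).continuous.enorm.measurable.comp measurable_snd).aemeasurable.mul
      (hu.enorm.comp_quasiMeasurePreserving
        (quasiMeasurePreserving_sub_of_right_invariant volume volume))
  calc ∫⁻ x, ‖mollify n u x‖ₑ ≤ ∫⁻ x, ∫⁻ t, ‖mollifier N n t‖ₑ * ‖u (x - t)‖ₑ := by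
        refine lintegral_mono fun x => ?_
        rw [mollify, convolution_lsmul]
        refine (enorm_integral_le_lintegral_enorm _).trans (le_of_eq ?_)
        simp only [enorm_smul]
    _ = ∫⁻ t, ∫⁻ x, ‖mollifier N n t‖ₑ * ‖u (x - t)‖ₑ := lintegral_lintegral_swap hm
    _ = ∫⁻ t, ‖mollifier N n t‖ₑ * ∫⁻ x, ‖u x‖ₑ := by
        refine lintegral_congr fun t => ?_
        rw [lintegral_const_mul' _ _ enorm_ne_top, lintegral_sub_right_eq_self (fun x => ‖u x‖ₑ) t]
    _ = ∫⁻ x, ‖u x‖ₑ := by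
        rw [lintegral_mul_const _ (contDiff_mollifier n).continuous.enorm.measurable,
          lintegral_enorm_mollifier, one_mul]

/-- After truncation, approximate in `L¹` by a compactly supported continuous function, whose
mollifications converge uniformly; the `L¹` contraction property controls the remainder. -/
theorem tendsto_lintegral_mollify_sub [CompleteSpace F] {u : Sp N → F} (hu : LocallyIntegrable u)
    (R : ℝ) :
    Tendsto (fun n => ∫⁻ x in Metric.closedBall 0 R, ‖mollify n u x - u x‖ₑ) atTop (𝓝 0) := by
  set B : Set (Sp N) := Metric.closedBall 0 R
  set B' : Set (Sp N) := Metric.closedBall 0 (R + 1)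
  have hBfin : volume B ≠ ⊤ := measure_closedBall_lt_top.ne
  set v := B'.indicator u
  have hv : Integrable v :=
    (hu.integrableOn_isCompact (isCompact_closedBall _ _)).integrable_indicator
      measurableSet_closedBall
  -- All mollifiers are supported in the unit ball, so on radius `R` only the values on radius `R +
  -- 1` matter.
  have huv : ∀ n, ∀ x ∈ B, mollify n u x - u x = mollify n v x - v x := by
    intro n x hx
    have hxB' : x ∈ B' := Metric.closedBall_subset_closedBall (by linarith) hx
    have h1 : mollify n u x = mollify n v x := by
      simp only [mollify_apply]
      congr 1
      funext y
      by_cases hy : mollifier N n (x - y) = 0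
      · simp [hy]
      · have h2 := support_mollifier_subset n (Function.mem_support.2 hy)
        have h3 : y ∈ B' := by
          rw [mem_ball_zero_iff] at h2
          simp only [B, B', mem_closedBall_zero_iff] at hx ⊢
          calc ‖y‖ = ‖x - (x - y)‖ := by rw [sub_sub_cancel]
            _ ≤ ‖x‖ + ‖x - y‖ := norm_sub_le _ _
            _ ≤ R + 1 := by linarith
        simp only [v, Set.indicator_of_mem h3]
    rw [h1]
    simp only [v, Set.indicator_of_mem hxB']
  rw [ENNReal.tendsto_nhds_zero]
  intro ε hε
  obtain ⟨δ, hδ, hδε⟩ : ∃ δ : ℝ≥0∞, δ ≠ 0 ∧ δ + δ ≤ ε / 2 :=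
    ⟨ε / 2 / 2, by simp [hε.ne'], (ENNReal.add_halves _).le⟩
  obtain ⟨g, hgs, hvg, hgc, hgi⟩ := hv.exists_hasCompactSupport_lintegral_sub_le hδ
  obtain ⟨κ, hκ, hκε⟩ : ∃ κ : ℝ, 0 < κ ∧ ENNReal.ofReal κ * volume B ≤ ε / 2 := by
    have h1 : Tendsto (fun κ : ℝ => ENNReal.ofReal κ * volume B) (𝓝[>] 0) (𝓝 0) := by
      have := ENNReal.Tendsto.mul_const (b := volume B)
        (ENNReal.tendsto_ofReal (tendsto_id (α := ℝ) (x := 𝓝 0))) (Or.inr hBfin)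
      rw [ENNReal.ofReal_zero, zero_mul] at this
      exact this.mono_left nhdsWithin_le_nhds
    obtain ⟨κ, h2, h3⟩ := ((h1.eventually_lt_const (ENNReal.half_pos hε.ne')).and
      self_mem_nhdsWithin).exists
    exact ⟨κ, h3, h2.le⟩
  obtain ⟨s, hs, hgs'⟩ := Metric.uniformContinuous_iff.1
    (hgs.uniformContinuous_of_continuous hgc) κ hκ
  filter_upwards [tendsto_rOut_shrinkingBump.eventually_lt_const hs] with n hn
  have hgn : ∀ x, ‖mollify n g x - g x‖ₑ ≤ ENNReal.ofReal κ := by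
    intro x
    have := ContDiffBump.dist_normed_convolution_le (φ := shrinkingBump N n) (x₀ := x)
      (ε := κ) (μ := volume) hgc.aestronglyMeasurable
      fun y hy => (hgs' (lt_trans (Metric.mem_ball.1 hy) hn)).le
    rw [dist_eq_norm] at this
    rw [← ofReal_norm]
    exact ENNReal.ofReal_le_ofReal this
  have hmvg : AEStronglyMeasurable fun x => v x - g x :=
    hv.aestronglyMeasurable.sub hgi.aestronglyMeasurable
  have hmm : Continuous (mollify n (fun x => v x - g x)) :=
    (contDiff_mollify n (hv.sub hgi).locallyIntegrable).continuous
  calc ∫⁻ x in B, ‖mollify n u x - u x‖ₑ = ∫⁻ x in B, ‖mollify n v x - v x‖ₑ :=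
        setLIntegral_congr_fun measurableSet_closedBall fun x hx => by simp only [huv n x hx]
    _ ≤ ∫⁻ x in B, (‖mollify n (fun x => v x - g x) x‖ₑ + (ENNReal.ofReal κ + ‖v x - g x‖ₑ)) := by
        refine lintegral_mono fun x => ?_
        have e : mollify n v x - v x = mollify n (fun x => v x - g x) x +
            ((mollify n g x - g x) - (v x - g x)) := by
          rw [mollify_sub n hv.locallyIntegrable hgi.locallyIntegrable]
          abel
        rw [e]
        refine (enorm_add_le _ _).trans (add_le_add le_rfl (enorm_sub_le.trans ?_))
        exact add_le_add (hgn x) le_rfl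
    _ = (∫⁻ x in B, ‖mollify n (fun x => v x - g x) x‖ₑ) + (ENNReal.ofReal κ * volume B +
        ∫⁻ x in B, ‖v x - g x‖ₑ) := by
        rw [lintegral_add_left hmm.enorm.measurable, lintegral_add_left measurable_const,
          setLIntegral_const]
    _ ≤ δ + (ε / 2 + δ) := by
        refine add_le_add ?_ (add_le_add hκε ((setLIntegral_le_lintegral _ _).trans hvg))
        exact (setLIntegral_le_lintegral _ _).trans
          ((lintegral_enorm_mollify_le n hmvg).trans hvg)
    _ = ε / 2 + (δ + δ) := by ring
    _ ≤ ε / 2 + ε / 2 := by gcongr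
    _ = ε := ENNReal.add_halves _

/-- Mollification commutes with taking weak gradients. -/
theorem fderiv_mollify {f : Sp N → ℝ} {G : Sp N → Sp N} (h : HasWeakGradient f G) (n : ℕ)
    (x : Sp N) : fderiv ℝ (mollify n f) x = innerSL ℝ (mollify n G x) := by
  have hm1 : ContDiff ℝ 1 (mollifier N n) := (contDiff_mollifier n).of_le (by simp)
  have hd := (hasCompactSupport_mollifier n).hasFDerivAt_convolution_left
    (ContinuousLinearMap.lsmul ℝ ℝ) (μ := volume) hm1 h.locallyIntegrable x
  refine (hd.fderiv).trans ?_
  ext v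
  have hint : Integrable fun t => ((ContinuousLinearMap.lsmul ℝ ℝ).precompL (Sp N))
      (fderiv ℝ (mollifier N n) t) (f (x - t)) :=
    (HasCompactSupport.convolutionExists_left _
      ((hasCompactSupport_mollifier n).fderiv ℝ) (hm1.continuous_fderiv one_ne_zero)
      h.locallyIntegrable x)
  have hφ : ContDiff ℝ ∞ fun y => mollifier N n (x - y) :=
    (contDiff_mollifier n).comp (contDiff_const.sub contDiff_id)
  have hφs : HasCompactSupport fun y => mollifier N n (x - y) :=
    (hasCompactSupport_mollifier n).comp_homeomorph (Homeomorph.subLeft x)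
  -- The weak gradient is tested against the reflected and translated mollifier; the sign of
  -- integration by parts cancels the sign of the reflection.
  have hw := h.integral_eq _ hφ hφs v
  have hdφ : ∀ y, fderiv ℝ (fun y => mollifier N n (x - y)) y v =
      -fderiv ℝ (mollifier N n) (x - y) v := by
    intro y
    have h1 : HasFDerivAt (fun y : Sp N => x - y) (-ContinuousLinearMap.id ℝ (Sp N)) y :=
      (hasFDerivAt_id y).const_sub x
    have h2 := ((hm1.differentiable one_ne_zero (x - y)).hasFDerivAt.comp y h1).fderiv
    rw [Function.comp_def] at h2
    rw [h2]
    simp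
  rw [convolution_def, ContinuousLinearMap.integral_apply hint]
  calc ∫ t, (((ContinuousLinearMap.lsmul ℝ ℝ).precompL (Sp N))
        (fderiv ℝ (mollifier N n) t) (f (x - t))) v
      = ∫ t, fderiv ℝ (mollifier N n) t v * f (x - t) := by
        refine integral_congr_ae (Eventually.of_forall fun t => ?_)
        simp [ContinuousLinearMap.precompL_apply]
    _ = ∫ y, fderiv ℝ (mollifier N n) (x - y) v * f y := by
        rw [← integral_sub_left_eq_self (fun t => fderiv ℝ (mollifier N n) t v * f (x - t)) volume x]
        simp
    _ = ∫ y, ⟪G y, v⟫_ℝ * mollifier N n (x - y) := by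
        simp only [hdφ, mul_neg, integral_neg, neg_inj] at hw
        rw [← hw]
        simp only [mul_comm]
    _ = innerSL ℝ (mollify n G x) v := by
        rw [mollify_apply, innerSL_apply_apply,
          real_inner_comm, ← integral_inner (integrable_mollifier_smul n h.locallyIntegrable_grad x)]
        refine integral_congr_ae (Eventually.of_forall fun y => ?_)
        simp only [inner_smul_right, real_inner_comm v]
        ring

theorem ae_tendsto_mollify [CompleteSpace F] {u : Sp N → F} (hu : LocallyIntegrable u) :
    ∀ᵐ x, Tendsto (fun n => mollify n u x) atTop (𝓝 (u x)) :=
  -- The outer radius of each bump is twice the inner one, whence the ratio `2` required by Lebesgue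
  -- differentiation.
  ContDiffBump.ae_convolution_tendsto_right_of_locallyIntegrable (K := 2)
    tendsto_rOut_shrinkingBump (Eventually.of_forall fun n => by
      change 1 / ((n : ℝ) + 1) ≤ 2 * (1 / (2 * ((n : ℝ) + 1)))
      field_simp
      exact le_rfl) hu

end Mollification

/-! ### Local boundedness of the density from above. -/

section LocalBounds

variable {N : ℕ} {ρ : Sp N → ℝ} {G : Sp N → Sp N}

theorem HasWeakGradient.congr {f f' : Sp N → ℝ} {G G' : Sp N → Sp N} (h : HasWeakGradient f G)
    (hf : f =ᵐ[volume] f') (hG : G =ᵐ[volume] G') : HasWeakGradient f' G' where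
  locallyIntegrable := h.locallyIntegrable.congr hf
  locallyIntegrable_grad := h.locallyIntegrable_grad.congr hG
  integral_eq φ h1 h2 v := by
    have e1 : ∫ x, f x * fderiv ℝ φ x v = ∫ x, f' x * fderiv ℝ φ x v :=
      integral_congr_ae (hf.mono fun x hx => by simp only [hx])
    have e2 : ∫ x, ⟪G x, v⟫_ℝ * φ x = ∫ x, ⟪G' x, v⟫_ℝ * φ x :=
      integral_congr_ae (hG.mono fun x hx => by simp only [hx])
    rw [← e1, ← e2, h.integral_eq φ h1 h2 v]

theorem HypothesisH1.ae_pos (h1 : HypothesisH1 ρ G) : ∀ᵐ x : Sp N, 0 < ρ x := by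
  have h : ∀ n : ℕ, ∀ᵐ x : Sp N, x ∈ Metric.closedBall (0 : Sp N) n → 0 < ρ x := by
    intro n
    obtain ⟨δ, hδ, h⟩ := h1.locallyBoundedBelow _ (isCompact_closedBall (0 : Sp N) n)
    rw [ae_restrict_iff' Metric.isClosed_closedBall.measurableSet] at h
    filter_upwards [h] with x hx hxn using hδ.trans_le (hx hxn)
  filter_upwards [ae_all_iff.mpr h] with x hx
  obtain ⟨n, hn⟩ := exists_nat_ge ‖x‖
  exact hx n (by simpa using hn)

/-- The integrability exponent of the logarithmic gradient may be assumed to be at least two. -/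
theorem HypothesisH1.exists_exponent (h1 : HypothesisH1 ρ G) :
    ∃ r : ℝ, 2 ≤ r ∧ (N : ℝ) < r ∧ LocMemLp (fun x => (ρ x)⁻¹ • G x) (ENNReal.ofReal r) := by
  obtain ⟨r, hr, h⟩ := h1.locMemLp_logGrad
  rcases le_or_gt 2 r with h2 | h2
  · exact ⟨r, h2, hr, h⟩
  -- When `N < r < 2` the exponent `2` works too: `G` is in `L²_loc` and `ρ⁻¹` is bounded on `K`.
  · refine ⟨2, le_rfl, hr.trans h2, fun K hK => ?_⟩
    obtain ⟨δ, hδ, hδK⟩ := h1.locallyBoundedBelow K hK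
    rw [ENNReal.ofReal_ofNat]
    refine (h1.locMemLp_grad K hK).of_le_mul (c := δ⁻¹) (h K hK).aestronglyMeasurable ?_
    filter_upwards [hδK] with x hx
    rw [norm_smul, norm_inv, Real.norm_of_nonneg (hδ.le.trans hx)]
    gcongr

/-- A smooth function with bounded derivative which grows like the logarithm. -/
def softLog (s : ℝ) : ℝ := 1 / 2 * Real.log (1 + s ^ 2)

theorem hasDerivAt_softLog (s : ℝ) : HasDerivAt softLog (s / (1 + s ^ 2)) s := by
  have h1 : HasDerivAt (fun s : ℝ => 1 + s ^ 2) (2 * s) s := by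
    simpa using (hasDerivAt_pow 2 s).const_add 1
  have h2 := (h1.log (by positivity)).const_mul (1 / 2)
  convert! h2 using 1
  ring

theorem abs_div_one_add_sq_le (s : ℝ) : |s / (1 + s ^ 2)| ≤ 1 := by
  rw [abs_div, abs_of_pos (by positivity : 0 < 1 + s ^ 2), div_le_one (by positivity), abs_le]
  constructor <;> nlinarith [sq_nonneg (s - 1), sq_nonneg (s + 1)]

theorem contDiff_softLog : ContDiff ℝ 1 softLog :=
  contDiff_const.mul ((contDiff_const.add (contDiff_id.pow 2)).log fun s => by
    have : (0 : ℝ) < 1 + s ^ 2 := by positivity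
    exact this.ne')

theorem continuous_div_one_add_sq : Continuous fun s : ℝ => s / (1 + s ^ 2) :=
  continuous_id.div (by fun_prop) fun s => by positivity

theorem abs_softLog_sub_le (s t : ℝ) : |softLog s - softLog t| ≤ |s - t| := by
  have := Convex.norm_image_sub_le_of_norm_hasDerivWithin_le (s := Set.univ) (C := 1)
    (fun x _ => (hasDerivAt_softLog x).hasDerivWithinAt) (fun x _ => abs_div_one_add_sq_le x)
    convex_univ (Set.mem_univ t) (Set.mem_univ s)
  simpa using this

/-- A density satisfying the standing hypothesis is locally bounded. -/
theorem HypothesisH1.exists_ae_le (hG : HasWeakGradient ρ G) (h1 : HypothesisH1 ρ G) (R : ℝ) :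
    ∃ M : ℝ, ∀ᵐ x ∂(volume.restrict (Metric.closedBall 0 R)), ρ x ≤ M := by
  obtain ⟨r, hr2, hNr, hr⟩ := h1.exists_exponent
  have hr0 : 0 < r := by linarith
  have hρm := hG.locallyIntegrable.aestronglyMeasurable
  have hGm := hG.locallyIntegrable_grad.aestronglyMeasurable
  set ρ' := hρm.mk ρ
  set G' := hGm.mk G
  have hρρ' : ρ =ᵐ[volume] ρ' := hρm.ae_eq_mk
  have hGG' : G =ᵐ[volume] G' := hGm.ae_eq_mk
  have hρ'm : Measurable ρ' := hρm.stronglyMeasurable_mk.measurable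
  have hG'm : Measurable G' := hGm.stronglyMeasurable_mk.measurable
  have hG' : HasWeakGradient ρ' G' := hG.congr hρρ' hGG'
  set B' := Metric.closedBall (0 : Sp N) (R + 1)
  have hcpt : IsCompact B' := isCompact_closedBall _ _
  -- Only `∇ρ/ρ`, not `∇ρ`, is known to be in `L^r_loc`, so Morrey's inequality is applied to a
  -- substitute for `log ρ`. The chain rule field `F = ρ(1 + ρ²)⁻¹ ∇ρ` satisfies `|F| ≤ |∇ρ|/ρ`, and
  -- boundedness of the derivative lets `softLog` pass through mollification.
  let dψ : ℝ → ℝ := fun s => s / (1 + s ^ 2)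
  let F : Sp N → (Sp N →L[ℝ] ℝ) := fun x => dψ (ρ' x) • innerSL ℝ (G' x)
  have hFm : Measurable F :=
    (continuous_div_one_add_sq.measurable.comp hρ'm).smul
      ((innerSL ℝ (E := Sp N)).continuous.measurable.comp hG'm)
  have hc : ∀ n, ContDiff ℝ 1 (mollify n ρ') := fun n =>
    (contDiff_mollify n hG'.locallyIntegrable).of_le (by simp)
  have hfd : ∀ n x, fderiv ℝ (fun y => softLog (mollify n ρ' y)) x =
      dψ (mollify n ρ' x) • innerSL ℝ (mollify n G' x) := by
    intro n x
    rw [← fderiv_mollify hG']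
    exact ((hasDerivAt_softLog _).comp_hasFDerivAt x
      ((hc n).differentiable one_ne_zero x).hasFDerivAt).fderiv
  have hui : ∫⁻ x in B', ‖softLog (ρ' x)‖ₑ ≠ ⊤ := by
    have h2 := (hG'.locallyIntegrable.integrableOn_isCompact hcpt).2
    rw [hasFiniteIntegral_iff_enorm] at h2
    refine ne_of_lt (lt_of_le_of_lt (lintegral_mono fun x => ?_) h2)
    have h3 := abs_softLog_sub_le (ρ' x) 0
    rw [show softLog 0 = 0 by simp [softLog], sub_zero, sub_zero] at h3
    exact enorm_le_iff_norm_le.2 h3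
  have hFr : ∫⁻ x in B', ‖F x‖ₑ ^ r ≠ ⊤ := by
    have h2 := (hr B' hcpt).eLpNorm_lt_top
    rw [eLpNorm_lt_top_iff_lintegral_rpow_enorm_lt_top (by simpa using hr0) (by simp),
      ENNReal.toReal_ofReal hr0.le] at h2
    refine ne_of_lt (lt_of_le_of_lt (lintegral_mono_ae ?_) h2)
    filter_upwards [ae_restrict_of_ae h1.ae_pos, ae_restrict_of_ae hρρ', ae_restrict_of_ae hGG']
      with x hx1 hx2 hx3
    refine ENNReal.rpow_le_rpow (enorm_le_iff_norm_le.2 ?_) hr0.le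
    simp only [F, dψ]
    rw [norm_smul, innerSL_apply_norm, ← hx2, ← hx3, norm_smul]
    gcongr
    rw [Real.norm_of_nonneg (by positivity), Real.norm_of_nonneg (by positivity), div_le_iff₀
      (by positivity)]
    field_simp
    nlinarith
  have hlim : Tendsto (fun n => ∫⁻ x in B', ‖softLog (mollify n ρ' x) - softLog (ρ' x)‖ₑ)
      atTop (𝓝 0) :=
    tendsto_of_tendsto_of_tendsto_of_le_of_le tendsto_const_nhds
      (tendsto_lintegral_mollify_sub hG'.locallyIntegrable (R + 1)) (fun _ => zero_le)
      fun n => lintegral_mono fun x => enorm_le_iff_norm_le.2 (abs_softLog_sub_le _ _)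
  -- Dominated convergence: the mollifications of `ρ'` converge almost everywhere and the factor in
  -- front of `G'` is at most `2`.
  have hlim2 : Tendsto (fun n => ∫⁻ x in B', ‖dψ (mollify n ρ' x) - dψ (ρ' x)‖ₑ * ‖G' x‖ₑ)
      atTop (𝓝 0) := by
    have h2 := tendsto_lintegral_of_dominated_convergence' (μ := volume.restrict B')
      (F := fun n x => ‖dψ (mollify n ρ' x) - dψ (ρ' x)‖ₑ * ‖G' x‖ₑ) (f := fun _ => 0)
      (fun x => 2 * ‖G' x‖ₑ) (fun n => ?_) (fun n => ?_) ?_ ?_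
    · simpa using h2
    · exact (((continuous_div_one_add_sq.comp (hc n).continuous).measurable.sub
        (continuous_div_one_add_sq.measurable.comp hρ'm)).enorm.mul hG'm.enorm).aemeasurable
    · refine Eventually.of_forall fun x => mul_le_mul_left ?_ _
      refine enorm_sub_le.trans ?_
      rw [← one_add_one_eq_two]
      refine add_le_add ?_ ?_ <;>
      · rw [← ofReal_norm, ← ENNReal.ofReal_one]
        exact ENNReal.ofReal_le_ofReal (abs_div_one_add_sq_le _)
    · have h2 := (hG'.locallyIntegrable_grad.integrableOn_isCompact hcpt).2
      rw [hasFiniteIntegral_iff_enorm] at h2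
      rw [lintegral_const_mul _ hG'm.enorm]
      exact ENNReal.mul_ne_top (by simp) h2.ne
    · filter_upwards [ae_restrict_of_ae (ae_tendsto_mollify hG'.locallyIntegrable)] with x hx
      have h2 : Tendsto (fun n => dψ (mollify n ρ' x) - dψ (ρ' x)) atTop (𝓝 0) := by
        have := ((continuous_div_one_add_sq.tendsto (ρ' x)).comp hx).sub_const (dψ (ρ' x))
        simpa [dψ] using this
      have h3 := ENNReal.Tendsto.mul_const (b := ‖G' x‖ₑ) h2.enorm (Or.inr enorm_ne_top)
      simpa using h3
  have hlimF : Tendsto (fun n => ∫⁻ x in B',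
      ‖fderiv ℝ (fun y => softLog (mollify n ρ' y)) x - F x‖ₑ) atTop (𝓝 0) := by
    have h2 := (tendsto_lintegral_mollify_sub hG'.locallyIntegrable_grad (R + 1)).add hlim2
    rw [add_zero] at h2
    refine tendsto_of_tendsto_of_tendsto_of_le_of_le tendsto_const_nhds h2 (fun _ => zero_le)
      fun n => ?_
    have hm : Measurable fun x => ‖mollify n G' x - G' x‖ₑ :=
      ((contDiff_mollify n hG'.locallyIntegrable_grad).continuous.measurable.sub hG'm).enorm
    simp only
    rw [← lintegral_add_left hm]
    refine lintegral_mono fun x => ?_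
    rw [hfd]
    have e : dψ (mollify n ρ' x) • innerSL ℝ (mollify n G' x) - F x =
        dψ (mollify n ρ' x) • innerSL ℝ (mollify n G' x - G' x) +
          (dψ (mollify n ρ' x) - dψ (ρ' x)) • innerSL ℝ (G' x) := by
      simp only [F, map_sub, smul_sub, sub_smul]
      abel
    rw [e]
    have h3 := enorm_add_le (dψ (mollify n ρ' x) • innerSL ℝ (mollify n G' x - G' x))
      ((dψ (mollify n ρ' x) - dψ (ρ' x)) • innerSL ℝ (G' x))
    refine h3.trans (add_le_add ?_ ?_)
    · rw [enorm_le_iff_norm_le, norm_smul, innerSL_apply_norm]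
      exact mul_le_of_le_one_left (norm_nonneg _) (abs_div_one_add_sq_le _)
    · rw [enorm_smul]
      gcongr
      rw [enorm_le_iff_norm_le, innerSL_apply_norm]
  obtain ⟨C, hC, hCx⟩ := exists_ae_enorm_le_of_tendsto (by linarith) hNr
    (φ := fun n x => softLog (mollify n ρ' x)) (fun n => contDiff_softLog.comp (hc n))
    (contDiff_softLog.continuous.measurable.comp hρ'm) hFm hui hFr hlim hlimF
  refine ⟨Real.exp C.toReal, ?_⟩
  filter_upwards [hCx, ae_restrict_of_ae hρρ', ae_restrict_of_ae h1.ae_pos] with x hx1 hx2 hx3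
  rw [Function.comp_apply, ← hx2] at hx1
  have h4 : softLog (ρ x) ≤ C.toReal := by
    have := ENNReal.toReal_mono hC hx1
    rw [toReal_enorm] at this
    exact (le_abs_self _).trans this
  -- From `ρ² ≤ 1 + ρ²`; the bound on `softLog ρ` therefore exponentiates to a bound on `ρ`.
  have h5 : Real.log (ρ x) ≤ softLog (ρ x) := by
    have h6 := Real.log_le_log (by positivity) (by linarith : ρ x ^ 2 ≤ 1 + ρ x ^ 2)
    rw [Real.log_pow] at h6
    simp only [softLog]
    push_cast at h6
    linarith
  calc ρ x = Real.exp (Real.log (ρ x)) := (Real.exp_log hx3).symm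
    _ ≤ _ := Real.exp_le_exp.2 (h5.trans h4)

end LocalBounds

/-! ### Calculus of test functions and integration by parts. -/

section TestFunctions

variable {N : ℕ}

/-- Real-valued test functions. -/
structure IsTest (φ : Sp N → ℝ) : Prop where
  contDiff : ContDiff ℝ ∞ φ
  hasCompactSupport : HasCompactSupport φ

/-- The partial derivatives. -/
def pd (i : Fin N) (φ : Sp N → ℝ) (x : Sp N) : ℝ := fderiv ℝ φ x (EuclideanSpace.single i 1)

theorem contDiff_pd {φ : Sp N → ℝ} (hφ : ContDiff ℝ ∞ φ) (i : Fin N) : ContDiff ℝ ∞ (pd i φ) :=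
  (hφ.fderiv_right (m := ∞) (by simp)).clm_apply contDiff_const

namespace IsTest

variable {φ ψ : Sp N → ℝ}

theorem continuous (h : IsTest φ) : Continuous φ := h.contDiff.continuous

theorem differentiable (h : IsTest φ) : Differentiable ℝ φ := h.contDiff.differentiable (by simp)

theorem pd (h : IsTest φ) (i : Fin N) : IsTest (pd i φ) :=
  ⟨contDiff_pd h.contDiff i, h.hasCompactSupport.fderiv_apply (𝕜 := ℝ) _⟩

theorem mul_left (h : IsTest φ) (hψ : ContDiff ℝ ∞ ψ) : IsTest fun x => ψ x * φ x :=
  ⟨hψ.mul h.contDiff, h.hasCompactSupport.mul_left⟩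

theorem add (h : IsTest φ) (hψ : IsTest ψ) : IsTest fun x => φ x + ψ x :=
  ⟨h.contDiff.add hψ.contDiff, h.hasCompactSupport.add hψ.hasCompactSupport⟩

theorem const_mul (h : IsTest φ) (c : ℝ) : IsTest fun x => c * φ x := h.mul_left contDiff_const

theorem integrable (h : IsTest φ) : Integrable φ :=
  h.continuous.integrable_of_hasCompactSupport h.hasCompactSupport

theorem memLp (h : IsTest φ) (p : ℝ≥0∞) : MemLp φ p :=
  h.continuous.memLp_of_hasCompactSupport h.hasCompactSupport

end IsTest

theorem pd_mul {φ ψ : Sp N → ℝ} (hφ : Differentiable ℝ φ) (hψ : Differentiable ℝ ψ)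
    (i : Fin N) (x : Sp N) :
    pd i (fun y => φ y * ψ y) x = φ x * pd i ψ x + pd i φ x * ψ x := by
  simp only [pd]
  rw [fderiv_fun_mul (hφ x) (hψ x)]
  simp
  ring

theorem pd_add {φ ψ : Sp N → ℝ} (hφ : Differentiable ℝ φ) (hψ : Differentiable ℝ ψ)
    (i : Fin N) (x : Sp N) : pd i (fun y => φ y + ψ y) x = pd i φ x + pd i ψ x := by
  simp only [pd]
  rw [fderiv_fun_add (hφ x) (hψ x)]
  simp

theorem pd_const_mul {φ : Sp N → ℝ} (hφ : Differentiable ℝ φ) (c : ℝ)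
    (i : Fin N) (x : Sp N) : pd i (fun y => c * φ y) x = c * pd i φ x := by
  simp only [pd]
  rw [fderiv_const_mul (hφ x)]
  simp

theorem pd_comm {φ : Sp N → ℝ} (hφ : ContDiff ℝ ∞ φ) (i j : Fin N) (x : Sp N) :
    pd i (pd j φ) x = pd j (pd i φ) x := by
  have hd : Differentiable ℝ (fderiv ℝ φ) :=
    (hφ.fderiv_right (m := ∞) (by simp)).differentiable (by simp)
  have h : ∀ i j, pd i (pd j φ) x =
      fderiv ℝ (fderiv ℝ φ) x (EuclideanSpace.single i 1) (EuclideanSpace.single j 1) := by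
    intro i j
    change fderiv ℝ (fun y => fderiv ℝ φ y (EuclideanSpace.single j 1)) x _ = _
    rw [fderiv_clm_apply (hd x) (differentiableAt_const _)]
    simp
  rw [h, h]
  exact second_derivative_symmetric (fun y => (hφ.differentiable (by simp) y).hasFDerivAt)
    (hd x).hasFDerivAt _ _

theorem sum_smul_single (v : Sp N) : ∑ i, v i • EuclideanSpace.single i (1 : ℝ) = v := by
  have := (EuclideanSpace.basisFun (Fin N) ℝ).sum_repr v
  simpa using this

theorem fderiv_apply_eq_sum (φ : Sp N → ℝ) (x v : Sp N) :
    fderiv ℝ φ x v = ∑ i, v i * pd i φ x := by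
  conv_lhs => rw [← sum_smul_single v]
  simp [pd]

theorem norm_fderiv_sq (φ : Sp N → ℝ) (x : Sp N) :
    ‖fderiv ℝ φ x‖ ^ 2 = ∑ i, pd i φ x ^ 2 := by
  have h1 := (InnerProductSpace.toDual ℝ (Sp N)).symm.norm_map (fderiv ℝ φ x)
  rw [← h1, EuclideanSpace.norm_sq_eq]
  refine Finset.sum_congr rfl fun i _ => ?_
  rw [Real.norm_eq_abs, sq_abs]
  congr 1
  have h2 := InnerProductSpace.toDual_symm_apply (𝕜 := ℝ) (x := EuclideanSpace.single i (1 : ℝ))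
    (y := fderiv ℝ φ x)
  rw [EuclideanSpace.inner_single_right] at h2
  simpa [pd] using h2

theorem laplacian_eq_sum_pd {φ : Sp N → ℝ} (hφ : ContDiff ℝ ∞ φ) (x : Sp N) :
    Laplacian.laplacian φ x = ∑ i, pd i (pd i φ) x := by
  rw [InnerProductSpace.laplacian_eq_iteratedFDeriv_orthonormalBasis φ
    (EuclideanSpace.basisFun (Fin N) ℝ)]
  have hd : Differentiable ℝ (fderiv ℝ φ) :=
    (hφ.fderiv_right (m := ∞) (by simp)).differentiable (by simp)
  refine Finset.sum_congr rfl fun i _ => ?_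
  rw [iteratedFDeriv_two_apply]
  change _ = fderiv ℝ (fun y => fderiv ℝ φ y (EuclideanSpace.single i 1)) x _
  rw [fderiv_clm_apply (hd x) (differentiableAt_const _)]
  simp

/-- The Laplacian as a sum of second partial derivatives. -/
def lap (φ : Sp N → ℝ) (x : Sp N) : ℝ := ∑ i, pd i (pd i φ) x

theorem IsTest.lap {φ : Sp N → ℝ} (h : IsTest φ) : IsTest (lap φ) where
  contDiff := ContDiff.sum fun i _ => ((h.pd i).pd i).contDiff
  hasCompactSupport := by
    refine HasCompactSupport.intro h.hasCompactSupport.isCompact fun x hx => ?_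
    refine Finset.sum_eq_zero fun i _ => ?_
    have : x ∉ tsupport (BiKolmogorov.pd i (BiKolmogorov.pd i φ)) := fun h2 =>
      hx ((tsupport_fderiv_apply_subset ℝ _) ((tsupport_fderiv_apply_subset ℝ _) h2))
    exact image_eq_zero_of_notMem_tsupport this

theorem integral_mul_pd {φ ψ : Sp N → ℝ} (hφ : IsTest φ) (hψ : ContDiff ℝ ∞ ψ) (i : Fin N) :
    ∫ x, ψ x * pd i φ x = - ∫ x, pd i ψ x * φ x :=
  integral_mul_fderiv_eq_neg_fderiv_mul_of_integrable (μ := volume)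
    (hφ.mul_left (contDiff_pd hψ i)).integrable ((hφ.pd i).mul_left hψ).integrable
    (hφ.mul_left hψ).integrable (fun x _ => hψ.differentiable (by simp) x)
    (fun x _ => hφ.differentiable x)

/-- Integration by parts against a weakly differentiable weight. -/
theorem HasWeakGradient.integral_mul_lap_add {w : Sp N → ℝ} {H : Sp N → Sp N}
    (hw : HasWeakGradient w H) {φ ψ : Sp N → ℝ} (hφ : IsTest φ) (hψ : ContDiff ℝ ∞ ψ) :
    ∫ x, (w x * ψ x * lap φ x + ψ x * fderiv ℝ φ x (H x)) =
      - ∫ x, w x * ∑ i, pd i ψ x * pd i φ x := by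
  have ht : ∀ i, IsTest fun x => ψ x * pd i φ x := fun i => (hφ.pd i).mul_left hψ
  have hwi : ∀ {θ : Sp N → ℝ}, IsTest θ → Integrable fun x => w x * θ x := by
    intro θ hθ
    refine (hw.locallyIntegrable.integrable_smul_left_of_hasCompactSupport
      hθ.continuous hθ.hasCompactSupport).congr (Eventually.of_forall fun x => ?_)
    simp only [smul_eq_mul]
    ring
  have hHi : ∀ (i : Fin N) {θ : Sp N → ℝ}, IsTest θ → Integrable fun x => H x i * θ x := by
    intro i θ hθ
    have h := hw.locallyIntegrable_grad.integrable_smul_left_of_hasCompactSupport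
      hθ.continuous hθ.hasCompactSupport
    refine ((EuclideanSpace.proj (𝕜 := ℝ) i).integrable_comp h).congr
      (Eventually.of_forall fun x => ?_)
    simp
    ring
  have i1 : ∀ i, Integrable fun x => w x * (ψ x * pd i (pd i φ) x) :=
    fun i => hwi (((hφ.pd i).pd i).mul_left hψ)
  have i2 : ∀ i, Integrable fun x => w x * (pd i ψ x * pd i φ x) :=
    fun i => hwi ((hφ.pd i).mul_left (contDiff_pd hψ i))
  have i3 : ∀ i, Integrable fun x => H x i * (ψ x * pd i φ x) := fun i => hHi i (ht i)
  have hi : ∀ i, (∫ x, w x * (ψ x * pd i (pd i φ) x)) + ∫ x, H x i * (ψ x * pd i φ x) =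
      - ∫ x, w x * (pd i ψ x * pd i φ x) := by
    intro i
    have h := hw.integral_eq _ (ht i).contDiff (ht i).hasCompactSupport (EuclideanSpace.single i 1)
    have e1 : ∫ x, ⟪H x, EuclideanSpace.single i (1 : ℝ)⟫_ℝ * (ψ x * pd i φ x) =
        ∫ x, H x i * (ψ x * pd i φ x) :=
      integral_congr_ae (Eventually.of_forall fun x => by
        simp [EuclideanSpace.inner_single_right])
    have e2 : ∫ x, w x * fderiv ℝ (fun x => ψ x * pd i φ x) x (EuclideanSpace.single i 1) =
        (∫ x, w x * (ψ x * pd i (pd i φ) x)) + ∫ x, w x * (pd i ψ x * pd i φ x) := by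
      rw [← integral_add (i1 i) (i2 i)]
      refine integral_congr_ae (Eventually.of_forall fun x => ?_)
      have := pd_mul (hψ.differentiable (by simp)) (hφ.pd i).differentiable i x
      simp only [← mul_add, ← this]
      rfl
    rw [e1, e2] at h
    linarith
  calc ∫ x, (w x * ψ x * lap φ x + ψ x * fderiv ℝ φ x (H x))
      = ∫ x, ∑ i, (w x * (ψ x * pd i (pd i φ) x) + H x i * (ψ x * pd i φ x)) := by
        refine integral_congr_ae (Eventually.of_forall fun x => ?_)
        simp only [lap, fderiv_apply_eq_sum φ x (H x), Finset.mul_sum, ← Finset.sum_add_distrib]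
        exact Finset.sum_congr rfl fun i _ => by ring
    _ = ∑ i, ((∫ x, w x * (ψ x * pd i (pd i φ) x)) + ∫ x, H x i * (ψ x * pd i φ x)) := by
        have i4 : ∀ i, Integrable fun x => w x * (ψ x * pd i (pd i φ) x) +
            H x i * (ψ x * pd i φ x) := fun i => (i1 i).add (i3 i)
        rw [integral_finsetSum _ fun i _ => i4 i]
        exact Finset.sum_congr rfl fun i _ => integral_add (i1 i) (i3 i)
    _ = - ∫ x, w x * ∑ i, pd i ψ x * pd i φ x := by
        simp only [hi, Finset.mul_sum]
        rw [integral_finsetSum _ fun i _ => i2 i, Finset.sum_neg_distrib]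

/-- Two integrations by parts turn `∫ ∂_i²φ ∂_j²φ` into `∫ (∂_j∂_i φ)²`. -/
theorem integral_lap_sq {φ : Sp N → ℝ} (hφ : IsTest φ) :
    ∫ x, lap φ x ^ 2 = ∑ i, ∑ j, ∫ x, pd j (pd i φ) x ^ 2 := by
  have ht : ∀ i j, IsTest fun x => pd i (pd i φ) x * pd j (pd j φ) x := fun i j =>
    ((hφ.pd j).pd j).mul_left (contDiff_pd (contDiff_pd hφ.contDiff i) i)
  calc ∫ x, lap φ x ^ 2 = ∫ x, ∑ i, ∑ j, pd i (pd i φ) x * pd j (pd j φ) x := by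
        refine integral_congr_ae (Eventually.of_forall fun x => ?_)
        simp only [lap, sq, Finset.sum_mul_sum]
    _ = ∑ i, ∑ j, ∫ x, pd i (pd i φ) x * pd j (pd j φ) x := by
        rw [integral_finsetSum _ fun i _ => integrable_finsetSum _ fun j _ => (ht i j).integrable]
        exact Finset.sum_congr rfl fun i _ =>
          integral_finsetSum _ fun j _ => (ht i j).integrable
    _ = _ := by
        refine Finset.sum_congr rfl fun i _ => Finset.sum_congr rfl fun j _ => ?_
        rw [integral_mul_pd (hφ.pd j) ((hφ.pd i).pd i).contDiff]
        have h2 := integral_mul_pd (hφ.pd i) (ψ := pd j (pd j φ))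
          ((hφ.pd j).pd j).contDiff i
        have e1 : ∀ x, pd j (pd i (pd i φ)) x = pd i (pd j (pd i φ)) x := fun x =>
          pd_comm (hφ.pd i).contDiff j i x
        simp only [e1]
        have h3 := integral_mul_pd ((hφ.pd i).pd j) (ψ := pd j φ) (hφ.pd j).contDiff i
        have e2 : ∫ x, pd i (pd j (pd i φ)) x * pd j φ x =
            ∫ x, pd j φ x * pd i (pd j (pd i φ)) x :=
          integral_congr_ae (Eventually.of_forall fun x => mul_comm _ _)
        rw [e2, h3, neg_neg]
        refine integral_congr_ae (Eventually.of_forall fun x => ?_)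
        simp only [pd_comm hφ.contDiff i j x]
        ring

theorem integral_mul_lap {φ ψ : Sp N → ℝ} (hφ : IsTest φ) (hψ : ContDiff ℝ ∞ ψ) :
    ∫ x, ψ x * lap φ x = - ∑ i, ∫ x, pd i ψ x * pd i φ x := by
  simp only [lap, Finset.mul_sum]
  rw [integral_finsetSum _ fun i _ => (((hφ.pd i).pd i).mul_left hψ).integrable,
    ← Finset.sum_neg_distrib]
  exact Finset.sum_congr rfl fun i _ => integral_mul_pd (hφ.pd i) hψ i

/-- The cross term `-2c ∫ φ Δφ` equals `2c ∫ |∇φ|²`. For `c > 0` derivatives of all three orders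
appear with positive coefficients, which is what absorbs a first-order perturbation. -/
theorem integral_sub_lap_sq {φ : Sp N → ℝ} (hφ : IsTest φ) (c : ℝ) :
    ∫ x, (c * φ x - lap φ x) ^ 2 = c ^ 2 * (∫ x, φ x ^ 2) + 2 * c * (∑ i, ∫ x, pd i φ x ^ 2) +
      ∑ i, ∑ j, ∫ x, pd j (pd i φ) x ^ 2 := by
  have h1 := integral_mul_lap hφ hφ.contDiff
  have i1 : Integrable fun x => c ^ 2 * φ x ^ 2 := by
    simpa only [sq] using ((hφ.mul_left hφ.contDiff).const_mul (c * c)).integrable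
  have i2 : Integrable fun x => 2 * c * (φ x * lap φ x) :=
    ((hφ.lap.mul_left hφ.contDiff).const_mul (2 * c)).integrable
  have i3 : Integrable fun x => lap φ x ^ 2 := by
    simpa only [sq] using (hφ.lap.mul_left hφ.lap.contDiff).integrable
  have e : ∀ x, (c * φ x - lap φ x) ^ 2 = c ^ 2 * φ x ^ 2 - 2 * c * (φ x * lap φ x) +
    lap φ x ^ 2 := fun x => by ring
  have i4 : Integrable fun x => c ^ 2 * φ x ^ 2 - 2 * c * (φ x * lap φ x) := i1.sub i2
  simp only [e]
  rw [integral_add i4 i3, integral_sub i1 i2, integral_const_mul, integral_const_mul, h1,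
    integral_lap_sq hφ]
  simp only [← sq]
  ring

end TestFunctions

/-! ### Uniqueness for `c - Δ` in `L²`, by smearing with test kernels. -/

section Helmholtz

open scoped Convolution

variable {N : ℕ}

/-- Convolution of a kernel with a function. -/
def smear (k u : Sp N → ℝ) : Sp N → ℝ := k ⋆[ContinuousLinearMap.lsmul ℝ ℝ, volume] u

theorem smear_apply (k u : Sp N → ℝ) (x : Sp N) : smear k u x = ∫ y, k (x - y) * u y := by
  rw [smear, convolution_lsmul_swap]
  rfl

theorem IsTest.contDiff_smear {k u : Sp N → ℝ} (hk : IsTest k) (hu : LocallyIntegrable u) :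
    ContDiff ℝ ∞ (smear k u) :=
  hk.hasCompactSupport.contDiff_convolution_left _ hk.contDiff hu

theorem IsTest.pd_smear {k u : Sp N → ℝ} (hk : IsTest k) (hu : LocallyIntegrable u) (i : Fin N) :
    BiKolmogorov.pd i (smear k u) = smear (BiKolmogorov.pd i k) u := by
  funext x
  have hk1 : ContDiff ℝ 1 k := hk.contDiff.of_le (by simp)
  have hd := hk.hasCompactSupport.hasFDerivAt_convolution_left
    (ContinuousLinearMap.lsmul ℝ ℝ) (μ := volume) hk1 hu x
  have hint : Integrable fun t => ((ContinuousLinearMap.lsmul ℝ ℝ).precompL (Sp N))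
      (fderiv ℝ k t) (u (x - t)) :=
    (HasCompactSupport.convolutionExists_left _
      (hk.hasCompactSupport.fderiv ℝ) (hk1.continuous_fderiv one_ne_zero) hu x)
  change fderiv ℝ (smear k u) x _ = _
  rw [show fderiv ℝ (smear k u) x = _ from hd.fderiv, convolution_def,
    ContinuousLinearMap.integral_apply hint, smear, convolution_def]
  rfl

/-- Young's inequality: Cauchy–Schwarz with `|k| = |k|^{1/2} |k|^{1/2}`, then Tonelli. -/
theorem lintegral_enorm_smear_sq_le {k u : Sp N → ℝ} (hk : IsTest k)
    (hu : AEStronglyMeasurable u) :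
    ∫⁻ x, ‖smear k u x‖ₑ ^ 2 ≤ (∫⁻ x, ‖k x‖ₑ) ^ 2 * ∫⁻ x, ‖u x‖ₑ ^ 2 := by
  have hkm : Measurable fun x => ‖k x‖ₑ := hk.continuous.enorm.measurable
  have hm : AEMeasurable (Function.uncurry fun (x t : Sp N) => ‖k t‖ₑ * ‖u (x - t)‖ₑ ^ 2)
      (volume.prod volume) :=
    (hkm.comp measurable_snd).aemeasurable.mul
      ((hu.enorm.comp_quasiMeasurePreserving
        (quasiMeasurePreserving_sub_of_right_invariant volume volume)).pow_const 2)
  set I := ∫⁻ x, ‖k x‖ₑ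
  have hI : I ≠ ⊤ := by
    have := hk.integrable.2
    rw [hasFiniteIntegral_iff_enorm] at this
    exact this.ne
  calc ∫⁻ x, ‖smear k u x‖ₑ ^ 2 ≤ ∫⁻ x, I * ∫⁻ t, ‖k t‖ₑ * ‖u (x - t)‖ₑ ^ 2 := by
        refine lintegral_mono fun x => ?_
        have hum : AEMeasurable fun t => ‖u (x - t)‖ₑ :=
          hu.enorm.comp_quasiMeasurePreserving
            (quasiMeasurePreserving_sub_left_of_right_invariant volume x)
        have h1 : ‖smear k u x‖ₑ ≤ ∫⁻ t, ‖k t‖ₑ * ‖u (x - t)‖ₑ := by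
          rw [smear, convolution_lsmul]
          refine (enorm_integral_le_lintegral_enorm _).trans (le_of_eq ?_)
          simp only [enorm_smul]
        have h2 := sq_lintegral_mul_le (μ := volume) (f := fun t => ‖k t‖ₑ ^ (1 / 2 : ℝ))
          (g := fun t => ‖k t‖ₑ ^ (1 / 2 : ℝ) * ‖u (x - t)‖ₑ) (hkm.pow_const _).aemeasurable
          ((hkm.pow_const _).aemeasurable.mul hum)
        have e : ∀ t, ‖k t‖ₑ ^ (1 / 2 : ℝ) * ‖k t‖ₑ ^ (1 / 2 : ℝ) = ‖k t‖ₑ := fun t => by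
          rw [← ENNReal.rpow_add_of_nonneg _ _ (by norm_num) (by norm_num)]
          norm_num
        simp only [mul_pow, ← mul_assoc, e] at h2
        simp only [sq, e] at h2
        refine (pow_le_pow_left' h1 2).trans ?_
        simpa only [sq] using! h2
    _ = I * ∫⁻ t, ∫⁻ x, ‖k t‖ₑ * ‖u (x - t)‖ₑ ^ 2 := by
        rw [lintegral_const_mul' _ _ hI, lintegral_lintegral_swap hm]
    _ = I * ∫⁻ t, ‖k t‖ₑ * ∫⁻ x, ‖u x‖ₑ ^ 2 := by
        congr 1
        refine lintegral_congr fun t => ?_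
        rw [lintegral_const_mul' _ _ enorm_ne_top,
          lintegral_sub_right_eq_self (fun x => ‖u x‖ₑ ^ 2) t]
    _ = _ := by
        rw [lintegral_mul_const _ hkm, ← mul_assoc, sq]

theorem memLp_two_iff_lintegral {α : Type*} [MeasurableSpace α] {μ : Measure α} {F : Type*}
    [NormedAddCommGroup F] {f : α → F} (hf : AEStronglyMeasurable f μ) :
    MemLp f 2 μ ↔ ∫⁻ x, ‖f x‖ₑ ^ 2 ∂μ < ⊤ := by
  have h := eLpNorm_lt_top_iff_lintegral_rpow_enorm_lt_top (f := f) (μ := μ) (p := 2) (by simp)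
    (by simp)
  simp only [ENNReal.toReal_ofNat, ENNReal.rpow_ofNat] at h
  rw [← h]
  exact ⟨fun h => h.2, fun h => ⟨hf, h⟩⟩

theorem IsTest.memLp_smear {k u : Sp N → ℝ} (hk : IsTest k) (hu : MemLp u 2) :
    MemLp (smear k u) 2 := by
  have hl : LocallyIntegrable u := hu.locallyIntegrable (by norm_num)
  rw [memLp_two_iff_lintegral (hk.contDiff_smear hl).continuous.aestronglyMeasurable]
  refine (lintegral_enorm_smear_sq_le hk hu.1).trans_lt (ENNReal.mul_lt_top ?_ ?_)
  · have := hk.integrable.2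
    rw [hasFiniteIntegral_iff_enorm] at this
    exact ENNReal.pow_lt_top this
  · exact (memLp_two_iff_lintegral hu.1).1 hu

theorem pd_comp_sub_left {k : Sp N → ℝ} (hk : Differentiable ℝ k) (x : Sp N) (i : Fin N) :
    pd i (fun y => k (x - y)) = fun y => - pd i k (x - y) := by
  funext y
  have h1 : HasFDerivAt (fun y : Sp N => x - y) (-ContinuousLinearMap.id ℝ (Sp N)) y :=
    (hasFDerivAt_id y).const_sub x
  have h2 := ((hk (x - y)).hasFDerivAt.comp y h1).fderiv
  simp only [pd]
  rw [show (fun y => k (x - y)) = k ∘ fun y => x - y from rfl, h2]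
  simp

theorem lap_comp_sub_left {k : Sp N → ℝ} (hk : ContDiff ℝ ∞ k) (x y : Sp N) :
    lap (fun y => k (x - y)) y = lap k (x - y) := by
  simp only [lap]
  refine Finset.sum_congr rfl fun i _ => ?_
  rw [pd_comp_sub_left (hk.differentiable (by simp))]
  have h1 := pd_comp_sub_left (k := fun z => - pd i k z)
    ((contDiff_pd hk i).differentiable (by simp)).neg x i
  have h2 : pd i (fun z => - pd i k z) = fun z => - pd i (pd i k) z := by
    funext z
    have := pd_const_mul ((contDiff_pd hk i).differentiable (by simp)) (-1) i z
    simpa using this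
  rw [h1, h2]
  simp

/-- The operator `c - Δ` has no nontrivial solutions in `L²` when `c > 0`. -/
theorem ae_eq_zero_of_integral_sub_lap {c : ℝ} (hc : 0 < c) {u : Sp N → ℝ} (hu : MemLp u 2)
    (h : ∀ φ, IsTest φ → ∫ x, u x * (c * φ x - lap φ x) = 0) : u =ᵐ[volume] 0 := by
  have hl : LocallyIntegrable u := hu.locallyIntegrable (by norm_num)
  have key : ∀ k, IsTest k → ∀ x, smear k u x = 0 := by
    intro k hk
    have hs := hk.contDiff_smear hl
    have hint : ∀ k, IsTest k → ∀ x, Integrable fun y => k (x - y) * u y := fun k hk x =>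
      (hk.hasCompactSupport.convolutionExists_left
        (ContinuousLinearMap.lsmul ℝ ℝ) hk.continuous hl x).integrable_swap
    have hp2 : ∀ i, pd i (pd i (smear k u)) = smear (pd i (pd i k)) u := fun i => by
      rw [hk.pd_smear hl, (hk.pd i).pd_smear hl]
    -- Testing with `k(x - ·)` shows that the smooth function `k * u` solves the equation
    -- classically.
    have hlap : ∀ x, c * smear k u x = ∑ i, smear (pd i (pd i k)) u x := by
      intro x
      have h1 := h (fun y => k (x - y)) ⟨hk.contDiff.comp (contDiff_const.sub contDiff_id),
        hk.hasCompactSupport.comp_homeomorph (Homeomorph.subLeft x)⟩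
      simp only [lap_comp_sub_left hk.contDiff] at h1
      simp only [lap, mul_sub, Finset.mul_sum] at h1
      have i1 : Integrable fun y => u y * (c * k (x - y)) :=
        ((hint k hk x).const_mul c).congr (Eventually.of_forall fun y => by ring)
      have i2 : ∀ i, Integrable fun y => u y * pd i (pd i k) (x - y) := fun i =>
        (hint _ ((hk.pd i).pd i) x).congr (Eventually.of_forall fun y => by ring)
      rw [integral_sub i1 (integrable_finsetSum _ fun i _ => i2 i),
        integral_finsetSum _ fun i _ => i2 i, sub_eq_zero] at h1
      simp only [smear_apply]
      rw [← integral_const_mul]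
      calc ∫ y, c * (k (x - y) * u y) = ∫ y, u y * (c * k (x - y)) :=
            integral_congr_ae (Eventually.of_forall fun y => by ring)
        _ = _ := h1
        _ = _ := Finset.sum_congr rfl fun i _ =>
            integral_congr_ae (Eventually.of_forall fun y => by ring)
    have hm := hk.memLp_smear hu
    have hm1 : ∀ i, MemLp (smear (pd i k) u) 2 := fun i => (hk.pd i).memLp_smear hu
    have hm2 : ∀ i, MemLp (smear (pd i (pd i k)) u) 2 := fun i => ((hk.pd i).pd i).memLp_smear hu
    have hparts : ∀ i, ∫ x, smear k u x * smear (pd i (pd i k)) u x =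
        - ∫ x, smear (pd i k) u x * smear (pd i k) u x := by
      intro i
      have hd1 := hk.pd_smear hl i
      have hd2 := (hk.pd i).pd_smear hl i
      have := integral_mul_fderiv_eq_neg_fderiv_mul_of_integrable (μ := volume)
        (f := smear k u) (g := smear (pd i k) u) (v := EuclideanSpace.single i 1)
        (by change Integrable fun x => pd i (smear k u) x * _
            rw [hd1]; exact (hm1 i).integrable_mul (hm1 i))
        (by change Integrable fun x => _ * pd i (smear (pd i k) u) x
            rw [hd2]; exact hm.integrable_mul (hm2 i))
        (hm.integrable_mul (hm1 i)) (fun x _ => hs.differentiable (by simp) x)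
        (fun x _ => ((hk.pd i).contDiff_smear hl).differentiable (by simp) x)
      change ∫ x, _ * pd i (smear (pd i k) u) x = - ∫ x, pd i (smear k u) x * _ at this
      rw [hd1, hd2] at this
      exact this
    -- `c ∫ (k * u)² = -∑ ∫ (∂_i k * u)²`; integration by parts needs no cutoff because all
    -- functions involved are in `L²`.
    have h0 : ∫ x, smear k u x ^ 2 ≤ 0 := by
      have e1 : c * ∫ x, smear k u x ^ 2 = ∑ i, ∫ x, smear k u x * smear (pd i (pd i k)) u x := by
        have i3 : ∀ i, Integrable fun x => smear k u x * smear (pd i (pd i k)) u x :=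
          fun i => hm.integrable_mul (hm2 i)
        rw [← integral_const_mul, ← integral_finsetSum _ fun i _ => i3 i]
        refine integral_congr_ae (Eventually.of_forall fun x => ?_)
        simp only
        rw [← Finset.mul_sum, ← hlap]
        ring
      have e2 : c * ∫ x, smear k u x ^ 2 ≤ 0 := by
        rw [e1]
        refine Finset.sum_nonpos fun i _ => ?_
        rw [hparts i, neg_nonpos]
        exact integral_nonneg fun x => mul_self_nonneg _
      by_contra hcon
      exact absurd e2 (not_le.2 (mul_pos hc (not_le.1 hcon)))
    have h1 : (fun x => smear k u x ^ 2) =ᵐ[volume] 0 := by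
      rw [← integral_eq_zero_iff_of_nonneg (fun x => sq_nonneg _) hm.integrable_sq]
      exact le_antisymm h0 (integral_nonneg fun x => sq_nonneg _)
    have h2 : smear k u = 0 := by
      refine (Continuous.ae_eq_iff_eq volume hs.continuous continuous_const).mp ?_
      filter_upwards [h1] with x hx
      exact pow_eq_zero_iff two_ne_zero |>.1 hx
    exact fun x => congrFun h2 x
  filter_upwards [ae_tendsto_mollify hl] with x hx
  have h1 : ∀ n, mollify n u x = 0 := fun n =>
    key _ ⟨contDiff_mollifier n, hasCompactSupport_mollifier n⟩ x
  simp only [h1] at hx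
  exact (tendsto_nhds_unique hx tendsto_const_nhds)

end Helmholtz

/-! ### Dense range of `c - Δ - β · ∇` by perturbation from `c - Δ`. -/

section Density

variable {N : ℕ}

theorem denseRange_of_forall_inner_eq_zero {X E : Type*} [AddCommGroup X] [Module ℝ X]
    [NormedAddCommGroup E] [InnerProductSpace ℝ E] [CompleteSpace E] (T : X →ₗ[ℝ] E)
    (h : ∀ z, (∀ x, ⟪z, T x⟫_ℝ = 0) → z = 0) : DenseRange T := by
  have h1 : (LinearMap.range T)ᗮ = ⊥ := by
    rw [eq_bot_iff]
    intro z hz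
    rw [Submodule.mem_bot]
    refine h z fun x => ?_
    rw [real_inner_comm]
    exact hz _ (LinearMap.mem_range_self T x)
  have h2 := (Submodule.topologicalClosure_eq_top_iff (K := LinearMap.range T)).2 h1
  have h3 := (Submodule.dense_iff_topologicalClosure_eq_top).2 h2
  rwa [LinearMap.coe_range] at h3

section L2Norm

variable {α : Type*} [MeasurableSpace α] {μ : Measure α}

/-- The norm of a square integrable function. -/
def l2 (μ : Measure α) (f : α → ℝ) : ℝ := √(∫ x, f x ^ 2 ∂μ)

theorem l2_nonneg (f : α → ℝ) : 0 ≤ l2 μ f := Real.sqrt_nonneg _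

theorem l2_sq (f : α → ℝ) : l2 μ f ^ 2 = ∫ x, f x ^ 2 ∂μ :=
  Real.sq_sqrt (integral_nonneg fun _ => sq_nonneg _)

theorem inner_toLp {f g : α → ℝ} (hf : MemLp f 2 μ) (hg : MemLp g 2 μ) :
    ⟪hf.toLp f, hg.toLp g⟫_ℝ = ∫ x, f x * g x ∂μ := by
  rw [L2.inner_def]
  refine integral_congr_ae ?_
  filter_upwards [hf.coeFn_toLp, hg.coeFn_toLp] with x h1 h2
  rw [h1, h2]
  simp [mul_comm]

theorem inner_toLp_right (f : Lp ℝ 2 μ) {g : α → ℝ} (hg : MemLp g 2 μ) :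
    ⟪f, hg.toLp g⟫_ℝ = ∫ x, f x * g x ∂μ := by
  rw [← inner_toLp (Lp.memLp f) hg, Lp.toLp_coeFn]

theorem norm_toLp_eq_l2 {f : α → ℝ} (hf : MemLp f 2 μ) : ‖hf.toLp f‖ = l2 μ f := by
  rw [l2, ← Real.sqrt_sq (norm_nonneg (hf.toLp f)), ← real_inner_self_eq_norm_sq, inner_toLp]
  simp only [sq]

theorem abs_integral_mul_le {f g : α → ℝ} (hf : MemLp f 2 μ) (hg : MemLp g 2 μ) :
    |∫ x, f x * g x ∂μ| ≤ l2 μ f * l2 μ g := by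
  rw [← inner_toLp hf hg, ← norm_toLp_eq_l2 hf, ← norm_toLp_eq_l2 hg]
  exact abs_real_inner_le_norm _ _

theorem l2_mono {f g : α → ℝ} (hg : MemLp g 2 μ) (h : ∀ᵐ x ∂μ, |f x| ≤ |g x|) :
    l2 μ f ≤ l2 μ g :=
  Real.sqrt_le_sqrt (integral_mono_of_nonneg (Eventually.of_forall fun _ => sq_nonneg _)
    hg.integrable_sq (h.mono fun _ hx => sq_le_sq.2 hx))

theorem lintegral_enorm_sq_eq {F : Type*} [NormedAddCommGroup F] {f : α → F} (hf : MemLp f 2 μ) :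
    ∫⁻ x, ‖f x‖ₑ ^ 2 ∂μ = ENNReal.ofReal (∫ x, ‖f x‖ ^ 2 ∂μ) := by
  rw [ofReal_integral_eq_lintegral_ofReal (hf.integrable_norm_pow two_ne_zero)
    (Eventually.of_forall fun _ => by positivity)]
  refine lintegral_congr fun x => ?_
  rw [ENNReal.ofReal_pow (norm_nonneg _), ofReal_norm]

end L2Norm

theorem IsTest.integral_norm_fderiv_sq {φ : Sp N → ℝ} (hφ : IsTest φ) :
    ∫ x, ‖fderiv ℝ φ x‖ ^ 2 = ∑ i, ∫ x, BiKolmogorov.pd i φ x ^ 2 := by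
  simp only [norm_fderiv_sq]
  exact integral_finsetSum _ fun i _ => ((hφ.pd i).memLp 2).integrable_sq

theorem IsTest.memLp_fderiv {φ : Sp N → ℝ} (hφ : IsTest φ) (p : ℝ≥0∞) : MemLp (fderiv ℝ φ) p :=
  (hφ.contDiff.continuous_fderiv (by simp)).memLp_of_hasCompactSupport
    (hφ.hasCompactSupport.fderiv ℝ)

/-- Multiplication by a field in `L^r`, `r > N`, is bounded on test functions relative to the
gradient, with arbitrarily small bound. -/
theorem exists_integral_sq_mul_le {β : Sp N → Sp N} {r : ℝ} (hr : 2 ≤ r) (hNr : (N : ℝ) < r)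
    (hβ : MemLp β (ENNReal.ofReal r)) {ε : ℝ} (hε : 0 < ε) :
    ∃ C : ℝ, 0 ≤ C ∧ ∀ φ, IsTest φ → MemLp (fun x => ‖β x‖ * φ x) 2 ∧
      ∫ x, (‖β x‖ * φ x) ^ 2 ≤ C * (∫ x, φ x ^ 2) + ε * ∑ i, ∫ x, pd i φ x ^ 2 := by
  have hr0 : 0 < r := by linarith
  have hb := hβ.eLpNorm_lt_top
  rw [eLpNorm_lt_top_iff_lintegral_rpow_enorm_lt_top (by simpa using hr0) (by simp),
    ENNReal.toReal_ofReal hr0.le] at hb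
  obtain ⟨C, hC, h⟩ := exists_lintegral_sq_mul_le hβ.1.enorm hr hNr hb.ne
    (ENNReal.ofReal_pos.2 hε).ne'
  refine ⟨C.toReal, ENNReal.toReal_nonneg, fun φ hφ => ?_⟩
  have h1 := h φ (hφ.contDiff.of_le (by simp))
  rw [lintegral_enorm_sq_eq (hφ.memLp 2), lintegral_enorm_sq_eq (hφ.memLp_fderiv 2),
    hφ.integral_norm_fderiv_sq] at h1
  have hm : AEStronglyMeasurable (fun x => ‖β x‖ * φ x) :=
    hβ.1.norm.mul hφ.continuous.aestronglyMeasurable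
  have e : ∀ x, ‖‖β x‖ * φ x‖ₑ ^ 2 = ‖β x‖ₑ ^ 2 * ‖φ x‖ₑ ^ 2 := fun x => by
    rw [enorm_mul, enorm_norm, mul_pow]
  have h0 : (0 : ℝ) ≤ ∑ i, ∫ x, pd i φ x ^ 2 :=
    Finset.sum_nonneg fun i _ => integral_nonneg fun x => sq_nonneg _
  have h00 : (0 : ℝ) ≤ ∫ x, φ x ^ 2 := integral_nonneg fun x => sq_nonneg _
  have hL : MemLp (fun x => ‖β x‖ * φ x) 2 := by
    rw [memLp_two_iff_lintegral hm]
    simp only [e]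
    exact h1.trans_lt (by finiteness)
  refine ⟨hL, ?_⟩
  have h2 := lintegral_enorm_sq_eq hL
  simp only [e] at h2
  rw [h2] at h1
  simp only [Real.norm_eq_abs, sq_abs] at h1
  rw [← ENNReal.ofReal_toReal hC, ← ENNReal.ofReal_mul ENNReal.toReal_nonneg,
    ← ENNReal.ofReal_mul hε.le, ← ENNReal.ofReal_add (by positivity) (by positivity)] at h1
  exact (ENNReal.ofReal_le_ofReal_iff (by positivity)).1 h1

/-- The space of real-valued test functions. -/
def testSpace (N : ℕ) : Submodule ℝ (Sp N → ℝ) where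
  carrier := {φ | IsTest φ}
  zero_mem' := ⟨contDiff_const, HasCompactSupport.zero⟩
  add_mem' h1 h2 := h1.add h2
  smul_mem' c _ h := h.const_mul c

/-- The differential operator `c - Δ - β · ∇`. -/
def shiftedOp (c : ℝ) (β : Sp N → Sp N) (φ : Sp N → ℝ) (x : Sp N) : ℝ :=
  c * φ x - lap φ x - fderiv ℝ φ x (β x)

theorem lap_add {φ ψ : Sp N → ℝ} (hφ : ContDiff ℝ ∞ φ) (hψ : ContDiff ℝ ∞ ψ) (x : Sp N) :
    lap (fun y => φ y + ψ y) x = lap φ x + lap ψ x := by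
  simp only [lap, ← Finset.sum_add_distrib]
  refine Finset.sum_congr rfl fun i _ => ?_
  rw [show pd i (fun y => φ y + ψ y) = fun y => pd i φ y + pd i ψ y from
    funext (pd_add (hφ.differentiable (by simp)) (hψ.differentiable (by simp)) i)]
  exact pd_add ((contDiff_pd hφ i).differentiable (by simp))
    ((contDiff_pd hψ i).differentiable (by simp)) i x

theorem lap_const_mul {φ : Sp N → ℝ} (hφ : ContDiff ℝ ∞ φ) (c : ℝ) (x : Sp N) :
    lap (fun y => c * φ y) x = c * lap φ x := by
  simp only [lap, Finset.mul_sum]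
  refine Finset.sum_congr rfl fun i _ => ?_
  rw [show pd i (fun y => c * φ y) = fun y => c * pd i φ y from
    funext (pd_const_mul (hφ.differentiable (by simp)) c i)]
  exact pd_const_mul ((contDiff_pd hφ i).differentiable (by simp)) c i x

/-- The operator `c - Δ - β · ∇` as a linear map on test functions. -/
def shiftedOpLin (c : ℝ) (β : Sp N → Sp N)
    (h : ∀ φ, IsTest φ → MemLp (shiftedOp c β φ) 2) :
    testSpace N →ₗ[ℝ] Lp ℝ 2 (volume : Measure (Sp N)) where
  toFun φ := (h φ.1 φ.2).toLp _
  map_add' φ ψ := by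
    rw [← MemLp.toLp_add]
    congr 1
    funext x
    have h1 := lap_add φ.2.contDiff ψ.2.contDiff x
    have h2 := fderiv_fun_add (φ.2.differentiable x) (ψ.2.differentiable x)
    change c * (φ.1 x + ψ.1 x) - lap (fun y => φ.1 y + ψ.1 y) x -
      fderiv ℝ (fun y => φ.1 y + ψ.1 y) x (β x) = shiftedOp c β φ.1 x + shiftedOp c β ψ.1 x
    rw [h1, h2]
    simp only [shiftedOp, _root_.add_apply]
    ring
  map_smul' k φ := by
    rw [RingHom.id_apply, ← MemLp.toLp_const_smul]
    congr 1
    funext x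
    have h1 := lap_const_mul φ.2.contDiff k x
    have h2 := fderiv_const_mul (φ.2.differentiable x) k
    change c * (k * φ.1 x) - lap (fun y => k * φ.1 y) x -
      fderiv ℝ (fun y => k * φ.1 y) x (β x) = k * shiftedOp c β φ.1 x
    rw [h1, h2]
    simp only [shiftedOp, _root_.smul_apply, smul_eq_mul]
    ring

theorem shiftedOpLin_apply {c : ℝ} {β : Sp N → Sp N}
    (h : ∀ φ, IsTest φ → MemLp (shiftedOp c β φ) 2) (φ : testSpace N) :
    shiftedOpLin c β h φ = (h φ.1 φ.2).toLp _ := rfl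

theorem IsTest.memLp_shiftedOp_zero {φ : Sp N → ℝ} (h : IsTest φ) (c : ℝ) :
    MemLp (shiftedOp c (0 : Sp N → Sp N) φ) 2 :=
  ((((h.const_mul c).memLp 2).sub (h.lap.memLp 2))).ae_eq
    (Eventually.of_forall fun x => by simp [shiftedOp])

theorem denseRange_shiftedOpLin_zero {c : ℝ} (hc : 0 < c) :
    DenseRange (shiftedOpLin c (0 : Sp N → Sp N) fun _ h => h.memLp_shiftedOp_zero c) := by
  refine denseRange_of_forall_inner_eq_zero _ fun z hz => ?_
  have h0 := ae_eq_zero_of_integral_sub_lap hc (Lp.memLp z) fun φ hφ => by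
    have h1 := hz ⟨φ, hφ⟩
    rw [shiftedOpLin_apply, inner_toLp_right] at h1
    simpa only [shiftedOp, Pi.zero_apply, map_zero, sub_zero] using h1
  exact Lp.ext (h0.trans (Lp.coeFn_zero _ _ _).symm)

/-- `c - Δ - β · ∇` maps the test functions onto a dense subspace of `L²` for large `c`. -/
theorem exists_denseRange_shiftedOp {β : Sp N → Sp N} {r : ℝ} (hr : 2 ≤ r) (hNr : (N : ℝ) < r)
    (hβ : MemLp β (ENNReal.ofReal r)) :
    ∃ c : ℝ, 0 < c ∧ ∃ h : ∀ φ, IsTest φ → MemLp (shiftedOp c β φ) 2,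
      DenseRange (shiftedOpLin c β h) := by
  obtain ⟨C, hC0, hC⟩ := exists_integral_sq_mul_le hr hNr hβ (ε := 1 / 4) (by norm_num)
  have hbound : ∀ φ x, |fderiv ℝ φ x (β x)| ≤ ‖β x‖ * ‖fderiv ℝ φ x‖ := fun φ x => by
    rw [mul_comm]; exact (fderiv ℝ φ x).le_opNorm _
  have hbi : ∀ {φ : Sp N → ℝ}, IsTest φ → Integrable fun x => ∑ i, (‖β x‖ * pd i φ x) ^ 2 :=
    fun hφ => integrable_finsetSum _ fun i _ => (hC _ (hφ.pd i)).1.integrable_sq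
  have hbs : ∀ φ x, (fderiv ℝ φ x (β x)) ^ 2 ≤ ∑ i, (‖β x‖ * pd i φ x) ^ 2 := by
    intro φ x
    simp only [mul_pow]
    rw [← Finset.mul_sum, ← norm_fderiv_sq, ← mul_pow]
    exact sq_le_sq' (abs_le.1 (hbound φ x)).1 (abs_le.1 (hbound φ x)).2
  have hm : ∀ {φ : Sp N → ℝ}, IsTest φ → MemLp (fun x => fderiv ℝ φ x (β x)) 2 := by
    intro φ hφ
    have hmeas : AEStronglyMeasurable (fun x => fderiv ℝ φ x (β x)) :=
      isBoundedBilinearMap_apply.continuous.comp_aestronglyMeasurable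
        ((hφ.contDiff.continuous_fderiv (by simp)).aestronglyMeasurable.prodMk hβ.1)
    rw [memLp_two_iff_integrable_sq hmeas]
    exact (hbi hφ).mono' (hmeas.pow 2) (Eventually.of_forall fun x => by
      rw [Real.norm_of_nonneg (sq_nonneg _)]; exact hbs φ x)
  -- Chosen so that `C ≤ c/2`: then `C ∑ ‖∂_iφ‖² + ¼ ∑ ‖∂_j∂_iφ‖²` is at most a quarter of `‖(c -
  -- Δ)φ‖²`, and the drift term has relative bound `½`.
  set c := 2 * C + 1
  have hc : 0 < c := by positivity
  have hbd : ∀ φ, IsTest φ → l2 volume (fun x => fderiv ℝ φ x (β x)) ≤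
      1 / 2 * l2 volume (shiftedOp c (0 : Sp N → Sp N) φ) := by
    intro φ hφ
    refine le_of_sq_le_sq ?_ (by have := l2_nonneg (μ := volume) (shiftedOp c (0 : Sp N → Sp N) φ); positivity)
    rw [mul_pow, l2_sq, l2_sq]
    simp only [shiftedOp, Pi.zero_apply, map_zero, sub_zero]
    rw [integral_sub_lap_sq hφ]
    calc ∫ x, (fderiv ℝ φ x (β x)) ^ 2 ≤ ∫ x, ∑ i, (‖β x‖ * pd i φ x) ^ 2 :=
          integral_mono (hm hφ).integrable_sq (hbi hφ) (hbs φ)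
      _ = ∑ i, ∫ x, (‖β x‖ * pd i φ x) ^ 2 :=
          integral_finsetSum _ fun i _ => (hC _ (hφ.pd i)).1.integrable_sq
      _ ≤ ∑ i, (C * (∫ x, pd i φ x ^ 2) + 1 / 4 * ∑ j, ∫ x, pd j (pd i φ) x ^ 2) :=
          Finset.sum_le_sum fun i _ => (hC _ (hφ.pd i)).2
      _ = C * (∑ i, ∫ x, pd i φ x ^ 2) + 1 / 4 * ∑ i, ∑ j, ∫ x, pd j (pd i φ) x ^ 2 := by
          rw [Finset.sum_add_distrib, Finset.mul_sum, Finset.mul_sum]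
      _ ≤ _ := by
          have h0 : (0 : ℝ) ≤ ∑ i, ∫ x, pd i φ x ^ 2 :=
            Finset.sum_nonneg fun i _ => integral_nonneg fun x => sq_nonneg _
          have h00 : (0 : ℝ) ≤ ∫ x, φ x ^ 2 := integral_nonneg fun x => sq_nonneg _
          have h1 : 0 ≤ c ^ 2 * ∫ x, φ x ^ 2 := by positivity
          simp only [c] at h1 ⊢
          nlinarith
  have hS : ∀ φ, IsTest φ → MemLp (shiftedOp c (0 : Sp N → Sp N) φ) 2 :=
    fun φ h => h.memLp_shiftedOp_zero c
  have hT : ∀ φ, IsTest φ → MemLp (shiftedOp c β φ) 2 := fun φ h =>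
    ((h.memLp_shiftedOp_zero c).sub (hm h)).ae_eq
      (Eventually.of_forall fun x => by simp [shiftedOp])
  have hSd : DenseRange (shiftedOpLin c 0 hS) := denseRange_shiftedOpLin_zero hc
  refine ⟨c, hc, hT, denseRange_of_forall_inner_eq_zero _ fun z hz => ?_⟩
  -- If `z` annihilates the perturbed range, then `(z, (c - Δ)φ) = (z, β · ∇φ)`, which is at most `½
  -- ‖z‖ ‖(c - Δ)φ‖`. The range of `c - Δ` is dense, so this holds for every `y`; the choice `y = z`
  -- forces `z = 0`.
  have h1 : ∀ y, ⟪z, y⟫_ℝ ≤ 1 / 2 * ‖z‖ * ‖y‖ := by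
    intro y
    refine hSd.induction_on (p := fun y => ⟪z, y⟫_ℝ ≤ 1 / 2 * ‖z‖ * ‖y‖) y
      (isClosed_le (by fun_prop) (by fun_prop)) fun φ => ?_
    have h2 := hz φ
    have e1 : shiftedOpLin c β hT φ = shiftedOpLin c 0 hS φ - (hm φ.2).toLp _ := by
      rw [shiftedOpLin_apply, shiftedOpLin_apply, ← MemLp.toLp_sub]
      congr 1
      funext x
      simp [shiftedOp]
    rw [e1, inner_sub_right, sub_eq_zero] at h2
    rw [h2]
    refine (real_inner_le_norm _ _).trans ?_
    have h3 := hbd φ.1 φ.2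
    rw [← norm_toLp_eq_l2 (hm φ.2), ← norm_toLp_eq_l2 (hS φ.1 φ.2)] at h3
    rw [shiftedOpLin_apply]
    nlinarith [norm_nonneg z]
  have h2 := h1 z
  rw [real_inner_self_eq_norm_sq] at h2
  rw [← norm_eq_zero]
  nlinarith [norm_nonneg z]

end Density

/-! ### Very weak solutions with dual `H¹` data have weak gradients in `L²`, by transposition. -/

section Regularity

variable {N : ℕ}

/-- A functional bounded by the norm of a linear image is represented by a vector. -/
theorem exists_forall_eq_inner {X E : Type*} [AddCommGroup X] [Module ℝ X]
    [NormedAddCommGroup E] [InnerProductSpace ℝ E] [CompleteSpace E] (j : X →ₗ[ℝ] E)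
    (f : X →ₗ[ℝ] ℝ) (C : ℝ) (h : ∀ x, |f x| ≤ C * ‖j x‖) : ∃ v : E, ∀ x, f x = ⟪v, j x⟫_ℝ := by
  -- A linear section of `j` moves `f` to a bounded functional on the range; the choice of section
  -- is immaterial, as the bound makes `f` vanish on `ker j`. Hahn–Banach and Riesz then represent
  -- it.
  obtain ⟨s, hs⟩ := LinearMap.exists_rightInverse_of_surjective j.rangeRestrict
    (LinearMap.range_rangeRestrict j)
  have hs' : ∀ y, j (s y) = y := fun y => congrArg Subtype.val (LinearMap.congr_fun hs y)
  let g : LinearMap.range j →L[ℝ] ℝ := (f.comp s).mkContinuous C fun y => by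
    have := h (s y)
    rw [hs'] at this
    exact this
  obtain ⟨g', hg', -⟩ := _root_.exists_extension_norm_eq _ g
  refine ⟨(InnerProductSpace.toDual ℝ E).symm g', fun x => ?_⟩
  rw [InnerProductSpace.toDual_symm_apply]
  have h1 := hg' (j.rangeRestrict x)
  have h2 : f (x - s (j.rangeRestrict x)) = 0 := by
    have h3 := h (x - s (j.rangeRestrict x))
    rw [map_sub j, hs', show ((j.rangeRestrict x : LinearMap.range j) : E) = j x from rfl, sub_self, norm_zero, mul_zero] at h3
    exact abs_nonpos_iff.1 h3
  rw [map_sub, sub_eq_zero] at h2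
  rw [h2]
  exact h1.symm

/-- The inclusion of the test functions into `L²`. -/
def testToLp (N : ℕ) : testSpace N →ₗ[ℝ] Lp ℝ 2 (volume : Measure (Sp N)) where
  toFun φ := (φ.2.memLp 2).toLp _
  map_add' φ ψ := by rw [← MemLp.toLp_add]; rfl
  map_smul' c φ := by rw [RingHom.id_apply, ← MemLp.toLp_const_smul]; rfl

/-- Boundedness of the distributional derivatives in `L²` yields a weak gradient in `L²`. -/
theorem exists_hasWeakGradient {u : Sp N → ℝ} (hu : MemLp u 2) {C : ℝ}
    (h : ∀ φ, IsTest φ → ∀ i, |∫ x, u x * pd i φ x| ≤ C * l2 volume φ) :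
    ∃ F : Sp N → Sp N, MemLp F 2 ∧ HasWeakGradient u F := by
  have hi : ∀ {φ : Sp N → ℝ}, IsTest φ → Integrable fun x => u x * φ x := fun hφ =>
    hu.integrable_mul (hφ.memLp 2)
  have h1 : ∀ i, ∃ v : Lp ℝ 2 (volume : Measure (Sp N)), ∀ φ, IsTest φ →
      - ∫ x, u x * pd i φ x = ∫ x, v x * φ x := by
    intro i
    let f : testSpace N →ₗ[ℝ] ℝ :=
      { toFun := fun φ => - ∫ x, u x * pd i φ.1 x
        map_add' := fun φ ψ => by
          rw [← neg_add, ← integral_add (hi (φ.2.pd i)) (hi (ψ.2.pd i))]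
          congr 1
          refine integral_congr_ae (Eventually.of_forall fun x => ?_)
          have := pd_add φ.2.differentiable ψ.2.differentiable i x
          change u x * pd i (fun y => φ.1 y + ψ.1 y) x = _
          rw [this, mul_add]
        map_smul' := fun c φ => by
          rw [RingHom.id_apply, smul_eq_mul, mul_neg, ← integral_const_mul]
          congr 1
          refine integral_congr_ae (Eventually.of_forall fun x => ?_)
          have := pd_const_mul φ.2.differentiable c i x
          change u x * pd i (fun y => c * φ.1 y) x = _
          rw [this]
          ring }
    obtain ⟨v, hv⟩ := exists_forall_eq_inner (testToLp N) f C fun φ => by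
      change |-∫ x, u x * pd i φ.1 x| ≤ C * ‖(φ.2.memLp 2).toLp _‖
      rw [abs_neg, norm_toLp_eq_l2]
      exact h _ φ.2 i
    refine ⟨v, fun φ hφ => ?_⟩
    have := hv ⟨φ, hφ⟩
    rw [show testToLp N ⟨φ, hφ⟩ = (hφ.memLp 2).toLp _ from rfl, inner_toLp_right] at this
    exact this
  choose v hv using h1
  have hF : MemLp (fun x => ∑ i, v i x • EuclideanSpace.single i (1 : ℝ)) 2 volume :=
    memLp_finsetSum _ fun i _ => by
      refine (Lp.memLp (v i)).of_le_mul (c := 1)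
        ((Lp.aestronglyMeasurable (v i)).smul_const _) (Eventually.of_forall fun x => ?_)
      rw [norm_smul, PiLp.norm_single, norm_one, mul_one, one_mul]
  refine ⟨_, hF, hu.locallyIntegrable (by norm_num), hF.locallyIntegrable (by norm_num),
    fun φ h1 h2 w => ?_⟩
  have hφ : IsTest φ := ⟨h1, h2⟩
  have hvi : ∀ i, Integrable fun x => w i * (v i x * φ x) := fun i =>
    ((Lp.memLp (v i)).integrable_mul (hφ.memLp 2)).const_mul _
  calc ∫ x, u x * fderiv ℝ φ x w = ∫ x, ∑ i, w i * (u x * pd i φ x) := by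
        refine integral_congr_ae (Eventually.of_forall fun x => ?_)
        simp only [fderiv_apply_eq_sum φ x w, Finset.mul_sum]
        exact Finset.sum_congr rfl fun i _ => by ring
    _ = ∑ i, w i * ∫ x, u x * pd i φ x := by
        rw [integral_finsetSum _ fun i _ => (hi (hφ.pd i)).const_mul _]
        exact Finset.sum_congr rfl fun i _ => integral_const_mul _ _
    _ = - ∑ i, ∫ x, w i * (v i x * φ x) := by
        rw [← Finset.sum_neg_distrib]
        refine Finset.sum_congr rfl fun i _ => ?_
        rw [integral_const_mul, ← hv i φ hφ]
        ring
    _ = _ := by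
        rw [← integral_finsetSum _ fun i _ => hvi i]
        congr 1
        refine integral_congr_ae (Eventually.of_forall fun x => ?_)
        simp only [sum_inner, inner_smul_left, EuclideanSpace.inner_single_left, Finset.sum_mul]
        refine Finset.sum_congr rfl fun i _ => ?_
        simp
        ring

/-- The square of the `H¹` norm. -/
def energy (φ : Sp N → ℝ) : ℝ := (∫ x, φ x ^ 2) + ∑ i, ∫ x, pd i φ x ^ 2

theorem energy_nonneg (φ : Sp N → ℝ) : 0 ≤ energy φ :=
  add_nonneg (integral_nonneg fun _ => sq_nonneg _)
    (Finset.sum_nonneg fun _ _ => integral_nonneg fun _ => sq_nonneg _)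

theorem l2_le_sqrt_energy (φ : Sp N → ℝ) : l2 volume φ ≤ √(energy φ) :=
  Real.sqrt_le_sqrt (le_add_of_nonneg_right
    (Finset.sum_nonneg fun _ _ => integral_nonneg fun _ => sq_nonneg _))

theorem l2_pd_le_sqrt_energy (φ : Sp N → ℝ) (i : Fin N) :
    l2 volume (pd i φ) ≤ √(energy φ) := by
  refine Real.sqrt_le_sqrt (le_add_of_nonneg_of_le (integral_nonneg fun _ => sq_nonneg _) ?_)
  exact Finset.single_le_sum (f := fun i => ∫ x, pd i φ x ^ 2)
    (fun _ _ => integral_nonneg fun _ => sq_nonneg _) (Finset.mem_univ i)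

/-- A weak solution with a right-hand side in the dual of `H¹` belongs to `H¹`. -/
theorem exists_hasWeakGradient_of_le_energy {w : Sp N → ℝ} {H β : Sp N → Sp N}
    (hw : HasWeakGradient w H) {δ M : ℝ} (hδ : 0 < δ) (hδw : ∀ᵐ x, δ ≤ w x) (hwM : ∀ᵐ x, w x ≤ M)
    (hH : ∀ᵐ x, H x = w x • β x) {r : ℝ} (hr : 2 ≤ r) (hNr : (N : ℝ) < r)
    (hβ : MemLp β (ENNReal.ofReal r)) {u : Sp N → ℝ} (hu : MemLp u 2) {C : ℝ}
    (h : ∀ φ, IsTest φ → |∫ x, u x * w x * (lap φ x + fderiv ℝ φ x (β x))| ≤ C * √(energy φ)) :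
    ∃ F : Sp N → Sp N, MemLp F 2 ∧ HasWeakGradient u F := by
  obtain ⟨c, hc, hT, hd⟩ := exists_denseRange_shiftedOp hr hNr hβ
  have hwm : AEStronglyMeasurable w := hw.locallyIntegrable.aestronglyMeasurable
  have hM : 0 ≤ M := by
    obtain ⟨x, h1, h2⟩ := (hδw.and hwM).exists
    linarith
  have hwu : ∀ {v : Sp N → ℝ}, MemLp v 2 → MemLp (fun x => w x * v x) 2 ∧
      l2 volume (fun x => w x * v x) ≤ M * l2 volume v := by
    intro v hv
    have hb : ∀ᵐ x, |w x * v x| ≤ |M * v x| := by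
      filter_upwards [hδw, hwM] with x h1 h2
      rw [abs_mul, abs_mul, abs_of_pos (hδ.trans_le h1), abs_of_nonneg hM]
      gcongr
    refine ⟨(hv.const_mul M).mono (hwm.mul hv.1) (by simpa only [Real.norm_eq_abs] using hb), ?_⟩
    refine (l2_mono (hv.const_mul M) hb).trans (le_of_eq ?_)
    rw [l2, l2]
    simp only [mul_pow]
    rw [integral_const_mul, Real.sqrt_mul (sq_nonneg _), Real.sqrt_sq hM]
  set m := δ * min c 1
  have hm : 0 < m := mul_pos hδ (lt_min hc one_pos)
  set K := c * (M * l2 volume u) + C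
  -- Since `H = wβ` is the gradient of the weight, `w(Δφ + β · ∇φ)` is in divergence form, and the
  -- right side equals `c ∫ wφ² + ∫ w|∇φ|²`.
  have hcoer : ∀ φ, IsTest φ → m * energy φ ≤ ∫ x, w x * φ x * shiftedOp c β φ x := by
    intro φ hφ
    have h1 := hw.integral_mul_lap_add hφ hφ.contDiff
    have i0 : ∀ {θ : Sp N → ℝ}, IsTest θ → Integrable fun x => w x * θ x ^ 2 := by
      intro θ hθ
      exact ((hwu (hθ.memLp 2)).1.integrable_mul (hθ.memLp 2)).congr
        (Eventually.of_forall fun x => by simp; ring)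
    have i1 : Integrable fun x => w x * φ x * shiftedOp c β φ x :=
      (hwu (hφ.memLp 2)).1.integrable_mul (hT φ hφ)
    have e1 : (fun x => c * (w x * φ x ^ 2) - w x * φ x * shiftedOp c β φ x) =ᵐ[volume]
        fun x => w x * φ x * lap φ x + φ x * fderiv ℝ φ x (H x) := by
      filter_upwards [hH] with x hx
      rw [hx, map_smul, smul_eq_mul, shiftedOp]
      ring
    have i3 : Integrable fun x => w x * ∑ i, pd i φ x * pd i φ x := by
      simp only [Finset.mul_sum, ← sq]
      exact integrable_finsetSum _ fun i _ => i0 (hφ.pd i)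
    rw [← integral_congr_ae e1, integral_sub ((i0 hφ).const_mul c) i1, integral_const_mul] at h1
    have h2 : δ * (∫ x, φ x ^ 2) ≤ ∫ x, w x * φ x ^ 2 := by
      rw [← integral_const_mul]
      refine integral_mono_ae ((hφ.memLp 2).integrable_sq.const_mul δ) (i0 hφ) ?_
      filter_upwards [hδw] with x hx
      gcongr
    have h3 : δ * (∑ i, ∫ x, pd i φ x ^ 2) ≤ ∫ x, w x * ∑ i, pd i φ x * pd i φ x := by
      rw [← integral_finsetSum _ fun i _ => ((hφ.pd i).memLp 2).integrable_sq, ← integral_const_mul]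
      refine integral_mono_ae ((integrable_finsetSum _ fun i _ =>
        ((hφ.pd i).memLp 2).integrable_sq).const_mul δ) i3 ?_
      filter_upwards [hδw] with x hx
      simp only [← sq]
      gcongr
    have h4 : (0 : ℝ) ≤ ∑ i, ∫ x, pd i φ x ^ 2 :=
      Finset.sum_nonneg fun i _ => integral_nonneg fun x => sq_nonneg _
    have h5 : (0 : ℝ) ≤ ∫ x, φ x ^ 2 := integral_nonneg fun x => sq_nonneg _
    have h6 : m * energy φ ≤ c * (δ * ∫ x, φ x ^ 2) + δ * ∑ i, ∫ x, pd i φ x ^ 2 := by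
      rw [energy, mul_add]
      refine add_le_add ?_ ?_
      · calc m * ∫ x, φ x ^ 2 ≤ (δ * c) * ∫ x, φ x ^ 2 := by
              exact mul_le_mul_of_nonneg_right (mul_le_mul_of_nonneg_left (min_le_left _ _) hδ.le) h5
          _ = _ := by ring
      · calc m * ∑ i, ∫ x, pd i φ x ^ 2 ≤ (δ * 1) * ∑ i, ∫ x, pd i φ x ^ 2 := by
              exact mul_le_mul_of_nonneg_right (mul_le_mul_of_nonneg_left (min_le_right _ _) hδ.le) h4
          _ = _ := by ring
    have h7 : c * (δ * ∫ x, φ x ^ 2) ≤ c * ∫ x, w x * φ x ^ 2 := by gcongr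
    linarith
  have hdual : ∀ φ, IsTest φ → |∫ x, w x * u x * shiftedOp c β φ x| ≤ K * √(energy φ) := by
    intro φ hφ
    have i1 : Integrable fun x => w x * u x * (c * φ x) :=
      (hwu hu).1.integrable_mul ((hφ.const_mul c).memLp 2)
    have i2 : Integrable fun x => w x * u x * shiftedOp c β φ x :=
      (hwu hu).1.integrable_mul (hT φ hφ)
    have e : ∫ x, w x * u x * shiftedOp c β φ x = c * (∫ x, w x * u x * φ x) -
        ∫ x, u x * w x * (lap φ x + fderiv ℝ φ x (β x)) := by
      rw [← integral_const_mul, ← integral_sub]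
      · refine integral_congr_ae (Eventually.of_forall fun x => ?_)
        simp only [shiftedOp]
        ring
      · exact ((hwu hu).1.integrable_mul (hφ.memLp 2)).const_mul c
      · refine (i1.sub i2).congr (Eventually.of_forall fun x => ?_)
        simp only [shiftedOp, Pi.sub_apply]
        ring
    rw [e]
    refine (abs_sub _ _).trans ?_
    rw [add_mul]
    refine add_le_add ?_ (h φ hφ)
    rw [abs_mul, abs_of_pos hc, mul_assoc]
    refine mul_le_mul_of_nonneg_left ?_ hc.le
    refine (abs_integral_mul_le (hwu hu).1 (hφ.memLp 2)).trans ?_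
    have := l2_nonneg (μ := volume) φ
    have := l2_nonneg (μ := volume) u
    exact mul_le_mul (hwu hu).2 (l2_le_sqrt_energy φ) (l2_nonneg _) (by positivity)
  refine exists_hasWeakGradient hu (C := |K| / m) fun ψ hψ i => ?_
  -- This function is approximated in `L²` by images `shiftedOp c β φ`; pairing it with `wu`
  -- recovers `∫ u ∂_i ψ`.
  have hg : MemLp (fun x => (w x)⁻¹ * pd i ψ x) 2 := by
    refine (((hψ.pd i).memLp 2).const_mul δ⁻¹).mono
      (hwm.aemeasurable.inv.aestronglyMeasurable.mul (hψ.pd i).continuous.aestronglyMeasurable) ?_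
    filter_upwards [hδw] with x hx
    rw [norm_mul, norm_mul, norm_inv, norm_inv, Real.norm_of_nonneg hδ.le,
      Real.norm_of_nonneg (hδ.le.trans hx)]
    gcongr
  have hε : ∀ ε > 0, |∫ x, u x * pd i ψ x| ≤
      |K| / m * l2 volume ψ + ε * (|K| / m * M + M * l2 volume u) := by
    intro ε hε
    obtain ⟨φ, hφε⟩ := hd.exists_dist_lt (hg.toLp _) hε
    have hφ := φ.2
    have hdiff := (hT _ hφ).sub hg
    rw [shiftedOpLin_apply, dist_comm, dist_eq_norm, ← MemLp.toLp_sub, norm_toLp_eq_l2] at hφε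
    set E := √(energy φ.1)
    have hE0 : 0 ≤ E := Real.sqrt_nonneg _
    have hE2 : E ^ 2 = energy φ.1 := Real.sq_sqrt (energy_nonneg _)
    have hwg : ∀ v : Sp N → ℝ, ∀ᵐ x, w x * v x * ((w x)⁻¹ * pd i ψ x) = v x * pd i ψ x := by
      intro v
      filter_upwards [hδw] with x hx
      have : w x ≠ 0 := (hδ.trans_le hx).ne'
      field_simp
    have hsplit : ∀ v : Sp N → ℝ, MemLp v 2 →
        ∫ x, w x * v x * shiftedOp c β φ.1 x = (∫ x, v x * pd i ψ x) +
          ∫ x, w x * v x * (shiftedOp c β φ.1 x - (w x)⁻¹ * pd i ψ x) := by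
      intro v hv
      have i1 : Integrable fun x => w x * v x * ((w x)⁻¹ * pd i ψ x) :=
        (hwu hv).1.integrable_mul hg
      have i2 : Integrable fun x => w x * v x * (shiftedOp c β φ.1 x - (w x)⁻¹ * pd i ψ x) :=
        (hwu hv).1.integrable_mul hdiff
      rw [← integral_congr_ae (hwg v), ← integral_add i1 i2]
      exact integral_congr_ae (Eventually.of_forall fun x => by ring)
    have hrest : ∀ v : Sp N → ℝ, MemLp v 2 →
        |∫ x, w x * v x * (shiftedOp c β φ.1 x - (w x)⁻¹ * pd i ψ x)| ≤
          M * l2 volume v * ε := by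
      intro v hv
      refine (abs_integral_mul_le (hwu hv).1 hdiff).trans ?_
      have := l2_nonneg (μ := volume) v
      exact mul_le_mul (hwu hv).2 hφε.le (l2_nonneg _) (by positivity)
    -- Coercivity bounds the energy of the approximating `φ`: up to the error, the pairing is `∫ φ
    -- ∂_i ψ = -∫ ∂_i φ ψ`, at most `E ‖ψ‖₂`. One factor `E` is cancelled at the end.
    have h1 : m * E ≤ l2 volume ψ + M * ε := by
      have h2 := hcoer _ hφ
      rw [hsplit _ (hφ.memLp 2), integral_mul_pd hψ hφ.contDiff i, ← hE2] at h2
      have h3 : |∫ x, pd i φ.1 x * ψ x| ≤ E * l2 volume ψ :=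
        (abs_integral_mul_le ((hφ.pd i).memLp 2) (hψ.memLp 2)).trans
          (mul_le_mul_of_nonneg_right (l2_pd_le_sqrt_energy _ i) (l2_nonneg _))
      have h4 := hrest _ (hφ.memLp 2)
      have h5 : M * l2 volume φ.1 * ε ≤ M * E * ε := by
        gcongr
        exact l2_le_sqrt_energy _
      have h6 := neg_abs_le (∫ x, pd i φ.1 x * ψ x)
      have h7 := le_abs_self (∫ x, w x * φ.1 x * (shiftedOp c β φ.1 x - (w x)⁻¹ * pd i ψ x))
      have h8 : E * (m * E) ≤ E * (l2 volume ψ + M * ε) := by nlinarith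
      rcases hE0.eq_or_lt with h9 | h9
      · rw [← h9, mul_zero]
        have := l2_nonneg (μ := volume) ψ
        positivity
      · exact le_of_mul_le_mul_left h8 h9
    have h2 := hdual _ hφ
    rw [hsplit _ hu] at h2
    have h3 := hrest _ hu
    have h4 : |∫ x, u x * pd i ψ x| ≤ K * E + M * l2 volume u * ε := by
      have := abs_sub_abs_le_abs_sub (∫ x, u x * pd i ψ x)
        (-∫ x, w x * u x * (shiftedOp c β φ.1 x - (w x)⁻¹ * pd i ψ x))
      rw [abs_neg, sub_neg_eq_add] at this
      linarith
    have h5 : K * E ≤ |K| / m * (m * E) := by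
      rw [← mul_assoc, div_mul_cancel₀ _ hm.ne']
      exact mul_le_mul_of_nonneg_right (le_abs_self _) hE0
    have h6 : |K| / m * (m * E) ≤ |K| / m * (l2 volume ψ + M * ε) := by gcongr
    linarith
  set D := |K| / m * M + M * l2 volume u
  have hlim : Tendsto (fun ε : ℝ => |K| / m * l2 volume ψ + ε * D) (𝓝[>] 0)
      (𝓝 (|K| / m * l2 volume ψ + 0 * D)) :=
    (tendsto_const_nhds.add ((tendsto_id.mono_left nhdsWithin_le_nhds).mul_const D))
  rw [zero_mul, add_zero] at hlim
  exact ge_of_tendsto hlim (eventually_nhdsWithin_of_forall fun ε h => hε ε h)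

end Regularity

/-! ### Cutoffs and interpolated weights. -/

section Localization

variable {N : ℕ} {ρ : Sp N → ℝ} {G : Sp N → Sp N}

/-- The plateau has radius `R + 1`, not `R`, so that derivatives of the cutoff vanish in a
neighbourhood of the closed ball of radius `R`. -/
theorem exists_cutoff (N : ℕ) {R : ℝ} (hR : 0 ≤ R) : ∃ χ : Sp N → ℝ, IsTest χ ∧
    (∀ x, 0 ≤ χ x) ∧ (∀ x, χ x ≤ 1) ∧ (∀ x ∈ Metric.closedBall 0 (R + 1), χ x = 1) ∧
    ∀ x, x ∉ Metric.closedBall 0 (R + 2) → χ x = 0 := by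
  let f : ContDiffBump (0 : Sp N) := ⟨R + 1, R + 2, by linarith, by linarith⟩
  exact ⟨f, ⟨f.contDiff, f.hasCompactSupport⟩, fun x => f.nonneg, fun x => f.le_one,
    fun x hx => f.one_of_mem_closedBall hx, fun x hx => f.zero_of_le_dist
      (not_le.1 (by simpa using hx)).le⟩

theorem lap_mul {φ ψ : Sp N → ℝ} (hφ : ContDiff ℝ ∞ φ) (hψ : ContDiff ℝ ∞ ψ) (x : Sp N) :
    lap (fun y => φ y * ψ y) x =
      φ x * lap ψ x + 2 * (∑ i, pd i φ x * pd i ψ x) + lap φ x * ψ x := by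
  have hd := hφ.differentiable (by simp)
  have hd' := hψ.differentiable (by simp)
  simp only [lap, Finset.mul_sum, Finset.sum_mul, ← Finset.sum_add_distrib]
  refine Finset.sum_congr rfl fun i _ => ?_
  have di := (contDiff_pd hφ i).differentiable (by simp)
  have di' := (contDiff_pd hψ i).differentiable (by simp)
  rw [show pd i (fun y => φ y * ψ y) = fun y => φ y * pd i ψ y + pd i φ y * ψ y from
    funext (pd_mul hd hd' i), pd_add (φ := fun y => φ y * pd i ψ y)
    (ψ := fun y => pd i φ y * ψ y) (hd.mul di') (di.mul hd'), pd_mul hd di', pd_mul di hd']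
  ring

/-- Interpolation between a weight and the constant weight one. -/
theorem HasWeakGradient.interpolate (hG : HasWeakGradient ρ G) {ζ : Sp N → ℝ} (hζ : IsTest ζ) :
    HasWeakGradient (fun x => ζ x * ρ x + (1 - ζ x))
      (fun x => ζ x • G x + (ρ x - 1) • (InnerProductSpace.toDual ℝ (Sp N)).symm (fderiv ℝ ζ x)) := by
  set g : Sp N → Sp N := fun x => (InnerProductSpace.toDual ℝ (Sp N)).symm (fderiv ℝ ζ x)
  have hgc : Continuous g := (InnerProductSpace.toDual ℝ (Sp N)).symm.continuous.comp
    (hζ.contDiff.continuous_fderiv (by simp))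
  have hginner : ∀ x v, ⟪g x, v⟫_ℝ = fderiv ℝ ζ x v := fun x v =>
    InnerProductSpace.toDual_symm_apply
  have l1 : LocallyIntegrable fun x => ζ x * ρ x := by
    simpa only [smul_eq_mul] using hG.locallyIntegrable.continuous_smul hζ.continuous
  have l2 : LocallyIntegrable fun x => ζ x • G x :=
    hG.locallyIntegrable_grad.continuous_smul hζ.continuous
  have l3 : LocallyIntegrable fun x => (ρ x - 1) • g x :=
    (hG.locallyIntegrable.sub (locallyIntegrable_const 1)).smul_continuous hgc
  refine ⟨l1.add (continuous_const.sub hζ.continuous).locallyIntegrable, l2.add l3,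
    fun φ h1 h2 v => ?_⟩
  have hφ : IsTest φ := ⟨h1, h2⟩
  have hφv : IsTest fun x => fderiv ℝ φ x v := ⟨(h1.fderiv_right (m := ∞) (by simp)).clm_apply
    contDiff_const, h2.fderiv_apply (𝕜 := ℝ) v⟩
  have hζv : IsTest fun x => fderiv ℝ ζ x v :=
    ⟨(hζ.contDiff.fderiv_right (m := ∞) (by simp)).clm_apply
    contDiff_const, hζ.hasCompactSupport.fderiv_apply (𝕜 := ℝ) v⟩
  have hρi : ∀ {θ : Sp N → ℝ}, IsTest θ → Integrable fun x => ρ x * θ x := by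
    intro θ hθ
    refine (hG.locallyIntegrable.integrable_smul_left_of_hasCompactSupport
      hθ.continuous hθ.hasCompactSupport).congr (Eventually.of_forall fun x => ?_)
    simp only [smul_eq_mul]
    ring
  have hGi : ∀ {θ : Sp N → ℝ}, IsTest θ → Integrable fun x => ⟪G x, v⟫_ℝ * θ x := by
    intro θ hθ
    have h := hG.locallyIntegrable_grad.integrable_smul_left_of_hasCompactSupport
      hθ.continuous hθ.hasCompactSupport
    refine (h.inner_const v).congr (Eventually.of_forall fun x => ?_)
    simp only [inner_smul_left]
    simp
    ring
  have k1 := hG.integral_eq _ (hφ.mul_left hζ.contDiff).contDiff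
    (hφ.mul_left hζ.contDiff).hasCompactSupport v
  have k2 : ∫ x, (1 - ζ x) * fderiv ℝ φ x v = - ∫ x, (- fderiv ℝ ζ x v) * φ x := by
    have := integral_mul_fderiv_eq_neg_fderiv_mul_of_integrable (μ := volume)
      (f := fun x => 1 - ζ x) (g := φ) (v := v)
      (by
        refine (hφ.mul_left hζv.contDiff).integrable.neg.congr (Eventually.of_forall fun x => ?_)
        simp only [Pi.neg_apply, fderiv_const_sub, _root_.neg_apply]
        ring)
      (hφv.mul_left (contDiff_const.sub hζ.contDiff)).integrable
      (hφ.mul_left (contDiff_const.sub hζ.contDiff)).integrable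
      (fun x _ => (hζ.differentiable x).const_sub 1) (fun x _ => hφ.differentiable x)
    simpa only [fderiv_const_sub, _root_.neg_apply] using this
  have e0 : ∀ x, fderiv ℝ (fun y => ζ y * φ y) x v =
      ζ x * fderiv ℝ φ x v + fderiv ℝ ζ x v * φ x := by
    intro x
    rw [fderiv_fun_mul (hζ.differentiable x) (hφ.differentiable x)]
    simp
    ring
  simp only [e0, mul_add] at k1
  rw [integral_add (hρi (hφv.mul_left hζ.contDiff)) (hρi (hφ.mul_left hζv.contDiff))] at k1
  have i1 : Integrable fun x => ζ x * ρ x * fderiv ℝ φ x v :=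
    (hρi (hφv.mul_left hζ.contDiff)).congr (Eventually.of_forall fun x => by ring)
  have i2 : Integrable fun x => (1 - ζ x) * fderiv ℝ φ x v :=
    (hφv.mul_left (contDiff_const.sub hζ.contDiff)).integrable
  simp only [add_mul]
  rw [integral_add i1 i2, k2]
  have e1 : ∫ x, ζ x * ρ x * fderiv ℝ φ x v = ∫ x, ρ x * (ζ x * fderiv ℝ φ x v) :=
    integral_congr_ae (Eventually.of_forall fun x => by ring)
  rw [e1, eq_sub_of_add_eq k1]
  have i3 := hρi (hφ.mul_left hζv.contDiff)
  have i4 := hGi (hφ.mul_left hζ.contDiff)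
  have i5 : Integrable fun x => (- fderiv ℝ ζ x v) * φ x :=
    (hφ.mul_left hζv.contDiff).integrable.neg.congr (Eventually.of_forall fun x => by simp)
  have i6 : Integrable fun x => ⟪G x, v⟫_ℝ * (ζ x * φ x) + ρ x * (fderiv ℝ ζ x v * φ x) := i4.add i3
  have e2 : ∫ x, ⟪ζ x • G x + (ρ x - 1) • g x, v⟫_ℝ * φ x =
      (∫ x, ⟪G x, v⟫_ℝ * (ζ x * φ x)) + (∫ x, ρ x * (fderiv ℝ ζ x v * φ x)) +
        ∫ x, (- fderiv ℝ ζ x v) * φ x := by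
    rw [← integral_add i4 i3, ← integral_add i6 i5]
    refine integral_congr_ae (Eventually.of_forall fun x => ?_)
    simp only [inner_add_left, inner_smul_left, hginner]
    simp
    ring
  rw [e2]
  ring

end Localization

/-! ### Local `H¹` regularity for the Kolmogorov equation. -/

section LocalRegularity

variable {N : ℕ} {ρ : Sp N → ℝ} {G : Sp N → Sp N}

/-- On a given ball the density coincides with a weight which is bounded from above and below and
whose logarithmic gradient is globally in `L^r`. -/
theorem HypothesisH1.exists_localWeight (hG : HasWeakGradient ρ G) (h1 : HypothesisH1 ρ G) {R : ℝ}
    (hR : 0 ≤ R) : ∃ (r : ℝ) (w : Sp N → ℝ) (H β : Sp N → Sp N) (δ M : ℝ), 2 ≤ r ∧ (N : ℝ) < r ∧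
      HasWeakGradient w H ∧ 0 < δ ∧ (∀ᵐ x, δ ≤ w x) ∧ (∀ᵐ x, w x ≤ M) ∧ (∀ᵐ x, H x = w x • β x) ∧
      MemLp β (ENNReal.ofReal r) ∧ ∀ x ∈ Metric.closedBall 0 (R + 2), w x = ρ x ∧
        β x = (ρ x)⁻¹ • G x := by
  obtain ⟨r, hr2, hNr, hr⟩ := h1.exists_exponent
  -- This cutoff is one on radius `R + 3` and zero outside radius `R + 4`. The weight `ζρ + 1 - ζ`
  -- and its logarithmic gradient therefore agree with those of `ρ` on radius `R + 2`, where the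
  -- next cutoff lives.
  obtain ⟨ζ, hζ, hζ0, hζ1, hζR, hζR'⟩ := exists_cutoff N (by linarith : 0 ≤ R + 2)
  set B := Metric.closedBall (0 : Sp N) (R + 2 + 2)
  have hB : IsCompact B := isCompact_closedBall _ _
  have hBm : MeasurableSet B := measurableSet_closedBall
  obtain ⟨δ, hδ, hδB⟩ := h1.locallyBoundedBelow B hB
  obtain ⟨M, hM⟩ := h1.exists_ae_le hG (R + 2 + 2)
  rw [ae_restrict_iff' hBm] at hδB hM
  set g : Sp N → Sp N := fun x => (InnerProductSpace.toDual ℝ (Sp N)).symm (fderiv ℝ ζ x)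
  set w : Sp N → ℝ := fun x => ζ x * ρ x + (1 - ζ x)
  set H : Sp N → Sp N := fun x => ζ x • G x + (ρ x - 1) • g x
  have hw : HasWeakGradient w H := hG.interpolate hζ
  have hgB : ∀ x, x ∉ B → g x = 0 := by
    intro x hx
    have h2 : ζ =ᶠ[𝓝 x] fun _ => 0 := by
      filter_upwards [Metric.isClosed_closedBall.isOpen_compl.mem_nhds hx] with y hy
      exact hζR' y hy
    simp only [g]
    rw [h2.fderiv_eq, fderiv_fun_const]
    simp
  have hgR : ∀ x ∈ Metric.closedBall 0 (R + 2), g x = 0 := by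
    intro x hx
    have h2 : ζ =ᶠ[𝓝 x] fun _ => 1 := by
      filter_upwards [Metric.isOpen_ball.mem_nhds (show x ∈ Metric.ball 0 (R + 2 + 1) from
        Metric.closedBall_subset_ball (by linarith) hx)] with y hy
      exact hζR y (Metric.ball_subset_closedBall hy)
    simp only [g]
    rw [h2.fderiv_eq, fderiv_fun_const]
    simp
  obtain ⟨C, hC⟩ := (hζ.hasCompactSupport.fderiv ℝ).exists_bound_of_continuous
    (hζ.contDiff.continuous_fderiv (by simp))
  have hgC : ∀ x, ‖g x‖ ≤ C := fun x => by
    simp only [g]; rw [LinearIsometryEquiv.norm_map]; exact hC x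
  have hC0 : 0 ≤ C := (norm_nonneg _).trans (hC 0)
  have hwδ : ∀ᵐ x, min δ 1 ≤ w x := by
    filter_upwards [hδB] with x hx
    by_cases hxB : x ∈ B
    · have h3 := hx hxB
      have h4 := min_le_left δ 1
      have h5 := min_le_right δ 1
      simp only [w]
      nlinarith [hζ0 x, hζ1 x]
    · simp only [w, hζR' x hxB]
      simp
  have hwM : ∀ᵐ x, w x ≤ max M 1 := by
    filter_upwards [hM] with x hx
    by_cases hxB : x ∈ B
    · have h3 := hx hxB
      have h4 := le_max_left M 1
      have h5 := le_max_right M 1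
      simp only [w]
      nlinarith [hζ0 x, hζ1 x]
    · simp only [w, hζR' x hxB]
      simp
  have hδ' : 0 < min δ 1 := lt_min hδ one_pos
  refine ⟨r, w, H, fun x => (w x)⁻¹ • H x, min δ 1, max M 1, hr2, hNr, hw, hδ', hwδ, hwM, ?_, ?_, ?_⟩
  · filter_upwards [hwδ] with x hx
    rw [smul_smul, mul_inv_cancel₀ (hδ'.trans_le hx).ne', one_smul]
  · have hm : AEStronglyMeasurable (fun x => (w x)⁻¹ • H x) :=
      hw.locallyIntegrable.aestronglyMeasurable.aemeasurable.inv.aestronglyMeasurable.smul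
        hw.locallyIntegrable_grad.aestronglyMeasurable
    have hβ : MemLp (B.indicator fun x => M * ‖(ρ x)⁻¹ • G x‖ + (M + 1) * C)
        (ENNReal.ofReal r) := by
      rw [memLp_indicator_iff_restrict hBm]
      have : IsFiniteMeasure (volume.restrict B) := isFiniteMeasure_restrict.2 hB.measure_ne_top
      exact ((hr B hB).norm.const_mul M).add (memLp_const _)
    refine hβ.of_le_mul (c := (min δ 1)⁻¹) hm ?_
    filter_upwards [hwδ, hδB, hM] with x h3 h4 h5
    by_cases hxB : x ∈ B
    · rw [Set.indicator_of_mem hxB, norm_smul, norm_inv, Real.norm_of_nonneg (hδ'.le.trans h3)]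
      have h6 := h4 hxB
      have h7 := h5 hxB
      -- The upper bound `ρ ≤ M` is used to control `G = ρ · (∇ρ/ρ)` by the logarithmic gradient.
      have h8 : ‖H x‖ ≤ M * ‖(ρ x)⁻¹ • G x‖ + (M + 1) * C := by
        refine (norm_add_le _ _).trans (add_le_add ?_ ?_)
        · rw [norm_smul, Real.norm_of_nonneg (hζ0 x)]
          have e : ‖G x‖ = ρ x * ‖(ρ x)⁻¹ • G x‖ := by
            rw [norm_smul, norm_inv, Real.norm_of_nonneg (hδ.le.trans h6), ← mul_assoc,
              mul_inv_cancel₀ (hδ.trans_le h6).ne', one_mul]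
          calc ζ x * ‖G x‖ ≤ 1 * ‖G x‖ := by gcongr; exact hζ1 x
            _ = ρ x * ‖(ρ x)⁻¹ • G x‖ := by rw [one_mul, e]
            _ ≤ _ := by gcongr
        · rw [norm_smul]
          refine mul_le_mul ?_ (hgC x) (norm_nonneg _) (by linarith)
          rw [Real.norm_eq_abs, abs_le]
          constructor <;> linarith
      calc (w x)⁻¹ * ‖H x‖ ≤ (min δ 1)⁻¹ * (M * ‖(ρ x)⁻¹ • G x‖ + (M + 1) * C) := by gcongr
        _ ≤ _ := by gcongr; exact le_abs_self _
    · rw [Set.indicator_of_notMem hxB]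
      simp only [H, hζR' x hxB, hgB x hxB]
      simp
  · intro x hx
    have h3 := hζR x (Metric.closedBall_subset_closedBall (by linarith) hx)
    simp [w, H, h3, hgR x hx]

/-- Square integrable weak solutions of the Kolmogorov equation are locally in `H¹`. -/
theorem HypothesisH1.exists_local_gradient (hG : HasWeakGradient ρ G) (h1 : HypothesisH1 ρ G)
    {a b : Sp N → ℝ} (ha : LocMemLp a 2) (hb : LocMemLp b 2)
    (hab : ∀ φ, IsTest φ → ∫ x, b x * ρ x * (lap φ x + fderiv ℝ φ x ((ρ x)⁻¹ • G x)) =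
      ∫ x, a x * ρ x * φ x) {R : ℝ} (hR : 0 ≤ R) :
    ∃ (u : Sp N → ℝ) (F : Sp N → Sp N), MemLp u 2 ∧ MemLp F 2 ∧ HasWeakGradient u F ∧
      (∀ x ∈ Metric.closedBall 0 (R + 1), u x = b x) ∧
      ∀ x, x ∉ Metric.closedBall 0 (R + 2) → u x = 0 := by
  obtain ⟨r, w, H, β, δ, M, hr2, hNr, hw, hδ, hwδ, hwM, hH, hβ, hloc⟩ := h1.exists_localWeight hG hR
  obtain ⟨χ, hχ, hχ0, hχ1, hχR, hχR'⟩ := exists_cutoff N hR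
  set B := Metric.closedBall (0 : Sp N) (R + 2)
  have hB : IsCompact B := isCompact_closedBall _ _
  have hBm : MeasurableSet B := measurableSet_closedBall
  have hwm : AEStronglyMeasurable w := hw.locallyIntegrable.aestronglyMeasurable
  have hM : 0 ≤ M := by
    obtain ⟨x, h1, h2⟩ := (hwδ.and hwM).exists
    linarith
  have hbdd : ∀ {f : Sp N → ℝ}, LocMemLp f 2 → ∀ {θ : Sp N → ℝ}, Continuous θ →
      (∀ x, x ∉ B → θ x = 0) → MemLp (fun x => f x * w x * θ x) 2 := by
    intro f hf θ hθ hθB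
    obtain ⟨C, hC⟩ := (HasCompactSupport.intro hB hθB).exists_bound_of_continuous hθ
    have hfB : MemLp (B.indicator f) 2 := (memLp_indicator_iff_restrict hBm).2 (hf B hB)
    have hm : AEStronglyMeasurable fun x => B.indicator f x * w x * θ x :=
      (hfB.1.mul hwm).mul hθ.aestronglyMeasurable
    have e : (fun x => f x * w x * θ x) = fun x => B.indicator f x * w x * θ x := by
      funext x
      by_cases hx : x ∈ B
      · rw [Set.indicator_of_mem hx]
      · rw [hθB x hx, mul_zero, mul_zero]
    rw [e]
    refine hfB.of_le_mul (c := M * C) hm ?_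
    filter_upwards [hwδ, hwM] with x h3 h4
    rw [norm_mul, norm_mul, Real.norm_of_nonneg (hδ.le.trans h3)]
    calc ‖B.indicator f x‖ * w x * ‖θ x‖ ≤ ‖B.indicator f x‖ * M * C := by
          gcongr
          exact hC x
      _ = _ := by ring
  have hu : MemLp (fun x => χ x * b x) 2 := by
    have hbB : MemLp (B.indicator b) 2 := (memLp_indicator_iff_restrict hBm).2 (hb B hB)
    have e : (fun x => χ x * b x) = fun x => χ x * B.indicator b x := by
      funext x
      by_cases hx : x ∈ B
      · rw [Set.indicator_of_mem hx]
      · rw [hχR' x hx, zero_mul, zero_mul]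
    rw [e]
    refine hbB.mono (hχ.continuous.aestronglyMeasurable.mul hbB.1) (Eventually.of_forall fun x => ?_)
    rw [norm_mul, Real.norm_of_nonneg (hχ0 x)]
    exact mul_le_of_le_one_left (norm_nonneg _) (hχ1 x)
  have hcl : IsClosed B := Metric.isClosed_closedBall
  have htsupp : tsupport χ ⊆ B := closure_minimal (fun x hx => by
    by_contra h
    exact hx (hχR' x h)) hcl
  have hdχ : ∀ x, x ∉ B → fderiv ℝ χ x = 0 := fun x hx =>
    image_eq_zero_of_notMem_tsupport fun h => hx (htsupp (tsupport_fderiv_subset ℝ h))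
  have hpχ : ∀ i x, x ∉ B → pd i χ x = 0 := fun i x hx => by simp only [pd]; rw [hdχ x hx]; rfl
  have hlχ : ∀ x, x ∉ B → lap χ x = 0 := by
    intro x hx
    refine Finset.sum_eq_zero fun i _ => ?_
    refine image_eq_zero_of_notMem_tsupport fun h => hx (htsupp ?_)
    exact tsupport_fderiv_apply_subset ℝ _ (tsupport_fderiv_apply_subset ℝ _ h)
  obtain ⟨C, hC0, hC⟩ := exists_integral_sq_mul_le hr2 hNr hβ (ε := 1) one_pos
  have hA := hbdd ha hχ.continuous hχR'
  have hL := hbdd hb hχ.lap.continuous hlχ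
  have hP := fun i => hbdd hb (hχ.pd i).continuous (hpχ i)
  have hD := hbdd hb (hχ.contDiff.continuous_fderiv (by simp)).norm
    (fun x hx => by rw [hdχ x hx, norm_zero])
  have hF : ∃ F : Sp N → Sp N, MemLp F 2 ∧ HasWeakGradient (fun x => χ x * b x) F := by
    -- The four summands of the constant come from the datum `a`, from `b Δχ`, from the drift
    -- falling on `χ`, and from the cross term `2 b ∇χ · ∇φ`. The third requires the form bound for
    -- `|β| φ`, hence the factor `√(C + 1)`.
    refine exists_hasWeakGradient_of_le_energy hw hδ hwδ hwM hH hr2 hNr hβ hu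
      (C := l2 volume (fun x => a x * w x * χ x) + l2 volume (fun x => b x * w x * lap χ x) +
        l2 volume (fun x => b x * w x * ‖fderiv ℝ χ x‖) * √(C + 1) +
        2 * ∑ i, l2 volume (fun x => b x * w x * pd i χ x)) fun φ hφ => ?_
    have hχφ := hφ.mul_left hχ.contDiff
    have hbφ : ∫ x, (‖β x‖ * φ x) ^ 2 ≤ (C + 1) * energy φ := by
      refine (hC φ hφ).2.trans ?_
      have h4 : (0 : ℝ) ≤ ∑ i, ∫ x, pd i φ x ^ 2 :=
        Finset.sum_nonneg fun i _ => integral_nonneg fun x => sq_nonneg _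
      have h5 : (0 : ℝ) ≤ ∫ x, φ x ^ 2 := integral_nonneg fun x => sq_nonneg _
      rw [energy]
      nlinarith [mul_nonneg hC0 h4]
    have hb4 : l2 volume (fun x => ‖β x‖ * φ x) ≤ √(C + 1) * √(energy φ) := by
      rw [← Real.sqrt_mul (by positivity)]
      exact Real.sqrt_le_sqrt hbφ
    have hm4 : AEStronglyMeasurable fun x => b x * w x * (φ x * fderiv ℝ χ x (β x)) := by
      have hbB : MemLp (B.indicator b) 2 := (memLp_indicator_iff_restrict hBm).2 (hb B hB)
      have e : (fun x => b x * w x * (φ x * fderiv ℝ χ x (β x))) =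
          fun x => B.indicator b x * w x * (φ x * fderiv ℝ χ x (β x)) := by
        funext x
        by_cases hx : x ∈ B
        · rw [Set.indicator_of_mem hx]
        · rw [hdχ x hx]; simp
      rw [e]
      exact (hbB.1.mul hwm).mul (hφ.continuous.aestronglyMeasurable.mul
        (isBoundedBilinearMap_apply.continuous.comp_aestronglyMeasurable
        ((hχ.contDiff.continuous_fderiv (by simp)).aestronglyMeasurable.prodMk hβ.1)))
    have hb5 : ∀ x, ‖b x * w x * (φ x * fderiv ℝ χ x (β x))‖ ≤
        ‖b x * w x * ‖fderiv ℝ χ x‖ * (‖β x‖ * φ x)‖ := by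
      intro x
      have := (fderiv ℝ χ x).le_opNorm (β x)
      simp only [norm_mul, norm_norm]
      calc ‖b x‖ * ‖w x‖ * (‖φ x‖ * ‖fderiv ℝ χ x (β x)‖) ≤
          ‖b x‖ * ‖w x‖ * (‖φ x‖ * (‖fderiv ℝ χ x‖ * ‖β x‖)) := by gcongr
        _ = _ := by ring
    have j4 : Integrable fun x => b x * w x * ‖fderiv ℝ χ x‖ * (‖β x‖ * φ x) :=
      hD.integrable_mul (hC φ hφ).1
    have i2 : Integrable fun x => b x * w x * lap χ x * φ x := hL.integrable_mul (hφ.memLp 2)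
    have i3 : ∀ i, Integrable fun x => b x * w x * pd i χ x * pd i φ x := fun i =>
      (hP i).integrable_mul ((hφ.pd i).memLp 2)
    have i4 : Integrable fun x => b x * w x * (φ x * fderiv ℝ χ x (β x)) :=
      j4.mono hm4 (Eventually.of_forall hb5)
    have hX := hbdd hb hχ.continuous hχR'
    have i5 : ∀ i, Integrable fun x => b x * w x * χ x * (β x i * pd i φ x) := by
      intro i
      have j5 : Integrable fun x => b x * w x * χ x * (‖β x‖ * pd i φ x) :=
        hX.integrable_mul (hC _ (hφ.pd i)).1
      refine j5.mono (hX.1.mul (((EuclideanSpace.proj (𝕜 := ℝ) i).continuous.comp_aestronglyMeasurable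
        hβ.1).mul (hφ.pd i).continuous.aestronglyMeasurable)) (Eventually.of_forall fun x => ?_)
      simp only [norm_mul, norm_norm]
      gcongr
      exact PiLp.norm_apply_le _ _
    have i6 : Integrable fun x => b x * w x * χ x * lap φ x := hX.integrable_mul (hφ.lap.memLp 2)
    have i0 : Integrable fun x => χ x * b x * w x * (lap φ x + fderiv ℝ φ x (β x)) := by
      refine (i6.add (integrable_finsetSum Finset.univ fun i _ => i5 i)).congr
        (Eventually.of_forall fun x => ?_)
      simp only [Pi.add_apply]
      rw [fderiv_apply_eq_sum, ← Finset.mul_sum]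
      ring
    have i3' : Integrable fun x => 2 * ∑ i, b x * w x * pd i χ x * pd i φ x :=
      (integrable_finsetSum _ fun i _ => i3 i).const_mul 2
    set I := fun x => b x * w x *
      (lap (fun y => χ y * φ y) x + fderiv ℝ (fun y => χ y * φ y) x (β x))
    have hdf : ∀ x v, fderiv ℝ (fun y => χ y * φ y) x v =
        χ x * fderiv ℝ φ x v + φ x * fderiv ℝ χ x v := by
      intro x v
      rw [fderiv_fun_mul (hχ.differentiable x) (hφ.differentiable x)]
      simp
    -- Moving `χ` from the solution to the test function costs the commutator of the operator with
    -- multiplication by `χ`, which has order one.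
    have eI : ∀ x, χ x * b x * w x * (lap φ x + fderiv ℝ φ x (β x)) = I x -
        (b x * w x * lap χ x * φ x + 2 * (∑ i, b x * w x * pd i χ x * pd i φ x) +
          b x * w x * (φ x * fderiv ℝ χ x (β x))) := by
      intro x
      simp only [I, lap_mul hχ.contDiff hφ.contDiff, hdf, mul_assoc]
      rw [← Finset.mul_sum, ← Finset.mul_sum]
      ring
    have i24 : Integrable fun x => b x * w x * lap χ x * φ x +
        2 * (∑ i, b x * w x * pd i χ x * pd i φ x) + b x * w x * (φ x * fderiv ℝ χ x (β x)) :=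
      (i2.add i3').add i4
    have i23 : Integrable fun x => b x * w x * lap χ x * φ x +
        2 * (∑ i, b x * w x * pd i χ x * pd i φ x) := i2.add i3'
    have i1 : Integrable I := (i0.add i24).congr (Eventually.of_forall fun x => by
      simp only [Pi.add_apply]
      rw [eI]
      ring)
    -- The equation for `b` is tested with `χφ`; on the support of `χ` the modified weight and drift
    -- are the original ones.
    have hI : ∫ x, I x = ∫ x, a x * w x * χ x * φ x := by
      have h3 := hab _ hχφ
      have e1 : ∫ x, I x = ∫ x, b x * ρ x * (lap (fun y => χ y * φ y) x +
          fderiv ℝ (fun y => χ y * φ y) x ((ρ x)⁻¹ • G x)) := by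
        refine integral_congr_ae (Eventually.of_forall fun x => ?_)
        simp only [I]
        by_cases hx : x ∈ B
        · rw [(hloc x hx).1, (hloc x hx).2]
        · simp only [lap_mul hχ.contDiff hφ.contDiff, hdf, hχR' x hx, hdχ x hx, hlχ x hx,
            hpχ _ x hx]
          simp
      rw [e1, h3]
      refine integral_congr_ae (Eventually.of_forall fun x => ?_)
      by_cases hx : x ∈ B
      · simp only [(hloc x hx).1]
        ring
      · simp only [hχR' x hx]
        ring
    have e : ∫ x, χ x * b x * w x * (lap φ x + fderiv ℝ φ x (β x)) =
        (∫ x, a x * w x * χ x * φ x) - ((∫ x, b x * w x * lap χ x * φ x) +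
          2 * (∑ i, ∫ x, b x * w x * pd i χ x * pd i φ x) +
          ∫ x, b x * w x * (φ x * fderiv ℝ χ x (β x))) := by
      rw [← hI, ← integral_finsetSum _ fun i _ => i3 i, ← integral_const_mul,
        ← integral_add i2 i3', ← integral_add i23 i4, ← integral_sub i1 i24]
      exact integral_congr_ae (Eventually.of_forall eI)
    have hEl := l2_le_sqrt_energy φ
    have t1 : |∫ x, a x * w x * χ x * φ x| ≤ l2 volume (fun x => a x * w x * χ x) * √(energy φ) :=
      (abs_integral_mul_le hA (hφ.memLp 2)).trans (mul_le_mul_of_nonneg_left hEl (l2_nonneg _))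
    have t2 : |∫ x, b x * w x * lap χ x * φ x| ≤
        l2 volume (fun x => b x * w x * lap χ x) * √(energy φ) :=
      (abs_integral_mul_le hL (hφ.memLp 2)).trans (mul_le_mul_of_nonneg_left hEl (l2_nonneg _))
    have t3 : |∑ i, ∫ x, b x * w x * pd i χ x * pd i φ x| ≤
        (∑ i, l2 volume (fun x => b x * w x * pd i χ x)) * √(energy φ) := by
      rw [Finset.sum_mul]
      refine (Finset.abs_sum_le_sum_abs _ _).trans (Finset.sum_le_sum fun i _ => ?_)
      exact (abs_integral_mul_le (hP i) ((hφ.pd i).memLp 2)).trans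
        (mul_le_mul_of_nonneg_left (l2_pd_le_sqrt_energy φ i) (l2_nonneg _))
    have t4 : |∫ x, b x * w x * (φ x * fderiv ℝ χ x (β x))| ≤
        l2 volume (fun x => b x * w x * ‖fderiv ℝ χ x‖) * √(C + 1) * √(energy φ) := by
      have e4 : ∀ x, ‖b x * w x * ‖fderiv ℝ χ x‖ * (‖β x‖ * φ x)‖ =
          |b x * w x * ‖fderiv ℝ χ x‖| * |(‖β x‖ * φ x)| := fun x => by
        rw [norm_mul]; rfl
      calc |∫ x, b x * w x * (φ x * fderiv ℝ χ x (β x))|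
          ≤ ∫ x, ‖b x * w x * ‖fderiv ℝ χ x‖ * (‖β x‖ * φ x)‖ :=
            (norm_integral_le_integral_norm _).trans
              (integral_mono i4.norm j4.norm hb5)
        _ ≤ l2 volume (fun x => |b x * w x * ‖fderiv ℝ χ x‖|) *
            l2 volume (fun x => |(‖β x‖ * φ x)|) := by
            simp only [e4]
            exact (le_abs_self _).trans (abs_integral_mul_le hD.norm (hC φ hφ).1.norm)
        _ = l2 volume (fun x => b x * w x * ‖fderiv ℝ χ x‖) *
            l2 volume (fun x => ‖β x‖ * φ x) := by
            simp only [l2, sq_abs]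
        _ ≤ _ := by
            rw [mul_assoc]
            exact mul_le_mul_of_nonneg_left hb4 (l2_nonneg _)
    rw [e, add_mul, add_mul, add_mul]
    rw [abs_le] at t1 t2 t3 t4 ⊢
    constructor <;> linarith [t1.1, t1.2, t2.1, t2.2, t3.1, t3.2, t4.1, t4.2]
  obtain ⟨F, hF, hF'⟩ := hF
  refine ⟨_, F, hu, hF, hF', fun x hx => by rw [hχR x hx, one_mul],
    fun x hx => by rw [hχR' x hx, zero_mul]⟩

end LocalRegularity

/-! ### The weak equation in terms of first derivatives. -/

section GlobalEnergy

open scoped Convolution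

variable {N : ℕ} {ρ : Sp N → ℝ} {G : Sp N → Sp N}

theorem mollify_eq_smear (n : ℕ) (u : Sp N → ℝ) : mollify n u = smear (mollifier N n) u := rfl

theorem isTest_mollifier (N n : ℕ) : IsTest (mollifier N n) :=
  ⟨contDiff_mollifier n, hasCompactSupport_mollifier n⟩

/-- Mollifications converge in `L²`. -/
theorem tendsto_l2_mollify_sub {u : Sp N → ℝ} (hu : MemLp u 2) :
    Tendsto (fun n => l2 volume (fun x => mollify n u x - u x)) atTop (𝓝 0) := by
  have hl : LocallyIntegrable u := hu.locallyIntegrable (by norm_num)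
  have hm : ∀ n, MemLp (mollify n u) 2 := fun n => (isTest_mollifier N n).memLp_smear hu
  have hle : ∀ n, ∫ x, mollify n u x ^ 2 ≤ ∫ x, u x ^ 2 := by
    intro n
    have h1 := lintegral_enorm_smear_sq_le (isTest_mollifier N n) hu.1
    rw [lintegral_enorm_mollifier, one_pow, one_mul, ← mollify_eq_smear,
      lintegral_enorm_sq_eq (hm n), lintegral_enorm_sq_eq hu] at h1
    simp only [Real.norm_eq_abs, sq_abs] at h1
    exact (ENNReal.ofReal_le_ofReal_iff (integral_nonneg fun _ => sq_nonneg _)).1 h1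
  set I := ∫ x, u x ^ 2
  have hI : 0 ≤ I := integral_nonneg fun _ => sq_nonneg _
  have hms : ∀ n, MemLp (fun x => mollify n u x + u x) 2 := fun n => (hm n).add hu
  have hmd : ∀ n, MemLp (fun x => mollify n u x - u x) 2 := fun n => (hm n).sub hu
  -- Fatou for `‖u_n + u‖²`, with `u_n` the mollifications; together with `‖u_n‖ ≤ ‖u‖` and the
  -- parallelogram law it forces `‖u_n - u‖² → 0`.
  have hfatou : ENNReal.ofReal (4 * I) ≤
      liminf (fun n => ∫⁻ x, ‖mollify n u x + u x‖ₑ ^ 2) atTop := by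
    have h1 := lintegral_liminf_le' (μ := volume)
      (f := fun n x => ‖mollify n u x + u x‖ₑ ^ 2) (u := atTop)
      fun n => (hms n).1.enorm.pow_const 2
    refine le_trans (le_of_eq ?_) h1
    have h2 : ∫⁻ x, ‖(2 * u x)‖ₑ ^ 2 = ENNReal.ofReal (4 * I) := by
      rw [lintegral_enorm_sq_eq (hu.const_mul 2), ← integral_const_mul]
      congr 1
      refine integral_congr_ae (Eventually.of_forall fun x => ?_)
      simp only [Real.norm_eq_abs, sq_abs]
      ring
    rw [← h2]
    refine lintegral_congr_ae ?_
    filter_upwards [ae_tendsto_mollify hl] with x hx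
    have h3 : Tendsto (fun n => ‖mollify n u x + u x‖ₑ ^ 2) atTop (𝓝 (‖2 * u x‖ₑ ^ 2)) := by
      rw [two_mul]
      exact ENNReal.Tendsto.pow (hx.add_const _).enorm
    exact h3.liminf_eq.symm
  have hsq : Tendsto (fun n => ∫ x, (mollify n u x - u x) ^ 2) atTop (𝓝 0) := by
    refine tendsto_order.2 ⟨fun a ha => Eventually.of_forall fun n =>
      ha.trans_le (integral_nonneg fun _ => sq_nonneg _), fun ε hε => ?_⟩
    have hpar : ∀ n, ∫ x, (mollify n u x - u x) ^ 2 ≤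
        4 * I - ∫ x, (mollify n u x + u x) ^ 2 := by
      intro n
      have h1 : (∫ x, (mollify n u x - u x) ^ 2) + ∫ x, (mollify n u x + u x) ^ 2 =
          2 * (∫ x, mollify n u x ^ 2) + 2 * I := by
        rw [← integral_add (hmd n).integrable_sq (hms n).integrable_sq, ← integral_const_mul,
          ← integral_const_mul, ← integral_add ((hm n).integrable_sq.const_mul 2)
          (hu.integrable_sq.const_mul 2)]
        exact integral_congr_ae (Eventually.of_forall fun x => by ring)
      linarith [hle n]
    rcases lt_or_ge (4 * I) ε with h4 | h4
    · refine Eventually.of_forall fun n => (hpar n).trans_lt ?_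
      have : (0 : ℝ) ≤ ∫ x, (mollify n u x + u x) ^ 2 := integral_nonneg fun _ => sq_nonneg _
      linarith
    · rcases hI.eq_or_lt with h0 | h0
      · linarith
      have h5 : ENNReal.ofReal (4 * I - ε) < ENNReal.ofReal (4 * I) :=
        (ENNReal.ofReal_lt_ofReal_iff (by linarith)).2 (by linarith)
      filter_upwards [eventually_lt_of_lt_liminf (h5.trans_le hfatou)] with n hn
      rw [lintegral_enorm_sq_eq (hms n)] at hn
      simp only [Real.norm_eq_abs, sq_abs] at hn
      have h6 := (ENNReal.ofReal_lt_ofReal_iff_of_nonneg (by linarith)).1 hn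
      linarith [hpar n]
  have := hsq.sqrt
  rwa [Real.sqrt_zero] at this

theorem pd_mollify {u : Sp N → ℝ} {F : Sp N → Sp N} (h : HasWeakGradient u F) (n : ℕ) (i : Fin N) :
    pd i (mollify n u) = mollify n fun x => F x i := by
  funext x
  simp only [pd]
  rw [fderiv_mollify h, innerSL_apply_apply, EuclideanSpace.inner_single_right, mollify_apply,
    mollify_apply]
  have := ((EuclideanSpace.proj (𝕜 := ℝ) i).integral_comp_comm
    (integrable_mollifier_smul n h.locallyIntegrable_grad x))
  simp at this ⊢
  exact this.symm

theorem tendsto_integral_mul_of_l2 {α : Type*} [MeasurableSpace α] {μ : Measure α}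
    {f : ℕ → α → ℝ} {f' g : α → ℝ} (hf : ∀ n, MemLp (f n) 2 μ) (hf' : MemLp f' 2 μ)
    (hg : MemLp g 2 μ) (h : Tendsto (fun n => l2 μ (fun x => f n x - f' x)) atTop (𝓝 0)) :
    Tendsto (fun n => ∫ x, f n x * g x ∂μ) atTop (𝓝 (∫ x, f' x * g x ∂μ)) := by
  rw [tendsto_iff_dist_tendsto_zero]
  have h1 := h.mul_const (l2 μ g)
  rw [zero_mul] at h1
  refine tendsto_of_tendsto_of_tendsto_of_le_of_le tendsto_const_nhds h1 (fun _ => dist_nonneg)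
    fun n => ?_
  have i1 : Integrable (fun x => f n x * g x) μ := (hf n).integrable_mul hg
  have i2 : Integrable (fun x => f' x * g x) μ := hf'.integrable_mul hg
  simp only [Real.dist_eq]
  rw [← integral_sub i1 i2]
  simp only [← sub_mul]
  exact abs_integral_mul_le ((hf n).sub hf') hg

theorem MemLp.eval_euclidean {F : Sp N → Sp N} {p : ℝ≥0∞} {μ : Measure (Sp N)} (hF : MemLp F p μ)
    (i : Fin N) : MemLp (fun x => F x i) p μ :=
  hF.mono ((EuclideanSpace.proj (𝕜 := ℝ) i).continuous.comp_aestronglyMeasurable hF.1)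
    (Eventually.of_forall fun _ => PiLp.norm_apply_le _ _)

theorem LocMemLp.memLp_mul {f : Sp N → ℝ} {p : ℝ≥0∞} (hf : LocMemLp f p) {θ : Sp N → ℝ}
    (hθ : Continuous θ) (hs : HasCompactSupport θ) : MemLp (fun x => f x * θ x) p := by
  obtain ⟨C, hC⟩ := hs.exists_bound_of_continuous hθ
  have hB : MeasurableSet (tsupport θ) := (isClosed_tsupport θ).measurableSet
  have h1 : MemLp ((tsupport θ).indicator f) p :=
    (memLp_indicator_iff_restrict hB).2 (hf _ hs.isCompact)
  have e : (fun x => f x * θ x) = fun x => (tsupport θ).indicator f x * θ x := by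
    funext x
    by_cases hx : x ∈ tsupport θ
    · rw [Set.indicator_of_mem hx]
    · rw [image_eq_zero_of_notMem_tsupport hx, mul_zero, mul_zero]
  rw [e]
  refine h1.of_le_mul (c := C) (h1.1.mul hθ.aestronglyMeasurable) (Eventually.of_forall fun x => ?_)
  rw [norm_mul, mul_comm]
  gcongr
  exact hC x

/-- The local upper bound of the density makes `ρθ` a bounded multiplier. -/
theorem HypothesisH1.memLp_mul (hG : HasWeakGradient ρ G) (h1 : HypothesisH1 ρ G) {f : Sp N → ℝ}
    (hf : LocMemLp f 2) {θ : Sp N → ℝ} (hθ : Continuous θ) (hs : HasCompactSupport θ) :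
    MemLp (fun x => ρ x * θ x * f x) 2 := by
  obtain ⟨R, hR⟩ := hs.isCompact.isBounded.subset_closedBall 0
  obtain ⟨M, hM⟩ := h1.exists_ae_le hG R
  rw [ae_restrict_iff' measurableSet_closedBall] at hM
  have h2 := hf.memLp_mul hθ hs
  refine h2.of_le_mul (c := M) ((h2.1.mul hG.locallyIntegrable.aestronglyMeasurable).congr
    (Eventually.of_forall fun x => ?_)) ?_
  · simp only [Pi.mul_apply]; ring
  · filter_upwards [hM, h1.ae_pos] with x h3 h4
    by_cases hx : θ x = 0
    · rw [hx]; simp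
    · have h5 := h3 (hR (subset_tsupport _ hx))
      rw [norm_mul, norm_mul, norm_mul, Real.norm_of_nonneg h4.le]
      calc ρ x * ‖θ x‖ * ‖f x‖ = ρ x * (‖f x‖ * ‖θ x‖) := by ring
        _ ≤ _ := by gcongr

theorem MemLp.locMemLp {F : Type*} [NormedAddCommGroup F] {f : Sp N → F} {p : ℝ≥0∞}
    (hf : MemLp f p) : LocMemLp f p :=
  fun _ _ => hf.restrict _

/-- The weak formulation of the Kolmogorov equation tested with first derivatives only. -/
theorem HypothesisH1.integral_gradient_eq (hG : HasWeakGradient ρ G) (h1 : HypothesisH1 ρ G)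
    {a b u : Sp N → ℝ} {F : Sp N → Sp N} {B : Set (Sp N)} (hu : MemLp u 2) (hF : MemLp F 2)
    (huF : HasWeakGradient u F) (hub : ∀ x ∈ B, u x = b x)
    (hab : ∀ φ, IsTest φ → ∫ x, b x * ρ x * (lap φ x + fderiv ℝ φ x ((ρ x)⁻¹ • G x)) =
      ∫ x, a x * ρ x * φ x) {φ : Sp N → ℝ} (hφ : IsTest φ) (hφB : tsupport φ ⊆ B) :
    ∫ x, a x * ρ x * φ x = - ∑ i, ∫ x, F x i * (ρ x * pd i φ x) := by
  have hgi : ∀ i, MemLp (fun x => ρ x * pd i φ x) 2 := fun i =>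
    h1.locMemLp.memLp_mul (hφ.pd i).continuous (hφ.pd i).hasCompactSupport
  have hg : MemLp (fun x => ρ x * lap φ x + fderiv ℝ φ x (G x)) 2 := by
    refine (h1.locMemLp.memLp_mul hφ.lap.continuous hφ.lap.hasCompactSupport).add ?_
    simp only [fderiv_apply_eq_sum φ]
    exact memLp_finsetSum _ fun i _ => LocMemLp.memLp_mul
      (fun K hK => MemLp.eval_euclidean (h1.locMemLp_grad K hK) i) (hφ.pd i).continuous
      (hφ.pd i).hasCompactSupport
  have hm : ∀ n, MemLp (mollify n u) 2 := fun n => (isTest_mollifier N n).memLp_smear hu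
  have hmi : ∀ n i, MemLp (mollify n fun x => F x i) 2 := fun n i =>
    (isTest_mollifier N n).memLp_smear (MemLp.eval_euclidean hF i)
  have t1 := tendsto_integral_mul_of_l2 hm hu hg (tendsto_l2_mollify_sub hu)
  have t2 : Tendsto (fun n => - ∑ i, ∫ x, mollify n (fun x => F x i) x * (ρ x * pd i φ x)) atTop
      (𝓝 (- ∑ i, ∫ x, F x i * (ρ x * pd i φ x))) :=
    (tendsto_finsetSum _ fun i _ => tendsto_integral_mul_of_l2 (fun n => hmi n i)
      (MemLp.eval_euclidean hF i) (hgi i)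
      (tendsto_l2_mollify_sub (MemLp.eval_euclidean hF i))).neg
  -- For the smooth function `mollify n u`, integration by parts needs only the weak gradient of
  -- `ρ`. Both sides pass to the limit in `L²`, using `ρ, G ∈ L²_loc`.
  have e : ∀ n, ∫ x, mollify n u x * (ρ x * lap φ x + fderiv ℝ φ x (G x)) =
      - ∑ i, ∫ x, mollify n (fun x => F x i) x * (ρ x * pd i φ x) := by
    intro n
    have h3 := hG.integral_mul_lap_add hφ (contDiff_mollify n huF.locallyIntegrable)
    simp only [pd_mollify huF] at h3
    have i1 : ∀ i, Integrable fun x => mollify n (fun x => F x i) x * (ρ x * pd i φ x) :=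
      fun i => (hmi n i).integrable_mul (hgi i)
    rw [← integral_finsetSum _ fun i _ => i1 i]
    calc _ = _ := integral_congr_ae (Eventually.of_forall fun x => by ring)
      _ = _ := h3
      _ = _ := by
        congr 1
        refine integral_congr_ae (Eventually.of_forall fun x => ?_)
        simp only [Finset.mul_sum]
        exact Finset.sum_congr rfl fun i _ => by ring
  simp only [e] at t1
  rw [tendsto_nhds_unique t2 t1, ← hab φ hφ]
  refine integral_congr_ae ?_
  filter_upwards [h1.ae_pos] with x hx
  by_cases hxφ : x ∈ tsupport φ
  · rw [hub x (hφB hxφ), map_smul, smul_eq_mul]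
    field_simp
  · have k1 : fderiv ℝ φ x = 0 := image_eq_zero_of_notMem_tsupport fun h =>
      hxφ (tsupport_fderiv_subset ℝ h)
    have k2 : lap φ x = 0 := by
      refine Finset.sum_eq_zero fun i _ => image_eq_zero_of_notMem_tsupport fun h => hxφ ?_
      exact tsupport_fderiv_apply_subset ℝ _ (tsupport_fderiv_apply_subset ℝ _ h)
    simp [k1, k2]

end GlobalEnergy

/-! ### Caccioppoli estimate, and vanishing mean of the datum. -/

section MeanZero

variable {N : ℕ} {ρ : Sp N → ℝ} {G : Sp N → Sp N}

theorem abs_sum_two_mul_le {ι : Type*} [Fintype ι] {r b e c : ℝ} (hr : 0 ≤ r) {p f : ι → ℝ}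
    (hp : ∑ i, p i ^ 2 ≤ c ^ 2) :
    |2 * ∑ i, b * (r * (e * p i) * f i)| ≤
      1 / 2 * (∑ i, f i * (r * (e * e) * f i)) + 2 * c ^ 2 * (b ^ 2 * r) := by
  rw [Finset.mul_sum]
  calc |∑ i, 2 * (b * (r * (e * p i) * f i))|
      ≤ ∑ i, |2 * (b * (r * (e * p i) * f i))| := Finset.abs_sum_le_sum_abs _ _
    _ ≤ ∑ i, (1 / 2 * (f i * (r * (e * e) * f i)) + 2 * (b ^ 2 * r) * p i ^ 2) := by
        refine Finset.sum_le_sum fun i _ => ?_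
        rw [abs_le]
        have h5 := mul_nonneg hr (sq_nonneg (e * f i - 2 * (b * p i)))
        have h6 := mul_nonneg hr (sq_nonneg (e * f i + 2 * (b * p i)))
        constructor <;> nlinarith
    _ = 1 / 2 * (∑ i, f i * (r * (e * e) * f i)) + 2 * (b ^ 2 * r) * ∑ i, p i ^ 2 := by
        rw [Finset.sum_add_distrib, ← Finset.mul_sum, ← Finset.mul_sum]
    _ ≤ 1 / 2 * (∑ i, f i * (r * (e * e) * f i)) + 2 * (b ^ 2 * r) * c ^ 2 := by gcongr
    _ = _ := by ring

theorem abs_sum_two_mul_le' {ι : Type*} [Fintype ι] {r e c : ℝ} (hr : 0 ≤ r) (hc : 0 < c)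
    {p f : ι → ℝ} (hp : ∑ i, p i ^ 2 ≤ c ^ 2) :
    |2 * ∑ i, f i * (r * (e * p i))| ≤ c * (∑ i, f i * (r * (e * e) * f i)) + c * r := by
  rw [Finset.mul_sum]
  calc |∑ i, 2 * (f i * (r * (e * p i)))|
      ≤ ∑ i, |2 * (f i * (r * (e * p i)))| := Finset.abs_sum_le_sum_abs _ _
    _ ≤ ∑ i, (c * (f i * (r * (e * e) * f i)) + c⁻¹ * r * p i ^ 2) := by
        refine Finset.sum_le_sum fun i _ => ?_
        rw [abs_le]
        have h5 := mul_nonneg (mul_nonneg (inv_pos.2 hc).le hr) (sq_nonneg (c * (e * f i) - p i))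
        have h6 := mul_nonneg (mul_nonneg (inv_pos.2 hc).le hr) (sq_nonneg (c * (e * f i) + p i))
        have e5 : c⁻¹ * r * (c * (e * f i) - p i) ^ 2 =
            c * (f i * (r * (e * e) * f i)) + c⁻¹ * r * p i ^ 2 - 2 * (f i * (r * (e * p i))) := by
          field_simp
          ring
        have e6 : c⁻¹ * r * (c * (e * f i) + p i) ^ 2 =
            c * (f i * (r * (e * e) * f i)) + c⁻¹ * r * p i ^ 2 + 2 * (f i * (r * (e * p i))) := by
          field_simp
          ring
        constructor <;> linarith
    _ = c * (∑ i, f i * (r * (e * e) * f i)) + c⁻¹ * r * ∑ i, p i ^ 2 := by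
        rw [Finset.sum_add_distrib, ← Finset.mul_sum, ← Finset.mul_sum]
    _ ≤ c * (∑ i, f i * (r * (e * e) * f i)) + c⁻¹ * r * c ^ 2 := by gcongr
    _ = _ := by
        congr 1
        field_simp

set_option maxHeartbeats 1000000 in
-- Test the equation twice. With `bη²` it bounds the energy `X = ∫ η² |∇b|² dμ` by the norms of `a`
-- and `b`; with `η²` it gives `∫ aη² dμ = -2 ∫ η ∇b · ∇η dμ`, at most `cX + c` because `μ` has mass
-- one. The factor `c`, the size of `∇η`, is the gain.
theorem HypothesisH1.abs_integral_mul_sq_le (hG : HasWeakGradient ρ G) (h1 : HypothesisH1 ρ G)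
    (hρ : IsProbDensity ρ) {a b : Sp N → ℝ} (ha : LocMemLp a 2) (hb : LocMemLp b 2)
    (ha2 : Integrable fun x => a x ^ 2 * ρ x) (hb2 : Integrable fun x => b x ^ 2 * ρ x)
    (hab : ∀ φ, IsTest φ → ∫ x, b x * ρ x * (lap φ x + fderiv ℝ φ x ((ρ x)⁻¹ • G x)) =
      ∫ x, a x * ρ x * φ x) {η : Sp N → ℝ} (hη : IsTest η) (hη1 : ∀ x, |η x| ≤ 1) {c : ℝ}
    (hc : 0 < c) (hηc : ∀ x, ‖fderiv ℝ η x‖ ≤ c) :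
    |∫ x, a x * ρ x * η x ^ 2| ≤ c * (4 * c ^ 2 * (∫ x, b x ^ 2 * ρ x) +
      (∫ x, a x ^ 2 * ρ x) + (∫ x, b x ^ 2 * ρ x) + 1) := by
  obtain ⟨R, hR0, hR⟩ := hη.hasCompactSupport.isCompact.isBounded.subset_closedBall_lt 0 0
  obtain ⟨u, F, hu, hF, huF, hub, -⟩ := h1.exists_local_gradient hG ha hb hab hR0.le
  have hRB : tsupport η ⊆ Metric.closedBall 0 (R + 1) :=
    hR.trans (Metric.closedBall_subset_closedBall (by linarith))
  have hFi := fun i => MemLp.eval_euclidean hF i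
  have hρ0 := h1.ae_pos
  have hη0 : ∀ x, u x * η x = b x * η x := by
    intro x
    by_cases hx : x ∈ tsupport η
    · rw [hub x (hRB hx)]
    · rw [image_eq_zero_of_notMem_tsupport hx, mul_zero, mul_zero]
  have hw := fun {f : Sp N → ℝ} (hf : MemLp f 2) {θ : Sp N → ℝ} (hθ : IsTest θ) =>
    h1.memLp_mul hG (MemLp.locMemLp hf) hθ.continuous hθ.hasCompactSupport
  have hηη : IsTest fun x => η x * η x := hη.mul_left hη.contDiff
  have hηp : ∀ i, IsTest fun x => η x * pd i η x := fun i => (hη.pd i).mul_left hη.contDiff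
  have hm : ∀ n, MemLp (mollify n u) 2 := fun n => (isTest_mollifier N n).memLp_smear hu
  have hmi : ∀ n i, MemLp (mollify n fun x => F x i) 2 := fun n i =>
    (isTest_mollifier N n).memLp_smear (hFi i)
  -- integrability of the terms in the energy identity
  have iX : ∀ i, Integrable fun x => F x i * (ρ x * (η x * η x) * F x i) := fun i =>
    (hFi i).integrable_mul (hw (hFi i) hηη)
  have iY : ∀ i, Integrable fun x => u x * (ρ x * (η x * pd i η x) * F x i) := fun i =>
    hu.integrable_mul (hw (hFi i) (hηp i))
  have hwa : MemLp (fun x => ρ x * (η x * η x) * a x) 2 :=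
    h1.memLp_mul hG ha hηη.continuous hηη.hasCompactSupport
  have iA : Integrable fun x => u x * (ρ x * (η x * η x) * a x) := hu.integrable_mul hwa
  -- `uη²` need not be smooth, so the test function is `mollify n u · η²` and `n → ∞`.
  have energy_id : ∫ x, u x * (ρ x * (η x * η x) * a x) =
      - ∑ i, ((∫ x, F x i * (ρ x * (η x * η x) * F x i)) +
        2 * ∫ x, u x * (ρ x * (η x * pd i η x) * F x i)) := by
    have t1 := tendsto_integral_mul_of_l2 hm hu hwa (tendsto_l2_mollify_sub hu)
    have t2 : Tendsto (fun n => - ∑ i,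
        ((∫ x, mollify n (fun x => F x i) x * (ρ x * (η x * η x) * F x i)) +
          2 * ∫ x, mollify n u x * (ρ x * (η x * pd i η x) * F x i))) atTop
        (𝓝 (- ∑ i, ((∫ x, F x i * (ρ x * (η x * η x) * F x i)) +
          2 * ∫ x, u x * (ρ x * (η x * pd i η x) * F x i)))) :=
      (tendsto_finsetSum _ fun i _ => (tendsto_integral_mul_of_l2 (fun n => hmi n i) (hFi i)
        (hw (hFi i) hηη) (tendsto_l2_mollify_sub (hFi i))).add
        ((tendsto_integral_mul_of_l2 hm hu (hw (hFi i) (hηp i))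
          (tendsto_l2_mollify_sub hu)).const_mul 2)).neg
    refine tendsto_nhds_unique t1 (t2.congr fun n => ?_)
    have hv := contDiff_mollify n huF.locallyIntegrable
    have hφ : IsTest fun x => mollify n u x * (η x * η x) := hηη.mul_left hv
    have hφs : tsupport (fun x => mollify n u x * (η x * η x)) ⊆ Metric.closedBall 0 (R + 1) :=
      (tsupport_mul_subset_right.trans tsupport_mul_subset_right).trans hRB
    have h3 := h1.integral_gradient_eq hG hu hF huF hub hab hφ hφs
    rw [show ∫ x, mollify n u x * (ρ x * (η x * η x) * a x) =
      ∫ x, a x * ρ x * (mollify n u x * (η x * η x)) from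
        integral_congr_ae (Eventually.of_forall fun x => by ring), h3]
    congr 1
    refine Finset.sum_congr rfl fun i _ => ?_
    have j1 : Integrable fun x => mollify n (fun x => F x i) x * (ρ x * (η x * η x) * F x i) :=
      (hmi n i).integrable_mul (hw (hFi i) hηη)
    have j2 : Integrable fun x => mollify n u x * (ρ x * (η x * pd i η x) * F x i) :=
      (hm n).integrable_mul (hw (hFi i) (hηp i))
    rw [← integral_const_mul, ← integral_add j1 (j2.const_mul 2)]
    refine integral_congr_ae (Eventually.of_forall fun x => ?_)
    simp only
    rw [pd_mul (hv.differentiable (by simp)) hηη.differentiable,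
      pd_mul hη.differentiable hη.differentiable, pd_mollify huF]
    ring
  have mean_id : ∫ x, a x * ρ x * η x ^ 2 =
      - ∑ i, 2 * ∫ x, F x i * (ρ x * (η x * pd i η x)) := by
    have h3 := h1.integral_gradient_eq hG hu hF huF hub hab hηη (tsupport_mul_subset_right.trans hRB)
    simp only [sq]
    rw [h3]
    congr 1
    refine Finset.sum_congr rfl fun i _ => ?_
    rw [← integral_const_mul]
    refine integral_congr_ae (Eventually.of_forall fun x => ?_)
    simp only
    rw [pd_mul hη.differentiable hη.differentiable]
    ring
  set X := ∑ i, ∫ x, F x i * (ρ x * (η x * η x) * F x i)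
  set Ia := ∫ x, a x ^ 2 * ρ x
  set Ib := ∫ x, b x ^ 2 * ρ x
  have hgrad : ∀ x, ∑ i, pd i η x ^ 2 ≤ c ^ 2 := fun x => by
    rw [← norm_fderiv_sq]
    exact pow_le_pow_left₀ (norm_nonneg _) (hηc x) 2
  have iX' : Integrable fun x => ∑ i, F x i * (ρ x * (η x * η x) * F x i) :=
    integrable_finsetSum _ fun i _ => iX i
  have eX : X = ∫ x, ∑ i, F x i * (ρ x * (η x * η x) * F x i) :=
    (integral_finsetSum _ fun i _ => iX i).symm
  have hY : |∑ i, 2 * ∫ x, u x * (ρ x * (η x * pd i η x) * F x i)| ≤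
      1 / 2 * X + 2 * c ^ 2 * Ib := by
    have j : Integrable fun x => 1 / 2 * (∑ i, F x i * (ρ x * (η x * η x) * F x i)) +
        2 * c ^ 2 * (b x ^ 2 * ρ x) := (iX'.const_mul _).add (hb2.const_mul _)
    have e : 1 / 2 * X + 2 * c ^ 2 * Ib = ∫ x, (1 / 2 * (∑ i, F x i * (ρ x * (η x * η x) * F x i)) +
        2 * c ^ 2 * (b x ^ 2 * ρ x)) := by
      rw [integral_add (iX'.const_mul _) (hb2.const_mul _), integral_const_mul, integral_const_mul,
        ← eX]
    have e' : ∑ i, 2 * ∫ x, u x * (ρ x * (η x * pd i η x) * F x i) =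
        ∫ x, 2 * ∑ i, u x * (ρ x * (η x * pd i η x) * F x i) := by
      rw [integral_const_mul, integral_finsetSum _ fun i _ => iY i, Finset.mul_sum]
    rw [e, e', ← Real.norm_eq_abs]
    refine norm_integral_le_of_norm_le j ?_
    filter_upwards [hρ0] with x hx
    have e1 : ∑ i, u x * (ρ x * (η x * pd i η x) * F x i) =
        ∑ i, b x * (ρ x * (η x * pd i η x) * F x i) :=
      Finset.sum_congr rfl fun i _ => by linear_combination ρ x * pd i η x * F x i * hη0 x
    rw [e1]
    exact abs_sum_two_mul_le hx.le (hgrad x)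
  have hη2 : ∀ x, η x * η x ≤ 1 := fun x => by
    have := hη1 x
    rw [← abs_mul_abs_self]
    nlinarith [abs_nonneg (η x)]
  have hA : |∫ x, u x * (ρ x * (η x * η x) * a x)| ≤ 1 / 2 * (Ia + Ib) := by
    rw [← integral_add ha2 hb2, ← integral_const_mul, ← Real.norm_eq_abs]
    have j : Integrable fun x => 1 / 2 * (a x ^ 2 * ρ x + b x ^ 2 * ρ x) :=
      (ha2.add hb2).const_mul _
    refine norm_integral_le_of_norm_le j ?_
    filter_upwards [hρ0] with x hx
    have e1 : u x * (ρ x * (η x * η x) * a x) = ρ x * (η x * η x) * (a x * b x) := by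
      have := hη0 x
      linear_combination ρ x * η x * a x * this
    rw [e1, Real.norm_eq_abs, abs_mul, abs_of_nonneg (mul_nonneg hx.le (mul_self_nonneg _))]
    have h5 : |a x * b x| ≤ 1 / 2 * (a x ^ 2 + b x ^ 2) := by
      rw [abs_le]
      constructor <;> nlinarith [sq_nonneg (a x - b x), sq_nonneg (a x + b x)]
    calc ρ x * (η x * η x) * |a x * b x| ≤ ρ x * 1 * (1 / 2 * (a x ^ 2 + b x ^ 2)) := by
          gcongr
          exact hη2 x
      _ = _ := by ring
  -- The cross term contributes `½X`, which is absorbed on the left.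
  have hX : X ≤ 4 * c ^ 2 * Ib + Ia + Ib := by
    rw [Finset.sum_add_distrib] at energy_id
    have h5 := neg_abs_le (∑ i, 2 * ∫ x, u x * (ρ x * (η x * pd i η x) * F x i))
    have h6 := neg_abs_le (∫ x, u x * (ρ x * (η x * η x) * a x))
    linarith
  have iZ : ∀ i, Integrable fun x => F x i * (ρ x * (η x * pd i η x)) := fun i =>
    (hFi i).integrable_mul (h1.locMemLp.memLp_mul (hηp i).continuous (hηp i).hasCompactSupport)
  have hZ : |∑ i, 2 * ∫ x, F x i * (ρ x * (η x * pd i η x))| ≤ c * X + c := by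
    have e0 : c * X + c = ∫ x, (c * (∑ i, F x i * (ρ x * (η x * η x) * F x i)) + c * ρ x) := by
      rw [integral_add (iX'.const_mul _) (hρ.integrable.const_mul _), integral_const_mul,
        integral_const_mul, ← eX, hρ.integral_eq_one, mul_one]
    have e' : ∑ i, 2 * ∫ x, F x i * (ρ x * (η x * pd i η x)) =
        ∫ x, 2 * ∑ i, F x i * (ρ x * (η x * pd i η x)) := by
      rw [integral_const_mul, integral_finsetSum _ fun i _ => iZ i, Finset.mul_sum]
    have j : Integrable fun x => c * (∑ i, F x i * (ρ x * (η x * η x) * F x i)) + c * ρ x :=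
      (iX'.const_mul _).add (hρ.integrable.const_mul _)
    rw [e0, e', ← Real.norm_eq_abs]
    refine norm_integral_le_of_norm_le j ?_
    filter_upwards [hρ0] with x hx
    exact abs_sum_two_mul_le' hx.le hc (hgrad x)
  rw [mean_id, abs_neg]
  refine hZ.trans ?_
  have := mul_le_mul_of_nonneg_left hX hc.le
  linarith

/-- The datum of a square integrable weak solution of the Kolmogorov equation has mean zero. -/
theorem HypothesisH1.integral_eq_zero (hG : HasWeakGradient ρ G) (h1 : HypothesisH1 ρ G)
    (hρ : IsProbDensity ρ) {a b : Sp N → ℝ} (ha : LocMemLp a 2) (hb : LocMemLp b 2)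
    (ha1 : Integrable fun x => a x * ρ x)
    (ha2 : Integrable fun x => a x ^ 2 * ρ x) (hb2 : Integrable fun x => b x ^ 2 * ρ x)
    (hab : ∀ φ, IsTest φ → ∫ x, b x * ρ x * (lap φ x + fderiv ℝ φ x ((ρ x)⁻¹ • G x)) =
      ∫ x, a x * ρ x * φ x) : ∫ x, a x * ρ x = 0 := by
  obtain ⟨χ, hχ, hχ0, hχ1, hχR, -⟩ := exists_cutoff N le_rfl
  obtain ⟨C, hC⟩ := (hχ.hasCompactSupport.fderiv ℝ).exists_bound_of_continuous
    (hχ.contDiff.continuous_fderiv (by simp))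
  have hC0 : 0 ≤ C := (norm_nonneg _).trans (hC 0)
  -- Dilated cutoffs `χ(s_n x)` exhaust the space while their gradients are of order `s_n → 0`. The
  -- constant `C + 1` replaces `C` to keep the gradient bound strictly positive.
  let s : ℕ → ℝ := fun n => ((n : ℝ) + 1)⁻¹
  have hs : ∀ n, 0 < s n := fun n => by positivity
  let η : ℕ → Sp N → ℝ := fun n x => χ (s n • x)
  have hη : ∀ n, IsTest (η n) := fun n => ⟨hχ.contDiff.comp (contDiff_const_smul _),
    hχ.hasCompactSupport.comp_smul (hs n).ne'⟩
  have hη1 : ∀ n x, |η n x| ≤ 1 := fun n x => by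
    rw [abs_of_nonneg (hχ0 _)]; exact hχ1 _
  have hηd : ∀ n x, ‖fderiv ℝ (η n) x‖ ≤ s n * (C + 1) := by
    intro n x
    have h2 : fderiv ℝ (η n) x = s n • fderiv ℝ χ (s n • x) := by
      have h3 := ((hχ.differentiable (s n • x)).hasFDerivAt.comp x
        ((hasFDerivAt_id x).const_smul (s n))).fderiv
      refine (show fderiv ℝ (η n) x = _ from h3).trans ?_
      ext v
      simp
    rw [h2, norm_smul, Real.norm_of_nonneg (hs n).le]
    exact mul_le_mul_of_nonneg_left ((hC _).trans (by linarith)) (hs n).le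
  have hs0 : Tendsto s atTop (𝓝 0) := by
    simpa [s, one_div] using tendsto_one_div_add_atTop_nhds_zero_nat (𝕜 := ℝ)
  have t1 : Tendsto (fun n => ∫ x, a x * ρ x * η n x ^ 2) atTop (𝓝 (∫ x, a x * ρ x)) := by
    refine tendsto_integral_of_dominated_convergence (fun x => ‖a x * ρ x‖)
      (fun n => ha1.1.mul ((hη n).continuous.pow 2).aestronglyMeasurable) ha1.norm
      (fun n => Eventually.of_forall fun x => ?_) (Eventually.of_forall fun x => ?_)
    · rw [norm_mul, norm_pow]
      exact mul_le_of_le_one_right (norm_nonneg _)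
        (pow_le_one₀ (norm_nonneg _) (by simpa using hη1 n x))
    · have h2 : Tendsto (fun n => η n x) atTop (𝓝 (χ ((0 : ℝ) • x))) :=
        (hχ.continuous.tendsto _).comp (hs0.smul_const x)
      rw [zero_smul, hχR 0 (by simp)] at h2
      simpa using (h2.pow 2).const_mul (a x * ρ x)
  have t2 : Tendsto (fun n => s n * (C + 1) * (4 * (s n * (C + 1)) ^ 2 * (∫ x, b x ^ 2 * ρ x) +
      (∫ x, a x ^ 2 * ρ x) + (∫ x, b x ^ 2 * ρ x) + 1)) atTop (𝓝 0) := by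
    have h2 := hs0.mul_const (C + 1)
    have h3 := h2.mul ((((((h2.pow 2).const_mul 4).mul_const (∫ x, b x ^ 2 * ρ x)).add_const
      (∫ x, a x ^ 2 * ρ x)).add_const (∫ x, b x ^ 2 * ρ x)).add_const 1)
    simpa using h3
  have t3 : Tendsto (fun n => ∫ x, a x * ρ x * η n x ^ 2) atTop (𝓝 0) :=
    squeeze_zero_norm (fun n => h1.abs_integral_mul_sq_le hG hρ ha hb ha2 hb2 hab (hη n) (hη1 n)
      (mul_pos (hs n) (by linarith)) (hηd n)) t2
  exact tendsto_nhds_unique t1 t3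

end MeanZero

/-! ### Passing between Lebesgue measure and `dμ`, and the real Kolmogorov operator. -/

section WeightedSpace

variable {N : ℕ} {ρ : Sp N → ℝ} {G : Sp N → Sp N}

theorem IsProbDensity.isProbabilityMeasure (hρ : IsProbDensity ρ) :
    IsProbabilityMeasure (wMeasure ρ) where
  measure_univ := by
    rw [wMeasure, withDensity_apply _ MeasurableSet.univ, Measure.restrict_univ,
      ← ofReal_integral_eq_lintegral_ofReal hρ.integrable hρ.nonneg, hρ.integral_eq_one,
      ENNReal.ofReal_one]

theorem IsProbDensity.integral_wMeasure (hρ : IsProbDensity ρ) {E : Type*} [NormedAddCommGroup E]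
    [NormedSpace ℝ E] (f : Sp N → E) : ∫ x, f x ∂(wMeasure ρ) = ∫ x, ρ x • f x := by
  rw [wMeasure, integral_withDensity_eq_integral_toReal_smul₀
    hρ.integrable.aemeasurable.ennreal_ofReal (Eventually.of_forall fun _ => by simp)]
  refine integral_congr_ae ?_
  filter_upwards [hρ.nonneg] with x hx
  rw [ENNReal.toReal_ofReal hx]

theorem IsProbDensity.integrable_wMeasure (hρ : IsProbDensity ρ) {E : Type*} [NormedAddCommGroup E]
    [NormedSpace ℝ E] {f : Sp N → E} :
    Integrable f (wMeasure ρ) ↔ Integrable fun x => ρ x • f x := by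
  rw [wMeasure, integrable_withDensity_iff_integrable_smul₀'
    hρ.integrable.aemeasurable.ennreal_ofReal (Eventually.of_forall fun _ => by simp)]
  refine integrable_congr ?_
  filter_upwards [hρ.nonneg] with x hx
  rw [ENNReal.toReal_ofReal hx]

theorem wMeasure_absolutelyContinuous (ρ : Sp N → ℝ) : wMeasure ρ ≪ volume :=
  withDensity_absolutelyContinuous _ _

theorem HypothesisH1.exists_restrict_le (h1 : HypothesisH1 ρ G) {K : Set (Sp N)}
    (hK : IsCompact K) : ∃ c : ℝ≥0∞, c ≠ ⊤ ∧ volume.restrict K ≤ c • wMeasure ρ := by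
  obtain ⟨δ, hδ, hδK⟩ := h1.locallyBoundedBelow K hK
  refine ⟨(ENNReal.ofReal δ)⁻¹, by simpa using hδ, ?_⟩
  refine Measure.le_intro fun s hs _ => ?_
  rw [Measure.smul_apply, smul_eq_mul, wMeasure, withDensity_apply _ hs]
  have h0 : ENNReal.ofReal δ ≠ 0 := by simpa using hδ
  rw [← ENNReal.mul_le_mul_iff_right h0 ENNReal.ofReal_ne_top, ← mul_assoc,
    ENNReal.mul_inv_cancel h0 ENNReal.ofReal_ne_top, one_mul]
  calc ENNReal.ofReal δ * volume.restrict K s = ∫⁻ _ in s, ENNReal.ofReal δ ∂(volume.restrict K) := by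
        rw [setLIntegral_const]
    _ ≤ ∫⁻ x in s, ENNReal.ofReal (ρ x) ∂(volume.restrict K) := by
        refine lintegral_mono_ae (ae_restrict_of_ae ?_)
        filter_upwards [hδK] with x hx using ENNReal.ofReal_le_ofReal hx
    _ ≤ _ := lintegral_mono' (Measure.restrict_mono_measure Measure.restrict_le_self _) le_rfl

theorem HypothesisH1.locMemLp_of_memLp (h1 : HypothesisH1 ρ G) {F : Type*}
    [NormedAddCommGroup F] {f : Sp N → F} {p : ℝ≥0∞} (hf : MemLp f p (wMeasure ρ)) :
    LocMemLp f p := by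
  intro K hK
  obtain ⟨c, hc, hle⟩ := h1.exists_restrict_le hK
  exact hf.of_measure_le_smul hc hle

/-- Uses the local upper bound of the density, as `exists_restrict_le` uses the lower one; on
compact sets the two measures are comparable. -/
theorem HypothesisH1.memLp_wMeasure (hG : HasWeakGradient ρ G) (h1 : HypothesisH1 ρ G) {F : Type*}
    [NormedAddCommGroup F] {f : Sp N → F} {p : ℝ≥0∞} {K : Set (Sp N)} (hK : IsCompact K)
    (hf : MemLp f p (volume.restrict K)) (h0 : ∀ x, x ∉ K → f x = 0) :
    MemLp f p (wMeasure ρ) := by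
  obtain ⟨R, hR⟩ := hK.isBounded.subset_closedBall 0
  obtain ⟨M, hM⟩ := h1.exists_ae_le hG R
  have hKm : MeasurableSet K := hK.measurableSet
  have hle : (wMeasure ρ).restrict K ≤ ENNReal.ofReal M • volume.restrict K := by
    refine Measure.le_intro fun s hs _ => ?_
    rw [Measure.smul_apply, smul_eq_mul, Measure.restrict_apply hs, wMeasure,
      withDensity_apply _ (hs.inter hKm), Measure.restrict_apply hs, ← setLIntegral_const]
    refine lintegral_mono_ae ?_
    have h2 := ae_mono (Measure.restrict_mono ((Set.inter_subset_right (s := s)).trans hR) le_rfl) hM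
    filter_upwards [h2] with x hx using ENNReal.ofReal_le_ofReal hx
  have h2 := hf.of_measure_le_smul ENNReal.ofReal_ne_top hle
  rw [← memLp_indicator_iff_restrict hKm] at h2
  refine h2.ae_eq (Eventually.of_forall fun x => ?_)
  by_cases hx : x ∈ K
  · rw [Set.indicator_of_mem hx]
  · rw [Set.indicator_of_notMem hx, h0 x hx]

/-- The Kolmogorov operator on real-valued functions. -/
def kolm (ρ : Sp N → ℝ) (G : Sp N → Sp N) (φ : Sp N → ℝ) (x : Sp N) : ℝ :=
  lap φ x + fderiv ℝ φ x ((ρ x)⁻¹ • G x)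

theorem re_kolmogorovExpr {φ : Sp N → ℂ} (hφ : ContDiff ℝ ∞ φ) (x : Sp N) :
    (kolmogorovExpr ρ G φ x).re = kolm ρ G (fun y => (φ y).re) x := by
  have h2 : ContDiffAt ℝ 2 φ x := (hφ.of_le (WithTop.coe_le_coe.mpr le_top)).contDiffAt
  have e1 := ContDiffAt.laplacian_CLM_comp_left (l := Complex.reCLM) h2
  have e2 := (Complex.reCLM.hasFDerivAt.comp x (hφ.differentiable (by simp) x).hasFDerivAt).fderiv
  have hr : ContDiff ℝ ∞ fun y => (φ y).re := Complex.reCLM.contDiff.comp hφ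
  rw [kolm, lap, ← laplacian_eq_sum_pd hr]
  change _ = Laplacian.laplacian (Complex.reCLM ∘ φ) x + fderiv ℝ (Complex.reCLM ∘ φ) x _
  rw [e1, e2]
  simp [kolmogorovExpr]

theorem im_kolmogorovExpr {φ : Sp N → ℂ} (hφ : ContDiff ℝ ∞ φ) (x : Sp N) :
    (kolmogorovExpr ρ G φ x).im = kolm ρ G (fun y => (φ y).im) x := by
  have h2 : ContDiffAt ℝ 2 φ x := (hφ.of_le (WithTop.coe_le_coe.mpr le_top)).contDiffAt
  have e1 := ContDiffAt.laplacian_CLM_comp_left (l := Complex.imCLM) h2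
  have e2 := (Complex.imCLM.hasFDerivAt.comp x (hφ.differentiable (by simp) x).hasFDerivAt).fderiv
  have hr : ContDiff ℝ ∞ fun y => (φ y).im := Complex.imCLM.contDiff.comp hφ
  rw [kolm, lap, ← laplacian_eq_sum_pd hr]
  change _ = Laplacian.laplacian (Complex.imCLM ∘ φ) x + fderiv ℝ (Complex.imCLM ∘ φ) x _
  rw [e1, e2]
  simp [kolmogorovExpr]

theorem kolm_zero (ρ : Sp N → ℝ) (G : Sp N → Sp N) (x : Sp N) :
    kolm ρ G (fun _ => 0) x = 0 := by
  have : ∀ i : Fin N, pd i (fun _ : Sp N => (0 : ℝ)) = fun _ => 0 := fun i => by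
    funext x
    simp [pd]
  simp [kolm, lap, this]

theorem IsTest.contDiff_ofReal {φ : Sp N → ℝ} (hφ : IsTest φ) :
    ContDiff ℝ ∞ fun x => (φ x : ℂ) :=
  Complex.ofRealCLM.contDiff.comp hφ.contDiff

theorem kolmogorovExpr_ofReal {φ : Sp N → ℝ} (hφ : IsTest φ) (x : Sp N) :
    kolmogorovExpr ρ G (fun y => (φ y : ℂ)) x = kolm ρ G φ x := by
  refine Complex.ext ?_ ?_
  · rw [re_kolmogorovExpr hφ.contDiff_ofReal]
    simp
  · rw [im_kolmogorovExpr hφ.contDiff_ofReal]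
    simp [kolm_zero]

theorem isTest_re {φ : Sp N → ℂ} (hφ : ContDiff ℝ ∞ φ) (hs : HasCompactSupport φ) :
    IsTest fun x => (φ x).re :=
  ⟨Complex.reCLM.contDiff.comp hφ, hs.comp_left (g := Complex.re) rfl⟩

theorem isTest_im {φ : Sp N → ℂ} (hφ : ContDiff ℝ ∞ φ) (hs : HasCompactSupport φ) :
    IsTest fun x => (φ x).im :=
  ⟨Complex.imCLM.contDiff.comp hφ, hs.comp_left (g := Complex.im) rfl⟩

theorem IsTest.memLp_wMeasure (hG : HasWeakGradient ρ G) (h1 : HypothesisH1 ρ G) {φ : Sp N → ℝ}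
    (hφ : IsTest φ) (p : ℝ≥0∞) : MemLp φ p (wMeasure ρ) :=
  h1.memLp_wMeasure hG hφ.hasCompactSupport.isCompact ((hφ.memLp p).restrict _)
    fun _ hx => image_eq_zero_of_notMem_tsupport hx

theorem fderiv_eq_zero_of_notMem {φ : Sp N → ℝ} {x : Sp N} (hx : x ∉ tsupport φ) :
    fderiv ℝ φ x = 0 :=
  image_eq_zero_of_notMem_tsupport fun h => hx (tsupport_fderiv_subset ℝ h)

theorem lap_eq_zero_of_notMem {φ : Sp N → ℝ} {x : Sp N} (hx : x ∉ tsupport φ) : lap φ x = 0 := by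
  refine Finset.sum_eq_zero fun i _ => image_eq_zero_of_notMem_tsupport fun h => hx ?_
  exact tsupport_fderiv_apply_subset ℝ _ (tsupport_fderiv_apply_subset ℝ _ h)

theorem HypothesisH1.memLp_kolm (hG : HasWeakGradient ρ G) (h1 : HypothesisH1 ρ G) {φ : Sp N → ℝ}
    (hφ : IsTest φ) : MemLp (kolm ρ G φ) 2 (wMeasure ρ) := by
  obtain ⟨r, hr2, hNr, hr⟩ := h1.exists_exponent
  have hK := hφ.hasCompactSupport.isCompact
  refine h1.memLp_wMeasure hG hK ?_ fun x hx => ?_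
  · have : IsFiniteMeasure (volume.restrict (tsupport φ)) :=
      isFiniteMeasure_restrict.2 hK.measure_ne_top
    have h3 : MemLp (fun x => (ρ x)⁻¹ • G x) 2 (volume.restrict (tsupport φ)) :=
      (hr _ hK).mono_exponent (by
        rw [← ENNReal.ofReal_ofNat]; exact ENNReal.ofReal_le_ofReal hr2)
    refine ((hφ.lap.memLp 2).restrict _).add ?_
    have hc := hφ.contDiff.continuous_fderiv (by simp)
    obtain ⟨C, hC⟩ := (hφ.hasCompactSupport.fderiv ℝ).exists_bound_of_continuous hc
    refine h3.of_le_mul (c := C) (isBoundedBilinearMap_apply.continuous.comp_aestronglyMeasurable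
      (hc.aestronglyMeasurable.prodMk h3.1)) (Eventually.of_forall fun x => ?_)
    exact ((fderiv ℝ φ x).le_opNorm _).trans (mul_le_mul_of_nonneg_right (hC x) (norm_nonneg _))
  · simp [kolm, fderiv_eq_zero_of_notMem hx, lap_eq_zero_of_notMem hx]

/-- The Dirichlet form of the Kolmogorov operator. -/
theorem HypothesisH1.integral_mul_kolm (hG : HasWeakGradient ρ G) (h1 : HypothesisH1 ρ G)
    (hρ : IsProbDensity ρ) {φ ψ : Sp N → ℝ} (hφ : IsTest φ) (hψ : IsTest ψ) :
    ∫ x, ψ x * kolm ρ G φ x ∂(wMeasure ρ) = - ∫ x, ρ x * ∑ i, pd i ψ x * pd i φ x := by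
  rw [hρ.integral_wMeasure, ← hG.integral_mul_lap_add hφ hψ.contDiff]
  refine integral_congr_ae ?_
  filter_upwards [h1.ae_pos] with x hx
  rw [smul_eq_mul, kolm, map_smul, smul_eq_mul]
  field_simp

theorem HypothesisH1.integral_mul_kolm_comm (hG : HasWeakGradient ρ G) (h1 : HypothesisH1 ρ G)
    (hρ : IsProbDensity ρ) {φ ψ : Sp N → ℝ} (hφ : IsTest φ) (hψ : IsTest ψ) :
    ∫ x, ψ x * kolm ρ G φ x ∂(wMeasure ρ) = ∫ x, φ x * kolm ρ G ψ x ∂(wMeasure ρ) := by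
  rw [h1.integral_mul_kolm hG hρ hφ hψ, h1.integral_mul_kolm hG hρ hψ hφ]
  congr 1
  refine integral_congr_ae (Eventually.of_forall fun x => ?_)
  simp only [mul_comm]

end WeightedSpace

/-! ### Closability, closed graph and dense domain of the Kolmogorov operator. -/

section Core

variable {N : ℕ} {ρ : Sp N → ℝ} {G : Sp N → Sp N}

section L2Complex

variable {α : Type*} [MeasurableSpace α] {μ : Measure α}

/-- The class of a real-valued function in the complex space `L^2`. -/
def realVec (g : α → ℝ) (hg : MemLp g 2 μ) : Lp ℂ 2 μ :=
  (hg.ofReal (K := ℂ)).toLp fun x => ((g x : ℝ) : ℂ)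

theorem coeFn_realVec {g : α → ℝ} (hg : MemLp g 2 μ) :
    realVec g hg =ᵐ[μ] fun x => (g x : ℂ) :=
  MemLp.coeFn_toLp _

theorem inner_realVec {g : α → ℝ} (hg : MemLp g 2 μ) (p : Lp ℂ 2 μ) :
    ⟪realVec g hg, p⟫_ℂ = ∫ x, (g x : ℂ) * p x ∂μ := by
  rw [L2.inner_def]
  refine integral_congr_ae ?_
  filter_upwards [coeFn_realVec hg] with x hx
  rw [hx]
  simp [mul_comm]

theorem integrable_ofReal_mul {g : α → ℝ} (hg : MemLp g 2 μ) (p : Lp ℂ 2 μ) :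
    Integrable (fun x => (g x : ℂ) * p x) μ :=
  (hg.ofReal (K := ℂ)).integrable_mul (Lp.memLp p)

theorem re_inner_realVec {g : α → ℝ} (hg : MemLp g 2 μ) (p : Lp ℂ 2 μ) :
    (⟪realVec g hg, p⟫_ℂ).re = ∫ x, g x * (p x).re ∂μ := by
  rw [inner_realVec hg]
  have := Complex.reCLM.integral_comp_comm (integrable_ofReal_mul hg p)
  simp only [Complex.reCLM_apply, Complex.re_ofReal_mul] at this
  exact this.symm

theorem im_inner_realVec {g : α → ℝ} (hg : MemLp g 2 μ) (p : Lp ℂ 2 μ) :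
    (⟪realVec g hg, p⟫_ℂ).im = ∫ x, g x * (p x).im ∂μ := by
  rw [inner_realVec hg]
  have := Complex.imCLM.integral_comp_comm (integrable_ofReal_mul hg p)
  simp only [Complex.imCLM_apply, Complex.im_ofReal_mul] at this
  exact this.symm

theorem l2_norm_eq (p : Lp ℂ 2 μ) : l2 μ (fun x => ‖p x‖) = ‖p‖ := by
  have h := inner_self_eq_norm_sq_to_K (𝕜 := ℂ) p
  rw [L2.inner_def] at h
  have e : ∫ x, ⟪p x, p x⟫_ℂ ∂μ = ((∫ x, ‖p x‖ ^ 2 ∂μ : ℝ) : ℂ) := by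
    rw [← integral_complex_ofReal]
    refine integral_congr_ae (Eventually.of_forall fun x => ?_)
    simp only [inner_self_eq_norm_sq_to_K]
    simp
  rw [e] at h
  have h2 : ∫ x, ‖p x‖ ^ 2 ∂μ = ‖p‖ ^ 2 := by
    refine Complex.ofReal_injective (h.trans ?_)
    push_cast
    rfl
  rw [l2, h2, Real.sqrt_sq (norm_nonneg _)]

theorem l2_re_le (p : Lp ℂ 2 μ) : l2 μ (fun x => (p x).re) ≤ ‖p‖ := by
  rw [← l2_norm_eq]
  refine l2_mono (Lp.memLp p).norm (Eventually.of_forall fun x => ?_)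
  rw [abs_of_nonneg (norm_nonneg (p x))]
  exact Complex.abs_re_le_norm _

end L2Complex

/-- The double orthogonal complement in the Hilbert product is the closure. `WithLp 2` supplies the
inner product that the plain product `H × H` does not carry. -/
theorem mem_topologicalClosure_of_forall_inner {H : Type*} [NormedAddCommGroup H]
    [InnerProductSpace ℂ H] [CompleteSpace H] (S : Submodule ℂ (H × H)) (p : H × H)
    (h : ∀ a b : H, (∀ q ∈ S, ⟪a, q.1⟫_ℂ + ⟪b, q.2⟫_ℂ = 0) → ⟪a, p.1⟫_ℂ + ⟪b, p.2⟫_ℂ = 0) :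
    p ∈ S.topologicalClosure := by
  let Γ : Submodule ℂ (WithLp 2 (H × H)) :=
    S.topologicalClosure.comap (WithLp.linearEquiv 2 ℂ (H × H)).toLinearMap
  have hΓ : IsClosed (Γ : Set (WithLp 2 (H × H))) :=
    S.isClosed_topologicalClosure.preimage (WithLp.prod_continuous_ofLp 2 H H)
  have : CompleteSpace Γ := hΓ.completeSpace_coe
  have h1 : WithLp.toLp 2 p ∈ Γᗮᗮ := by
    rw [Submodule.mem_orthogonal]
    intro v hv
    rw [WithLp.prod_inner_apply]
    refine h _ _ fun q hq => ?_
    have h2 := (Submodule.mem_orthogonal' _ _).1 hv (WithLp.toLp 2 q)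
      (S.le_topologicalClosure hq)
    rwa [WithLp.prod_inner_apply] at h2
  rw [Submodule.orthogonal_orthogonal] at h1
  exact h1

theorem IsTest.mem_coreGraph (hG : HasWeakGradient ρ G) (h1 : HypothesisH1 ρ G) {φ : Sp N → ℝ}
    (hφ : IsTest φ) :
    (realVec φ (hφ.memLp_wMeasure hG h1 2), realVec _ (h1.memLp_kolm hG hφ)) ∈ kolmogorovCoreGraph ρ G := by
  refine ⟨fun x => (φ x : ℂ), hφ.contDiff_ofReal, hφ.hasCompactSupport.comp_left
    (g := fun t : ℝ => (t : ℂ)) Complex.ofReal_zero, coeFn_realVec (hφ.memLp_wMeasure hG h1 2), ?_⟩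
  refine (coeFn_realVec (h1.memLp_kolm hG hφ)).trans (Eventually.of_forall fun x => ?_)
  exact (kolmogorovExpr_ofReal hφ x).symm

/-- The real and imaginary parts of elements of the core. -/
theorem exists_of_mem_coreGraph {p : L2 ρ × L2 ρ} (hp : p ∈ kolmogorovCoreGraph ρ G) :
    ∃ φ ψ : Sp N → ℝ, IsTest φ ∧ IsTest ψ ∧ (∀ᵐ x ∂(wMeasure ρ), (p.1 x).re = φ x ∧
      (p.1 x).im = ψ x ∧ (p.2 x).re = kolm ρ G φ x ∧ (p.2 x).im = kolm ρ G ψ x) := by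
  obtain ⟨Φ, h1, h2, h3, h4⟩ := hp
  refine ⟨_, _, isTest_re h1 h2, isTest_im h1 h2, ?_⟩
  filter_upwards [h3, h4] with x h5 h6
  rw [h5, h6, re_kolmogorovExpr h1, im_kolmogorovExpr h1]
  exact ⟨rfl, rfl, rfl, rfl⟩

theorem eq_zero_of_forall_inner_test (hG : HasWeakGradient ρ G) (h1 : HypothesisH1 ρ G)
    (hρ : IsProbDensity ρ) {q : L2 ρ}
    (h : ∀ φ (hφ : IsTest φ), ⟪realVec φ (hφ.memLp_wMeasure hG h1 2), q⟫_ℂ = 0) :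
    q = 0 := by
  have := hρ.isProbabilityMeasure
  have h2 := ae_eq_zero_of_integral_contDiff_smul_eq_zero (μ := wMeasure ρ)
    ((Lp.memLp q).integrable (by norm_num)).locallyIntegrable fun g hg hs => by
      have h3 := h g ⟨hg, hs⟩
      rw [inner_realVec (IsTest.memLp_wMeasure hG h1 ⟨hg, hs⟩ 2)] at h3
      simpa using! h3
  exact Lp.ext (EventuallyEq.trans (show (q : Sp N → ℂ) =ᵐ[wMeasure ρ] 0 from h2)
    (Lp.coeFn_zero _ _ _).symm)

theorem inner_eq_of_mem_coreGraph (hG : HasWeakGradient ρ G) (h1 : HypothesisH1 ρ G)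
    (hρ : IsProbDensity ρ) {φ : Sp N → ℝ} (hφ : IsTest φ) {p : L2 ρ × L2 ρ}
    (hp : p ∈ kolmogorovCoreGraph ρ G) :
    ⟪realVec φ (hφ.memLp_wMeasure hG h1 2), p.2⟫_ℂ =
      ⟪realVec _ (h1.memLp_kolm hG hφ), p.1⟫_ℂ := by
  obtain ⟨φ1, φ2, h2, h3, h4⟩ := exists_of_mem_coreGraph hp
  have key : ∀ {θ : Sp N → ℝ} {f g : Sp N → ℝ}, IsTest θ → (∀ᵐ x ∂(wMeasure ρ), f x = θ x) →
      (∀ᵐ x ∂(wMeasure ρ), g x = kolm ρ G θ x) →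
      ∫ x, φ x * g x ∂(wMeasure ρ) = ∫ x, kolm ρ G φ x * f x ∂(wMeasure ρ) := by
    intro θ f g hθ hf hg
    have e1 : ∫ x, φ x * g x ∂(wMeasure ρ) = ∫ x, φ x * kolm ρ G θ x ∂(wMeasure ρ) :=
      integral_congr_ae (hg.mono fun x hx => by simp only [hx])
    have e2 : ∫ x, kolm ρ G φ x * f x ∂(wMeasure ρ) = ∫ x, θ x * kolm ρ G φ x ∂(wMeasure ρ) :=
      integral_congr_ae (hf.mono fun x hx => by simp only [hx]; exact mul_comm _ _)
    rw [e1, e2]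
    exact h1.integral_mul_kolm_comm hG hρ hθ hφ
  refine Complex.ext ?_ ?_
  · rw [re_inner_realVec (hφ.memLp_wMeasure hG h1 2), re_inner_realVec (h1.memLp_kolm hG hφ)]
    exact key h2 (h4.mono fun x hx => hx.1) (h4.mono fun x hx => hx.2.2.1)
  · rw [im_inner_realVec (hφ.memLp_wMeasure hG h1 2), im_inner_realVec (h1.memLp_kolm hG hφ)]
    exact key h3 (h4.mono fun x hx => hx.2.1) (h4.mono fun x hx => hx.2.2.2)

theorem kolmogorovCore_graph (hρ : IsProbDensity ρ) (h1 : HypothesisH1 ρ G) :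
    (kolmogorovCore ρ G).graph = kolmogorovCoreGraph ρ G :=
  Submodule.toLinearPMap_graph_eq _ fun p hp h0 => kolmogorovCoreGraph_singleValued hρ h1 p hp h0

/-- Symmetry against test functions is a closed condition on graph pairs. For a limit pair `(0, q)`
it says that `q` is orthogonal to all test functions, hence zero. -/
theorem kolmogorovCore_isClosable (hG : HasWeakGradient ρ G) (h1 : HypothesisH1 ρ G)
    (hρ : IsProbDensity ρ) : (kolmogorovCore ρ G).IsClosable := by
  refine ⟨(kolmogorovCoreGraph ρ G).topologicalClosure.toLinearPMap, ?_⟩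
  rw [kolmogorovCore_graph hρ h1, Submodule.toLinearPMap_graph_eq]
  intro p hp h0
  refine eq_zero_of_forall_inner_test hG h1 hρ fun φ hφ => ?_
  have h2 : p ∈ {q : L2 ρ × L2 ρ |
      ⟪realVec φ (hφ.memLp_wMeasure hG h1 2), q.2⟫_ℂ =
      ⟪realVec _ (h1.memLp_kolm hG hφ), q.1⟫_ℂ} :=
    closure_minimal (fun q hq => inner_eq_of_mem_coreGraph hG h1 hρ hφ hq)
      (isClosed_eq (by fun_prop) (by fun_prop)) hp
  rw [Set.mem_ofPred_eq, h0, inner_zero_right] at h2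
  exact h2

theorem kolmogorov_graph (hG : HasWeakGradient ρ G) (h1 : HypothesisH1 ρ G)
    (hρ : IsProbDensity ρ) :
    (kolmogorov ρ G).graph = (kolmogorovCoreGraph ρ G).topologicalClosure := by
  rw [kolmogorov, ← (kolmogorovCore_isClosable hG h1 hρ).graph_closure_eq_closure_graph,
    kolmogorovCore_graph hρ h1]

theorem kolmogorov_isClosed_graph (hG : HasWeakGradient ρ G) (h1 : HypothesisH1 ρ G)
    (hρ : IsProbDensity ρ) : IsClosed ((kolmogorov ρ G).graph : Set (L2 ρ × L2 ρ)) := by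
  rw [kolmogorov_graph hG h1 hρ]
  exact Submodule.isClosed_topologicalClosure _

theorem dense_kolmogorov_domain (hG : HasWeakGradient ρ G) (h1 : HypothesisH1 ρ G)
    (hρ : IsProbDensity ρ) : Dense ((kolmogorov ρ G).domain : Set (L2 ρ)) := by
  rw [Submodule.dense_iff_topologicalClosure_eq_top, Submodule.topologicalClosure_eq_top_iff,
    Submodule.eq_bot_iff]
  intro q hq
  refine eq_zero_of_forall_inner_test hG h1 hρ fun φ hφ => (Submodule.mem_orthogonal _ q).1 hq _ ?_
  refine (LinearPMap.mem_domain_iff (f := kolmogorov ρ G)).2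
    ⟨realVec _ (h1.memLp_kolm hG hφ), ?_⟩
  rw [kolmogorov_graph hG h1 hρ]
  exact Submodule.le_topologicalClosure _ (hφ.mem_coreGraph hG h1)

end Core

/-! ### The kernel of the Kolmogorov operator is the space of constants. -/

section Constants

variable {N : ℕ} {ρ : Sp N → ℝ} {G : Sp N → Sp N}

/-- The mollifications have zero gradient, so each is constant, and they converge almost everywhere.
-/
theorem ae_eq_const_of_hasWeakGradient_zero {f : Sp N → ℝ} (h : HasWeakGradient f fun _ => 0) :
    ∃ c : ℝ, ∀ᵐ x, f x = c := by
  have h2 : ∀ n x, mollify n f x = mollify n f 0 := by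
    intro n x
    refine is_const_of_fderiv_eq_zero (𝕜 := ℝ)
      ((contDiff_mollify n h.locallyIntegrable).differentiable (by simp)) (fun y => ?_) x 0
    rw [fderiv_mollify h, mollify_apply]
    simp
  have h3 := ae_tendsto_mollify h.locallyIntegrable
  obtain ⟨x₀, hx₀⟩ := h3.exists
  refine ⟨f x₀, ?_⟩
  filter_upwards [h3] with x hx
  simp only [h2 _ x] at hx
  simp only [h2 _ x₀] at hx₀
  exact tendsto_nhds_unique hx hx₀

theorem ae_eq_const_of_integral_mul_pd {f : Sp N → ℝ} (hf : LocallyIntegrable f)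
    (h : ∀ i φ, IsTest φ → ∫ x, f x * pd i φ x = 0) : ∃ c : ℝ, ∀ᵐ x, f x = c := by
  refine ae_eq_const_of_hasWeakGradient_zero ⟨hf, (locallyIntegrable_const 0), fun φ h1 h2 v => ?_⟩
  have hφ : IsTest φ := ⟨h1, h2⟩
  have hi : ∀ i ∈ Finset.univ, Integrable fun x => v i * (f x * pd i φ x) := fun i _ => by
    have h3 := hf.integrable_smul_left_of_hasCompactSupport (hφ.pd i).continuous
      (hφ.pd i).hasCompactSupport
    refine (h3.congr (Eventually.of_forall fun x => ?_)).const_mul (v i)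
    simp only [smul_eq_mul, mul_comm]
  calc ∫ x, f x * fderiv ℝ φ x v = ∫ x, ∑ i, v i * (f x * pd i φ x) := by
        refine integral_congr_ae (Eventually.of_forall fun x => ?_)
        simp only [fderiv_apply_eq_sum φ x v, Finset.mul_sum]
        exact Finset.sum_congr rfl fun i _ => by ring
    _ = 0 := by
        rw [integral_finsetSum _ hi]
        refine Finset.sum_eq_zero fun i _ => ?_
        rw [integral_const_mul, h i φ hφ, mul_zero]
    _ = _ := by simp

/-- `φ/ρ` represents Lebesgue integration against `φ` as a continuous functional on `L²(μ)`. -/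
theorem HypothesisH1.memLp_div (hG : HasWeakGradient ρ G) (h1 : HypothesisH1 ρ G)
    (hρ : IsProbDensity ρ) {φ : Sp N → ℝ} (hφ : IsTest φ) :
    MemLp (fun x => φ x * (ρ x)⁻¹) 2 (wMeasure ρ) := by
  have hK := hφ.hasCompactSupport.isCompact
  have : IsFiniteMeasure (volume.restrict (tsupport φ)) :=
    isFiniteMeasure_restrict.2 hK.measure_ne_top
  refine h1.memLp_wMeasure hG hK ?_ fun x hx => by
    rw [image_eq_zero_of_notMem_tsupport hx, zero_mul]
  obtain ⟨δ, hδ, hδK⟩ := h1.locallyBoundedBelow _ hK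
  refine (((hφ.memLp 2).restrict (tsupport φ)).of_le_mul (c := δ⁻¹) ?_ ?_)
  · exact (hφ.continuous.aestronglyMeasurable.mul
      hρ.integrable.aemeasurable.inv.aestronglyMeasurable).restrict
  · filter_upwards [hδK] with x hx
    rw [norm_mul, mul_comm, norm_inv, Real.norm_of_nonneg (hδ.le.trans hx)]
    gcongr

theorem HypothesisH1.integral_div_mul (hρ : IsProbDensity ρ) (h1 : HypothesisH1 ρ G)
    (f g : Sp N → ℝ) :
    ∫ x, f x * (ρ x)⁻¹ * g x ∂(wMeasure ρ) = ∫ x, f x * g x := by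
  rw [hρ.integral_wMeasure]
  refine integral_congr_ae ?_
  filter_upwards [h1.ae_pos] with x hx
  rw [smul_eq_mul]
  field_simp

/-- By Cauchy–Schwarz and the Dirichlet form, `∫ |∇φ|² dμ = -∫ φ Lφ dμ ≤ ‖φ‖ ‖Lφ‖`. Only norms of
`φ` and `Lφ` in `L²(μ)` occur on the right, so the bound survives closure of the graph. -/
theorem HypothesisH1.sq_integral_mul_pd_le (hG : HasWeakGradient ρ G) (h1 : HypothesisH1 ρ G)
    (hρ : IsProbDensity ρ) {φ ψ : Sp N → ℝ} (hφ : IsTest φ) (hψ : IsTest ψ) (i : Fin N) :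
    (∫ x, φ x * pd i ψ x) ^ 2 ≤ l2 (wMeasure ρ) (fun x => ψ x * (ρ x)⁻¹) ^ 2 *
      (l2 (wMeasure ρ) φ * l2 (wMeasure ρ) (kolm ρ G φ)) := by
  have hp := (hφ.pd i).memLp_wMeasure hG h1 2
  have e1 : ∫ x, φ x * pd i ψ x = - ∫ x, ψ x * (ρ x)⁻¹ * pd i φ x ∂(wMeasure ρ) := by
    rw [h1.integral_div_mul hρ, integral_mul_pd hψ hφ.contDiff i]
    simp only [mul_comm]
  have e2 := abs_integral_mul_le (h1.memLp_div hG hρ hψ) hp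
  have e3 : l2 (wMeasure ρ) (pd i φ) ^ 2 ≤ l2 (wMeasure ρ) φ * l2 (wMeasure ρ) (kolm ρ G φ) := by
    refine le_trans ?_ (abs_integral_mul_le (hφ.memLp_wMeasure hG h1 2) (h1.memLp_kolm hG hφ))
    rw [h1.integral_mul_kolm hG hρ hφ hφ, abs_neg]
    refine le_trans ?_ (le_abs_self _)
    rw [l2_sq, hρ.integral_wMeasure]
    have hint : ∀ j, Integrable fun x => ρ x * (pd j φ x * pd j φ x) := fun j => by
      have h2 := hρ.integrable_wMeasure.1 ((hφ.pd j).memLp_wMeasure hG h1 2).integrable_sq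
      refine h2.congr (Eventually.of_forall fun x => ?_)
      simp only [smul_eq_mul, sq]
    refine integral_mono_ae ((hint i).congr (Eventually.of_forall fun x => by
      simp only [smul_eq_mul, sq])) ?_ ?_
    · refine (integrable_finsetSum Finset.univ fun j _ => hint j).congr
        (Eventually.of_forall fun x => ?_)
      simp only [Finset.mul_sum]
    · filter_upwards [h1.ae_pos] with x hx
      simp only [smul_eq_mul, sq]
      exact mul_le_mul_of_nonneg_left (Finset.single_le_sum (f := fun j => pd j φ x * pd j φ x)
        (fun j _ => mul_self_nonneg _) (Finset.mem_univ i)) hx.le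
  rw [e1, neg_sq, ← sq_abs]
  refine (pow_le_pow_left₀ (abs_nonneg _) e2 2).trans ?_
  rw [mul_pow]
  exact mul_le_mul_of_nonneg_left e3 (sq_nonneg _)

theorem ae_re_eq_const (hG : HasWeakGradient ρ G) (h1 : HypothesisH1 ρ G)
    (hρ : IsProbDensity ρ) {u : L2 ρ} (hu : (u, 0) ∈ (kolmogorovCoreGraph ρ G).topologicalClosure) :
    ∃ c : ℝ, ∀ᵐ x, (u x).re = c := by
  have hloc : LocallyIntegrable fun x => (u x).re := by
    rw [locallyIntegrable_iff]
    intro K hK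
    have : IsFiniteMeasure (volume.restrict K) := isFiniteMeasure_restrict.2 hK.measure_ne_top
    exact ((h1.locMemLp_of_memLp (Lp.memLp u) K hK).integrable (by norm_num)).re
  refine ae_eq_const_of_integral_mul_pd hloc fun i ψ hψ => ?_
  have hg := h1.memLp_div hG hρ (hψ.pd i)
  set C := l2 (wMeasure ρ) (fun x => ψ x * (ρ x)⁻¹) ^ 2
  have e1 : ∀ p : L2 ρ, (⟪realVec _ hg, p⟫_ℂ).re = ∫ x, (p x).re * pd i ψ x := by
    intro p
    rw [re_inner_realVec hg, h1.integral_div_mul hρ]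
    simp only [mul_comm]
  have h2 : (u, (0 : L2 ρ)) ∈ {q : L2 ρ × L2 ρ | (⟪realVec _ hg, q.1⟫_ℂ).re ^ 2 ≤
      C * (‖q.1‖ * ‖q.2‖)} := by
    refine closure_minimal (fun q hq => ?_) (isClosed_le
      ((Complex.continuous_re.comp (by fun_prop)).pow 2) (by fun_prop)) hu
    obtain ⟨φ, φ', h3, -, h4⟩ := exists_of_mem_coreGraph hq
    have e2 : ∫ x, (q.1 x).re * pd i ψ x = ∫ x, φ x * pd i ψ x := by
      refine integral_congr_ae ?_
      filter_upwards [(volume_absolutelyContinuous hρ h1).ae_le h4] with x hx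
      rw [hx.1]
    have e3 : l2 (wMeasure ρ) φ ≤ ‖q.1‖ := by
      refine le_trans (l2_mono (Lp.memLp q.1).re (h4.mono fun x hx => ?_)) (l2_re_le _)
      exact (congrArg _ hx.1).ge
    have e4 : l2 (wMeasure ρ) (kolm ρ G φ) ≤ ‖q.2‖ := by
      refine le_trans (l2_mono (Lp.memLp q.2).re (h4.mono fun x hx => ?_)) (l2_re_le _)
      exact (congrArg _ hx.2.2.1).ge
    change (⟪realVec _ hg, q.1⟫_ℂ).re ^ 2 ≤ _
    rw [e1, e2]
    refine (h1.sq_integral_mul_pd_le hG hρ h3 hψ i).trans ?_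
    have := l2_nonneg (μ := wMeasure ρ) (kolm ρ G φ)
    gcongr
  rw [Set.mem_ofPred_eq, e1] at h2
  simp only [norm_zero, mul_zero] at h2
  exact pow_eq_zero_iff two_ne_zero |>.1 (le_antisymm h2 (sq_nonneg _))

/-- The kernel of the Kolmogorov operator consists of constants. -/
theorem ae_eq_const_of_mem_closure (hG : HasWeakGradient ρ G) (h1 : HypothesisH1 ρ G)
    (hρ : IsProbDensity ρ) {u : L2 ρ} (hu : (u, 0) ∈ (kolmogorovCoreGraph ρ G).topologicalClosure) :
    ∃ c : ℂ, ∀ᵐ x, u x = c := by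
  obtain ⟨a, ha⟩ := ae_re_eq_const hG h1 hρ hu
  -- The real part of `-iu` is the imaginary part of `u`.
  have h2 : ((-Complex.I) • u, (0 : L2 ρ)) ∈ (kolmogorovCoreGraph ρ G).topologicalClosure := by
    have := Submodule.smul_mem _ (-Complex.I) hu
    rwa [Prod.smul_mk, smul_zero] at this
  obtain ⟨b, hb⟩ := ae_re_eq_const hG h1 hρ h2
  refine ⟨⟨a, b⟩, ?_⟩
  filter_upwards [ha, hb, (volume_absolutelyContinuous hρ h1).ae_le
    (Lp.coeFn_smul (-Complex.I) u)] with x h3 h4 h5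
  rw [h5] at h4
  exact Complex.ext h3 (by simpa using h4)

/-- By duality it suffices that every `(α, β)` orthogonal to the core graph has `∫ α dμ = 0`.
Orthogonality says that `Lβ = -α` in the very weak sense, so `HypothesisH1.integral_eq_zero` applies
to real and imaginary parts. -/
theorem one_mem_closure (hG : HasWeakGradient ρ G) (h1 : HypothesisH1 ρ G)
    (hρ : IsProbDensity ρ) (hone : MemLp (fun _ : Sp N => (1 : ℝ)) 2 (wMeasure ρ)) :
    (realVec _ hone, (0 : L2 ρ)) ∈ (kolmogorovCoreGraph ρ G).topologicalClosure := by
  have := hρ.isProbabilityMeasure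
  refine mem_topologicalClosure_of_forall_inner _ _ fun α β h => ?_
  have key : ∀ {a b : Sp N → ℝ}, MemLp a 2 (wMeasure ρ) → MemLp b 2 (wMeasure ρ) →
      (∀ φ, IsTest φ → ∫ x, φ x * a x ∂(wMeasure ρ) +
        ∫ x, kolm ρ G φ x * b x ∂(wMeasure ρ) = 0) → ∫ x, 1 * a x ∂(wMeasure ρ) = 0 := by
    intro a b ha hb hab
    have i1 := hρ.integrable_wMeasure.1 (ha.integrable (by norm_num))
    have i2 := hρ.integrable_wMeasure.1 ha.integrable_sq
    have i3 := hρ.integrable_wMeasure.1 hb.integrable_sq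
    have h2 := h1.integral_eq_zero hG hρ (a := fun x => -a x) (b := b)
      (h1.locMemLp_of_memLp ha.neg) (h1.locMemLp_of_memLp hb)
      (i1.neg.congr (Eventually.of_forall fun x => by
        simp only [Pi.neg_apply, smul_eq_mul]; ring))
      (i2.congr (Eventually.of_forall fun x => by simp only [smul_eq_mul]; ring))
      (i3.congr (Eventually.of_forall fun x => by simp only [smul_eq_mul]; ring))
      fun φ hφ => by
        have h3 := hab φ hφ
        rw [hρ.integral_wMeasure, hρ.integral_wMeasure, add_comm,
          add_eq_zero_iff_eq_neg, ← integral_neg] at h3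
        refine Eq.trans (integral_congr_ae (Eventually.of_forall fun x => ?_))
          (h3.trans (integral_congr_ae (Eventually.of_forall fun x => ?_)))
        · simp only [smul_eq_mul, kolm]; ring
        · simp only [smul_eq_mul]; ring
    rw [hρ.integral_wMeasure, ← neg_eq_zero, ← integral_neg, ← h2]
    refine integral_congr_ae (Eventually.of_forall fun x => ?_)
    simp only [smul_eq_mul]
    ring
  have h' : ∀ φ (hφ : IsTest φ), ⟪realVec φ (hφ.memLp_wMeasure hG h1 2), α⟫_ℂ +
      ⟪realVec _ (h1.memLp_kolm hG hφ), β⟫_ℂ = 0 := by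
    intro φ hφ
    -- Conjugating puts the real test vectors in the first slot, where real and imaginary parts of
    -- `α` and `β` separate.
    have h2 := congrArg (starRingEnd ℂ) (h _ (hφ.mem_coreGraph hG h1))
    rw [map_add, inner_conj_symm, inner_conj_symm, map_zero] at h2
    exact h2
  rw [inner_zero_right, add_zero, ← inner_conj_symm]
  have h3 : ⟪realVec _ hone, α⟫_ℂ = 0 := by
    refine Complex.ext ?_ ?_
    · rw [re_inner_realVec hone]
      refine key (Lp.memLp α).re (Lp.memLp β).re fun φ hφ => ?_
      have h4 := congrArg Complex.re (h' φ hφ)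
      rw [Complex.add_re, re_inner_realVec (hφ.memLp_wMeasure hG h1 2),
        re_inner_realVec (h1.memLp_kolm hG hφ)] at h4
      exact h4
    · rw [im_inner_realVec hone]
      refine key (Lp.memLp α).im (Lp.memLp β).im fun φ hφ => ?_
      have h4 := congrArg Complex.im (h' φ hφ)
      rw [Complex.add_im, im_inner_realVec (hφ.memLp_wMeasure hG h1 2),
        im_inner_realVec (h1.memLp_kolm hG hφ)] at h4
      exact h4
  rw [h3, map_zero]

end Constants

/-! ### Conjugations and semigroups. -/

section Conjugation

variable {H : Type*} [NormedAddCommGroup H] [InnerProductSpace ℂ H]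

/-- A conjugation of a complex Hilbert space: an antilinear isometric involution. -/
structure IsConjugation (J : H →ₗᵢ⋆[ℂ] H) : Prop where
  involutive : ∀ x, J (J x) = x
  inner_map_map : ∀ x y, ⟪J x, J y⟫_ℂ = starRingEnd ℂ ⟪x, y⟫_ℂ

/-- The semigroup conjugated by an antilinear isometric involution. -/
def C0Semigroup.conj (T : C0Semigroup H) {J : H →ₗᵢ⋆[ℂ] H} (hJ : IsConjugation J) :
    C0Semigroup H where
  op t := J.toContinuousLinearMap.comp ((T.op t).comp J.toContinuousLinearMap)
  op_zero := by
    ext x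
    simp [T.op_zero, hJ.involutive]
  op_add s t := by
    ext x
    simp [T.op_add, hJ.involutive]
  tendsto_zero x := by
    have h := (J.continuous.tendsto _).comp (T.tendsto_zero (J x))
    rw [hJ.involutive] at h
    exact h

theorem C0Semigroup.conj_op_apply (T : C0Semigroup H) {J : H →ₗᵢ⋆[ℂ] H} (hJ : IsConjugation J)
    (t : ℝ≥0) (x : H) : (T.conj hJ).op t x = J (T.op t (J x)) := rfl

/-- Difference quotients at real times commute with `J`. With uniqueness this makes the semigroup of
a real generator commute with `J`. -/
theorem IsGenerator.conj {T : C0Semigroup H} {B : H →ₗ.[ℂ] H} (hT : IsGenerator T B)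
    {J : H →ₗᵢ⋆[ℂ] H} (hJ : IsConjugation J)
    (hB : ∀ x y, (x, y) ∈ B.graph → (J x, J y) ∈ B.graph) : IsGenerator (T.conj hJ) B := by
  intro x y
  have h1 : (x, y) ∈ B.graph ↔ (J x, J y) ∈ B.graph :=
    ⟨hB x y, fun h => by simpa only [hJ.involutive] using hB _ _ h⟩
  have h2 : J ∘ (fun t : ℝ≥0 => ((t : ℝ) : ℂ)⁻¹ • (T.op t (J x) - J x)) =
      fun t : ℝ≥0 => ((t : ℝ) : ℂ)⁻¹ • ((T.conj hJ).op t x - x) := by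
    funext t
    simp [C0Semigroup.conj_op_apply, hJ.involutive, map_smulₛₗ]
  rw [h1, hT, J.isometry.isEmbedding.tendsto_nhds_iff, h2, hJ.involutive]

theorem squareFormGraph_conj {L : H →ₗ.[ℂ] H} {J : H →ₗᵢ⋆[ℂ] H} (hJ : IsConjugation J)
    (hL : ∀ x y, (x, y) ∈ L.graph → (J x, J y) ∈ L.graph) {u w : H}
    (h : (u, w) ∈ squareFormGraph L) : (J u, J w) ∈ squareFormGraph L := by
  have key : ∀ v : L.domain, ∃ v' : L.domain, (v' : H) = J v ∧ L v' = J (L v) := fun v => by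
    obtain ⟨v', h1, h2⟩ := (LinearPMap.mem_graph_iff L).1 (hL _ _ (L.mem_graph v))
    exact ⟨v', h1, h2⟩
  obtain ⟨a, rfl, h2⟩ := h
  obtain ⟨a', h3, h4⟩ := key a
  refine ⟨a', h3, fun v => ?_⟩
  obtain ⟨v', h5, h6⟩ := key v
  have h7 := congrArg (starRingEnd ℂ) (h2 v')
  rw [h5, h6, ← hJ.inner_map_map, ← hJ.inner_map_map, hJ.involutive, hJ.involutive, ← h4] at h7
  exact h7

end Conjugation

/-! ### Kernel and dissipativity of the form operator. -/

section SquareForm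

variable {H : Type*} [NormedAddCommGroup H] [InnerProductSpace ℂ H]

theorem mem_neg_graph_iff {A : H →ₗ.[ℂ] H} {x y : H} :
    (x, y) ∈ (-A).graph ↔ (x, -y) ∈ A.graph := by
  rw [LinearPMap.mem_graph_iff, LinearPMap.mem_graph_iff]
  constructor
  · rintro ⟨a, h1, h2⟩
    refine ⟨a, h1, ?_⟩
    change A a = -y
    rw [← show (-A) a = y from h2, LinearPMap.neg_apply, neg_neg]
  · rintro ⟨a, h1, h2⟩
    refine ⟨a, h1, ?_⟩
    change (-A) a = y
    rw [LinearPMap.neg_apply, show A a = -y from h2, neg_neg]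

/-- `ker A = ker L`: the form at `(u, u)` is `‖Lu‖²`. -/
theorem mem_graph_zero_iff_squareFormGraph {L : H →ₗ.[ℂ] H} {x : H} :
    (x, 0) ∈ squareFormGraph L ↔ (x, 0) ∈ L.graph := by
  rw [LinearPMap.mem_graph_iff]
  constructor
  · rintro ⟨u, h1, h2⟩
    refine ⟨u, h1, ?_⟩
    have h3 := h2 u
    rw [inner_zero_right, inner_self_eq_zero] at h3
    exact h3
  · rintro ⟨u, h1, h2⟩
    refine ⟨u, h1, fun v => ?_⟩
    rw [show L u = 0 from h2, inner_zero_right, inner_zero_right]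

theorem re_inner_nonpos_of_mem_neg_graph {L : H →ₗ.[ℂ] H} (hd : Dense (L.domain : Set H)) {x y : H}
    (h : (x, y) ∈ (-squareFormOperator L).graph) : RCLike.re ⟪x, y⟫_ℂ ≤ 0 := by
  rw [mem_neg_graph_iff, squareFormOperator_graph hd] at h
  obtain ⟨u, rfl, h2⟩ := h
  have h3 := congrArg RCLike.re (h2 u)
  simp only [inner_neg_right, map_neg] at h3
  have h4 : 0 ≤ RCLike.re ⟪L u, L u⟫_ℂ := inner_self_nonneg
  linarith

end SquareForm

/-! ### Generation, smoothing and stability for the form operator. -/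

section Convergence

variable {H : Type*} [NormedAddCommGroup H] [InnerProductSpace ℂ H] [CompleteSpace H]

theorem exists_isGenerator_neg_squareFormOperator {L : H →ₗ.[ℂ] H}
    (hcl : IsClosed (L.graph : Set (H × H))) (hd : Dense (L.domain : Set H)) :
    ∃ T : C0Semigroup H, IsGenerator T (-squareFormOperator L) ∧
      (∀ n x, T.op 1 x ∈ powDomain (squareFormOperator L) n) ∧
      (∀ x, (∀ y, (y, 0) ∈ L.graph → ⟪y, x⟫_ℂ = 0) → Tendsto (T.op · x) atTop (𝓝 0)) ∧
      Dense ((-squareFormOperator L).domain : Set H) := by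
  obtain ⟨R, hR, hn, hdR, hRg⟩ := exists_resolvent L hcl hd
  have hA : ∀ u w, (u, w) ∈ (squareFormOperator L).graph ↔ R (u + w) = u := by
    rw [squareFormOperator_graph hd]
    exact hRg
  refine ⟨resolventSemigroup R hR hn hdR, isGenerator_resolventSemigroup hR hn hdR fun x y => ?_,
    resolventOp_one_mem_powDomain hR hA, fun x hx => ?_, ?_⟩
  · rw [mem_neg_graph_iff, hA, sub_eq_add_neg]
  -- The fixed vectors of `R = (1 + A)⁻¹` form `ker A`, which is `ker L`.
  · refine tendsto_resolventOp_atTop hR hn (mem_closure_range_one_sub hR fun y hy => hx y ?_)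
    rw [← mem_graph_zero_iff_squareFormGraph, hRg, add_zero, hy]
  · refine hdR.mono ?_
    rintro _ ⟨y, rfl⟩
    have h2 : (R y, R y - y) ∈ (-squareFormOperator L).graph := by
      rw [mem_neg_graph_iff, neg_sub, hA, add_sub_cancel]
    exact LinearPMap.mem_domain_of_mem_graph h2

end Convergence

/-! ### Complex conjugation on the complex `L²` space. -/

section ComplexConjugation

variable {α : Type*} [MeasurableSpace α] {μ : Measure α}

/-- Complex conjugation on `L^2`. -/
def conjL2 (μ : Measure α) : Lp ℂ 2 μ →ₗᵢ⋆[ℂ] Lp ℂ 2 μ where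
  toFun f := star f
  map_add' f g := by
    refine Lp.ext ?_
    filter_upwards [Lp.coeFn_star (f + g), Lp.coeFn_add f g, Lp.coeFn_add (star f) (star g),
      Lp.coeFn_star f, Lp.coeFn_star g] with x h1 h2 h3 h4 h5
    rw [h1, h3, Pi.star_apply, h2, Pi.add_apply, Pi.add_apply, h4, h5, star_add]
    rfl
  map_smul' c f := by
    refine Lp.ext ?_
    filter_upwards [Lp.coeFn_star (c • f), Lp.coeFn_smul c f, Lp.coeFn_smul (starRingEnd ℂ c) (star f),
      Lp.coeFn_star f] with x h1 h2 h3 h4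
    simp [h1, h2, h3, h4]
  norm_map' f := by
    change ‖star f‖ = ‖f‖
    rw [Lp.norm_def, Lp.norm_def]
    congr 1
    refine eLpNorm_congr_norm_ae ?_
    filter_upwards [Lp.coeFn_star f] with x h1
    simp [h1]

theorem coeFn_conjL2 (f : Lp ℂ 2 μ) : ∀ᵐ x ∂μ, conjL2 μ f x = starRingEnd ℂ (f x) :=
  Lp.coeFn_star f

theorem isConjugation_conjL2 (μ : Measure α) : IsConjugation (conjL2 μ) where
  involutive f := star_star f
  inner_map_map f g := by
    rw [L2.inner_def, L2.inner_def, ← integral_conj]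
    refine integral_congr_ae ?_
    filter_upwards [coeFn_conjL2 f, coeFn_conjL2 g] with x h1 h2
    simp [h1, h2]

end ComplexConjugation

/-! ### Reality of the bi-Kolmogorov operator and local `L^∞` bounds. -/

section Positivity

variable {N : ℕ} {ρ : Sp N → ℝ} {G : Sp N → Sp N}

theorem kolmogorovExpr_conj {φ : Sp N → ℂ} (hφ : ContDiff ℝ ∞ φ) (x : Sp N) :
    kolmogorovExpr ρ G (fun y => starRingEnd ℂ (φ y)) x =
      starRingEnd ℂ (kolmogorovExpr ρ G φ x) := by
  have h2 : ContDiffAt ℝ 2 φ x := (hφ.of_le (WithTop.coe_le_coe.mpr le_top)).contDiffAt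
  have e1 := ContDiffAt.laplacian_CLM_comp_left (l := (Complex.conjCLE : ℂ →L[ℝ] ℂ)) h2
  have e2 := ((Complex.conjCLE : ℂ →L[ℝ] ℂ).hasFDerivAt.comp x
    (hφ.differentiable (by simp) x).hasFDerivAt).fderiv
  change Laplacian.laplacian ((Complex.conjCLE : ℂ →L[ℝ] ℂ) ∘ φ) x +
    fderiv ℝ ((Complex.conjCLE : ℂ →L[ℝ] ℂ) ∘ φ) x _ = _
  rw [e1, e2]
  simp [kolmogorovExpr]

theorem kolmogorov_graph_conj (hG : HasWeakGradient ρ G) (h1 : HypothesisH1 ρ G)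
    (hρ : IsProbDensity ρ) (u w : L2 ρ) (h : (u, w) ∈ (kolmogorov ρ G).graph) :
    (conjL2 _ u, conjL2 _ w) ∈ (kolmogorov ρ G).graph := by
  rw [kolmogorov_graph hG h1 hρ] at h ⊢
  have h2 : (u, w) ∈ Prod.map (conjL2 (wMeasure ρ)) (conjL2 (wMeasure ρ)) ⁻¹'
      ((kolmogorovCoreGraph ρ G).topologicalClosure : Set (L2 ρ × L2 ρ)) := by
    refine closure_minimal (fun p hp => ?_) ((Submodule.isClosed_topologicalClosure _).preimage
      ((conjL2 _).continuous.prodMap (conjL2 _).continuous)) h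
    refine Submodule.le_topologicalClosure _ ?_
    obtain ⟨φ, h3, h4, h5, h6⟩ := hp
    refine ⟨fun y => starRingEnd ℂ (φ y), Complex.conjCLE.contDiff.comp h3,
      h4.comp_left (g := starRingEnd ℂ) (map_zero _), ?_, ?_⟩
    · filter_upwards [coeFn_conjL2 p.1, h5] with x h7 h8
      exact h7.trans (congrArg _ h8)
    · filter_upwards [coeFn_conjL2 p.2, h6] with x h7 h8
      rw [kolmogorovExpr_conj h3, ← h8]
      exact h7
  exact h2

theorem biKolmogorov_neg_graph_conj (hG : HasWeakGradient ρ G) (h1 : HypothesisH1 ρ G)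
    (hρ : IsProbDensity ρ) (u w : L2 ρ) (h : (u, w) ∈ (-biKolmogorov ρ G).graph) :
    (conjL2 _ u, conjL2 _ w) ∈ (-biKolmogorov ρ G).graph := by
  rw [mem_neg_graph_iff, biKolmogorov,
    squareFormOperator_graph (dense_kolmogorov_domain hG h1 hρ)] at h ⊢
  rw [← map_neg]
  exact squareFormGraph_conj (isConjugation_conjL2 _) (kolmogorov_graph_conj hG h1 hρ) h

/-- A bounded operator on `L^2(dμ)` with values in `L^∞_loc` is bounded into `L^∞(K)`. -/
theorem HypothesisH1.exists_continuousLinearMap_restrict (h1 : HypothesisH1 ρ G)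
    (S : L2 ρ →L[ℂ] L2 ρ) (hS : ∀ z, LocMemLp (S z : Sp N → ℂ) ⊤) {K : Set (Sp N)}
    (hK : IsCompact K) : ∃ Φ : L2 ρ →L[ℂ] Lp ℂ ⊤ (volume.restrict K),
      ∀ z, ∀ᵐ x ∂(volume.restrict K), Φ z x = S z x := by
  obtain ⟨c, hc, hle⟩ := h1.exists_restrict_le hK
  have hac : ∀ {P : Sp N → Prop}, (∀ᵐ x ∂(wMeasure ρ), P x) → ∀ᵐ x ∂(volume.restrict K), P x :=
    fun h => (Measure.absolutelyContinuous_of_le_smul hle).ae_le h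
  let g : L2 ρ →ₗ[ℂ] Lp ℂ ⊤ (volume.restrict K) :=
    { toFun := fun z => (hS z K hK).toLp (S z)
      map_add' := fun y z => by
        refine Lp.ext ?_
        filter_upwards [(hS (y + z) K hK).coeFn_toLp, (hS y K hK).coeFn_toLp,
          (hS z K hK).coeFn_toLp, Lp.coeFn_add ((hS y K hK).toLp (S y)) ((hS z K hK).toLp (S z)),
          hac (Lp.coeFn_add (S y) (S z))] with x h2 h3 h4 h5 h6
        rw [h2, h5, Pi.add_apply, h3, h4, map_add, h6, Pi.add_apply]
      map_smul' := fun a z => by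
        refine Lp.ext ?_
        filter_upwards [(hS (a • z) K hK).coeFn_toLp, (hS z K hK).coeFn_toLp,
          Lp.coeFn_smul a ((hS z K hK).toLp (S z)), hac (Lp.coeFn_smul a (S z))]
          with x h2 h4 h5 h6
        rw [h2, RingHom.id_apply, h5, Pi.smul_apply, h4, map_smul, h6, Pi.smul_apply] }
  have hg : ∀ z, ∀ᵐ x ∂(volume.restrict K), g z x = S z x := fun z => (hS z K hK).coeFn_toLp
  -- Closed graph theorem: convergence in `L^∞(K)` and in `L²(μ)` both imply convergence in measure
  -- on `K`, so the two limits agree.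
  refine ⟨⟨g, g.continuous_of_seq_closed_graph fun u z y hu hy => ?_⟩, hg⟩
  have m1 : TendstoInMeasure (volume.restrict K) (fun n => (g (u n) : Sp N → ℂ)) atTop y :=
    tendstoInMeasure_of_tendsto_Lp hy
  have m2 : TendstoInMeasure (wMeasure ρ) (fun n => (S (u n) : Sp N → ℂ)) atTop (S z) :=
    tendstoInMeasure_of_tendsto_Lp ((S.continuous.tendsto z).comp hu)
  have m3 : TendstoInMeasure (volume.restrict K) (fun n => (S (u n) : Sp N → ℂ)) atTop (S z) := by
    intro ε hε
    have h2 := ENNReal.Tendsto.const_mul (a := c) (m2 ε hε) (Or.inr hc)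
    rw [mul_zero] at h2
    exact tendsto_of_tendsto_of_tendsto_of_le_of_le tendsto_const_nhds h2
      (fun _ => zero_le) fun _ => hle _
  have m4 := m3.congr (fun n => (hg (u n)).mono fun x hx => hx.symm)
    (Filter.EventuallyEq.refl _ (S z : Sp N → ℂ))
  exact Lp.ext ((tendstoInMeasure_ae_unique m1 m4).trans ((hg z).mono fun x hx => hx.symm))

end Positivity

/-! ### Local eventual positivity. -/

section EventualPositivity

theorem ae_norm_le_norm_of_top {α : Type*} [MeasurableSpace α] {μ : Measure α} (f : Lp ℂ ⊤ μ) :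
    ∀ᵐ x ∂μ, ‖f x‖ ≤ ‖f‖ := by
  filter_upwards [enorm_ae_le_eLpNormEssSup f μ] with x hx
  rw [← eLpNorm_exponent_top, ← Lp.enorm_def] at hx
  exact enorm_le_iff_norm_le.1 hx

variable {N : ℕ} {ρ : Sp N → ℝ} {G : Sp N → Sp N}

theorem ae_im_eq_zero_of_conj {u : L2 ρ} (h : conjL2 _ u = u) :
    ∀ᵐ x ∂(wMeasure ρ), (u x).im = 0 := by
  have h2 := coeFn_conjL2 u
  rw [h] at h2
  filter_upwards [h2] with x hx
  exact Complex.conj_eq_iff_im.1 hx.symm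

theorem conj_eq_self_of_ae_im {u : L2 ρ} (h : ∀ᵐ x ∂(wMeasure ρ), (u x).im = 0) :
    conjL2 _ u = u := by
  refine Lp.ext ?_
  filter_upwards [coeFn_conjL2 u, h] with x h1 h2
  rw [h1, Complex.conj_eq_iff_im.2 h2]

theorem integral_re_pos (hρ : IsProbDensity ρ) (h1 : HypothesisH1 ρ G) {K : Set (Sp N)}
    {f u : L2 ρ} (hK : MeasurableSet K) (hu : ∀ᵐ x ∂(wMeasure ρ), u x = K.indicator f x)
    (hf : ∀ᵐ x ∂(volume.restrict K), 0 ≤ f x) (hf0 : 0 < volume {x | x ∈ K ∧ 0 < f x}) :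
    0 < ∫ x, (u x).re ∂(wMeasure ρ) := by
  have := hρ.isProbabilityMeasure
  rw [ae_restrict_iff' hK] at hf
  have hpos : ∀ᵐ x ∂(wMeasure ρ), 0 ≤ (u x).re := by
    filter_upwards [hu, (wMeasure_absolutelyContinuous ρ).ae_le hf] with x h2 h3
    rw [h2]
    by_cases hx : x ∈ K
    · rw [Set.indicator_of_mem hx]
      exact (Complex.nonneg_iff.1 (h3 hx)).1
    · rw [Set.indicator_of_notMem hx, Complex.zero_re]
  have hint : Integrable (fun x => (u x).re) (wMeasure ρ) :=
    ((Lp.memLp u).integrable (by norm_num)).re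
  rw [integral_pos_iff_support_of_nonneg_ae hpos hint]
  have h2 : wMeasure ρ {x | x ∈ K ∧ 0 < f x} ≠ 0 := fun h =>
    hf0.ne' (volume_absolutelyContinuous hρ h1 h)
  refine (pos_iff_ne_zero.2 h2).trans_le (measure_mono_ae ?_)
  filter_upwards [hu] with x h3 h4
  have h5 : 0 < f x := h4.2
  change (u x).re ≠ 0
  rw [h3, Set.indicator_of_mem h4.1]
  exact (Complex.pos_iff.1 h5).1.ne'

/-- The bi-Kolmogorov semigroup preserves real-valued functions. -/
theorem op_conj (hG : HasWeakGradient ρ G) (h1 : HypothesisH1 ρ G) (hρ : IsProbDensity ρ)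
    {T : C0Semigroup (L2 ρ)} (hT : IsGenerator T (-biKolmogorov ρ G))
    (hd : Dense ((-biKolmogorov ρ G).domain : Set (L2 ρ))) {u : L2 ρ} (hu : conjL2 _ u = u)
    (t : ℝ≥0) : conjL2 _ (T.op t u) = T.op t u := by
  have h2 := (hT.conj (isConjugation_conjL2 _) (biKolmogorov_neg_graph_conj hG h1 hρ)).op_eq hT
    (fun x y => re_inner_nonpos_of_mem_neg_graph (dense_kolmogorov_domain hG h1 hρ)) hd t
  have h3 := congrArg (fun S : L2 ρ →L[ℂ] L2 ρ => S u) h2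
  simp only [C0Semigroup.conj_op_apply, hu] at h3
  exact h3

/-- Split `χ_K f` into its mean `c` and a part orthogonal to the constants. The semigroup fixes the
first and sends the second to zero in `L²(μ)`; one more unit of time upgrades this to smallness in
`L^∞(K)`. -/
theorem locallyIndividuallyEventuallyPositive (hG : HasWeakGradient ρ G) (h1 : HypothesisH1 ρ G)
    (hρ : IsProbDensity ρ)
    {T : C0Semigroup (L2 ρ)} (hT : IsGenerator T (-biKolmogorov ρ G))
    (hd : Dense ((-biKolmogorov ρ G).domain : Set (L2 ρ)))
    (hloc : ∀ z, LocMemLp (T.op 1 z : Sp N → ℂ) ⊤)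
    (hlim : ∀ x, (∀ y, (y, 0) ∈ (kolmogorov ρ G).graph → ⟪y, x⟫_ℂ = 0) →
      Tendsto (T.op · x) atTop (𝓝 0)) :
    LocallyIndividuallyEventuallyPositive T := by
  intro K hK f hf hf0
  have hprob := hρ.isProbabilityMeasure
  have hone : MemLp (fun _ : Sp N => (1 : ℝ)) 2 (wMeasure ρ) := memLp_const 1
  set e : L2 ρ := realVec _ hone
  have he : ∀ᵐ x ∂(wMeasure ρ), e x = 1 := by simpa using! coeFn_realVec hone
  set u : L2 ρ := chiMul hK.measurableSet f
  have hu : ∀ᵐ x ∂(wMeasure ρ), u x = K.indicator f x := MemLp.coeFn_toLp _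
  have huim : ∀ᵐ x ∂(wMeasure ρ), (u x).im = 0 := by
    rw [ae_restrict_iff' hK.measurableSet] at hf
    filter_upwards [hu, (wMeasure_absolutelyContinuous ρ).ae_le hf] with x h2 h3
    rw [h2]
    by_cases hx : x ∈ K
    · rw [Set.indicator_of_mem hx]
      exact (Complex.nonneg_iff.1 (h3 hx)).2.symm
    · rw [Set.indicator_of_notMem hx, Complex.zero_im]
  have hureal : ∀ t, ∀ᵐ x ∂(wMeasure ρ), (T.op t u x).im = 0 := fun t =>
    ae_im_eq_zero_of_conj (op_conj hG h1 hρ hT hd (conj_eq_self_of_ae_im huim) t)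
  set c : ℝ := ∫ x, (u x).re ∂(wMeasure ρ)
  have hc : 0 < c := integral_re_pos hρ h1 hK.measurableSet hu hf hf0
  have heu : ⟪e, u⟫_ℂ = c := by
    refine Complex.ext ?_ ?_
    · rw [re_inner_realVec hone, Complex.ofReal_re]
      simp only [one_mul, c]
    · rw [im_inner_realVec hone, Complex.ofReal_im]
      refine integral_eq_zero_of_ae ?_
      filter_upwards [huim] with x hx
      simp [hx]
  have hee : ⟪e, e⟫_ℂ = 1 := by
    rw [inner_realVec hone, integral_congr_ae (g := fun _ => (1 : ℂ)) ?_]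
    · simp
    · filter_upwards [he] with x hx
      simp [hx]
  have hker : (e, (0 : L2 ρ)) ∈ (-biKolmogorov ρ G).graph := by
    rw [mem_neg_graph_iff, neg_zero, biKolmogorov,
      squareFormOperator_graph (dense_kolmogorov_domain hG h1 hρ),
      mem_graph_zero_iff_squareFormGraph, kolmogorov_graph hG h1 hρ]
    exact one_mem_closure hG h1 hρ hone
  have hTe : ∀ t, T.op t e = e := hT.op_eq_self hker
  have hlim0 : Tendsto (T.op · (u - (c : ℂ) • e)) atTop (𝓝 0) := by
    -- Every kernel element is a multiple of `e`, and `(e, u - ce) = c - c = 0`.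
    refine hlim _ fun y hy => ?_
    rw [kolmogorov_graph hG h1 hρ] at hy
    obtain ⟨a, ha⟩ := ae_eq_const_of_mem_closure hG h1 hρ hy
    have hya : y = a • e := by
      refine Lp.ext ?_
      filter_upwards [(wMeasure_absolutelyContinuous ρ).ae_le ha, he, Lp.coeFn_smul a e]
        with x h2 h3 h4
      rw [h2, h4, Pi.smul_apply, h3, smul_eq_mul, mul_one]
    rw [hya, inner_smul_left, inner_sub_right, inner_smul_right, heu, hee, mul_one, sub_self,
      mul_zero]
  obtain ⟨Φ, hΦ⟩ := h1.exists_continuousLinearMap_restrict (T.op 1) hloc hK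
  have hlim1 : Tendsto (fun t => Φ (T.op t (u - (c : ℂ) • e))) atTop (𝓝 0) := by
    have h2 := (Φ.continuous.tendsto 0).comp hlim0
    rwa [map_zero] at h2
  obtain ⟨t₁, ht₁⟩ := eventually_atTop.1 (Metric.tendsto_nhds.1 hlim1 (c / 2) (by positivity))
  -- The fluctuation is below `c/2` on `K` from time `t₁` on, after one further unit of time spent
  -- in the smoothing operator `T.op 1`.
  refine ⟨c / 2, by positivity, t₁ + 1, by positivity, fun t ht => ?_⟩
  set v : L2 ρ := T.op (t - 1) (u - (c : ℂ) • e)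
  have ht' : 1 + (t - 1) = t := add_tsub_cancel_of_le (le_add_self.trans ht)
  have hnorm : ‖Φ v‖ ≤ c / 2 := by
    have h2 := ht₁ (t - 1) (le_tsub_of_add_le_right ht)
    rw [dist_zero_right] at h2
    exact h2.le
  have hdecomp : T.op t u = (c : ℂ) • e + T.op 1 v := by
    rw [← T.op_add_apply, ht', map_sub, map_smul, hTe, add_sub_cancel]
  have hac : ∀ {P : Sp N → Prop}, (∀ᵐ x ∂(wMeasure ρ), P x) → ∀ᵐ x ∂(volume.restrict K), P x :=
    fun h => ae_restrict_of_ae ((volume_absolutelyContinuous hρ h1).ae_le h)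
  filter_upwards [hac (hureal t), hΦ v, ae_norm_le_norm_of_top (Φ v), hac he,
    hac (Lp.coeFn_add ((c : ℂ) • e) (T.op 1 v)), hac (Lp.coeFn_smul (c : ℂ) e)]
    with x h2 h3 h4 h5 h6 h7
  have h8 : T.op t u x = c + Φ v x := by
    rw [hdecomp, h6, Pi.add_apply, h7, Pi.smul_apply, h5, h3, smul_eq_mul, mul_one]
  -- The order on `ℂ` also demands equal imaginary parts; this is where reality of the semigroup
  -- enters.
  rw [Complex.le_def, h2, Complex.ofReal_im, h8, Complex.add_re, Complex.ofReal_re,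
    Complex.ofReal_re]
  have h9 := (abs_le.1 ((Complex.abs_re_le_norm _).trans (h4.trans hnorm))).1
  exact ⟨by linarith, rfl⟩

end EventualPositivity

end BiKolmogorov

end

theorem mainTheorem10 {N : ℕ} (ρ : Sp N → ℝ) (G : Sp N → Sp N)
    (hρ : IsProbDensity ρ) (hG : HasWeakGradient ρ G) (h1 : HypothesisH1 ρ G)
    (hA : ∃ n : ℕ, ∀ u ∈ powDomain (biKolmogorov ρ G) n, LocMemLp (u : Sp N → ℂ) (∞ : ℝ≥0∞)) :
    (∃ T : C0Semigroup (L2 ρ), IsGenerator T (-(biKolmogorov ρ G))) ∧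
    ∀ T : C0Semigroup (L2 ρ), IsGenerator T (-(biKolmogorov ρ G)) →
      LocallyIndividuallyEventuallyPositive T := by
  have hcl := kolmogorov_isClosed_graph hG h1 hρ
  have hdom := dense_kolmogorov_domain hG h1 hρ
  obtain ⟨S, hS, hpow, hlim, hd⟩ := exists_isGenerator_neg_squareFormOperator hcl hdom
  refine ⟨⟨S, hS⟩, fun T hT => ?_⟩
  -- Smoothing and stability are known only for the constructed semigroup; uniqueness transfers them
  -- to any other with the same generator.
  have hTS : ∀ t, T.op t = S.op t :=
    hT.op_eq hS (fun x y => re_inner_nonpos_of_mem_neg_graph hdom) hd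
  obtain ⟨n, hn⟩ := hA
  refine locallyIndividuallyEventuallyPositive hG h1 hρ hT hd (fun z => ?_) fun x hx => ?_
  · rw [hTS]
    exact hn _ (hpow n z)
  · simp only [hTS]
    exact hlim x hx
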